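/- Fix $\nu>0$ and a cutoff function $\varphi\in C^\infty(\mathbb R^3)$ of order one, i.e. $\varphi\in L^1$, $\int\varphi\,dx=1$ and $\int|x||\varphi(x)|\,dx<\infty$. Let $G^\nu_t(x)=(4\pi\nu t)^{-3/2}e^{-|x|^2/(4\nu t)}$ for $t>0$, with the convention $G^\nu_0*f=f$. Let $K(x)=-\frac1{4\pi}\frac{x}{|x|^3}$, $\varphi_\varepsilon(x)=\varepsilon^{-3}\varphi(x/\varepsilon)$, $K_\varepsilon=\varphi_\varepsilon*K$ for $\varepsilon>0$, $K_0=K$, and $\mathbf K^\varepsilon(w)(x)=\int_{\mathbb R^3}K_\varepsilon(x-y)\wedge w(y)\,dy$. For $\mathbf w,\mathbf v:[0,T]\times\mathbb R^3\to\mathbb R^3$ put $$\mathbf B^\varepsilon(\mathbf w,\mathbf v)(t,x)=\int_0^t\sum_{j=1}^3\int_{\mathbb R^3}\frac{\partial}{\partial y_j}\big[G^\nu_{t-s}(x-y)\big]\,\big[\mathbf K^\varepsilon(\mathbf w(s))_j(y)\,\mathbf v(s,y)-\mathbf v_j(s,y)\,\mathbf K^\varepsilon(\mathbf w(s))(y)\big]\,dy\,ds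 .$$ For $T>0$ let $|||\mathbf w|||_{0,p,T}=\sup_{0\le t\le T}\|\mathbf w(t)\|_p$ and $|||\mathbf w|||_{1,p,T}=\sup_{0\le t\le T}\{\|\mathbf w(t)\|_p+t^{1/2}\sum_{k=1}^3\|\partial\mathbf w(t)/\partial x_k\|_p\}$, where $\|\cdot\|_p$ is the norm of $L^p(\mathbb R^3)^3$, derivatives are weak, and the second term is read as $0$ at $t=0$. Let $\mathbf F_{i,p,T}$ ($i=0,1$) be the space of measurable functions $[0,T]\times\mathbb R^3\to\mathbb R^3$ with $\mathbf w(t)\in L^p(\mathbb R^3)^3$ for all $t\in[0,T]$ and $|||\mathbf w|||_{i,p,T}<\infty$; two elements are identified when they agree for every $t\in[0,T]$ almost everywhere in $x$. A pair $w_0:\mathbb R^3\to\mathbb R^3$, $\mathbf g:[0,T]\times\mathbb R^3\to\mathbb R^3$ (measurable) satisfies $(\mathrm H_p)$ on $[0,T]$ if $w_0\in L^p(\mathbb R^3)^3$, $\mathbf g(t,\cdot)\in L^p(\mathbb R^3)^3$ for all $t\in[0,T]$, $|||\mathbf g|||_{0,p,T}<\infty$, and $\operatorname{div}w_0=0$,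 $\operatorname{div}\mathbf g(t,\cdot)=0$ for all $t\in[0,T]$ in the sense of distributions. Put $\mathbf w_0(t,x)=G^\nu_t*w_0(x)+\int_0^tG^\nu_{t-s}*\mathbf g(s,\cdot)(x)\,ds$ and consider, for $\varepsilon\ge0$, the equation $$\mathbf v=\mathbf w_0+\mathbf B^\varepsilon(\mathbf v,\mathbf v),\qquad(\ast)_\varepsilon$$ understood for every $t\in[0,T]$ and almost every $x\in\mathbb R^3$. **Theorem.** Let $\frac32<p<3$. (a) For every $T>0$, every $w_0,\mathbf g$ satisfying $(\mathrm H_p)$ on $[0,T]$ and every $\varepsilon\ge0$, equation $(\ast)_\varepsilon$ has at most one solution in $\mathbf F_{0,p,T}$. (b) There is a constant $\Gamma_0(p)>0$ (depending only on $p$, $\nu$ and $\varphi$, and in particular not on $\varepsilon$) such that for all $T>0$ and all $w_0,\mathbf g$ satisfying $(\mathrm H_p)$ on $[0,T]$ and $$T^{1-\frac{3}{2p}}\big(\|w_0\|_p+T\,|||\mathbf g|||_{0,p,T}\big)<\Gamma_0(p),$$ one has $\mathbf w_0\in\mathbf F_{1,p,T}$, and for every $\varepsilon\ge0$ equation $(\ast)_\varepsilon$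 has a solution $\mathbf w^\varepsilon\in\mathbf F_{1,p,T}$, for which all the integrals in the equation converge absolutely (for almost every $x$). Moreover $$\sup_{\varepsilon\ge0}|||\mathbf w^\varepsilon|||_{1,p,T}\le2\,|||\mathbf w_0|||_{1,p,T}.$$ -/

import Mathlib

open MeasureTheory Set
open scoped ENNReal ContDiff

namespace VortexMild

noncomputable section

/-- Three-dimensional Euclidean space. -/
abbrev E3 : Type := EuclideanSpace ℝ (Fin 3)

/-- The `k`-th vector of the canonical basis. -/
def basisVec (k : Fin 3) : E3 := EuclideanSpace.single k (1 : ℝ)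

/-- The vectorial product `a ∧ b` of `ℝ³`. -/
def wedge (a b : E3) : E3 :=
  WithLp.toLp 2 (crossProduct (WithLp.ofLp a) (WithLp.ofLp b))

/-! ### Heat kernel -/

/-- `G^ν_t(x) = (4πνt)^{-3/2} exp(-|x|²/(4νt))`, for `t > 0`. -/
def heatKernel (ν t : ℝ) (x : E3) : ℝ :=
  (4 * Real.pi * ν * t) ^ (-(3 / 2 : ℝ)) * Real.exp (-‖x‖ ^ 2 / (4 * ν * t))

/-- `G^ν_t * f` for `t > 0`, and `f` itself for `t = 0`. -/
def heatSemigroup (ν t : ℝ) (f : E3 → E3) (x : E3) : E3 :=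
  if t = 0 then f x else ∫ y, heatKernel ν t (x - y) • f y

/-- The partial derivative with respect to `y_j` of `y ↦ G^ν_t(x - y)`. -/
def heatKernelPartial (ν t : ℝ) (j : Fin 3) (x y : E3) : ℝ :=
  fderiv ℝ (fun z : E3 => heatKernel ν t (x - z)) y (basisVec j)

/-! ### Biot--Savart kernel and its mollifications -/

/-- `K(x) = -(1/4π) x/|x|³`. -/
def bsKernel (x : E3) : E3 := (-(1 / (4 * Real.pi)) * (‖x‖ ^ 3)⁻¹) • x

/-- A cutoff function of order one. -/
structure IsCutoff (φ : E3 → ℝ) : Prop where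
  smooth : ContDiff ℝ ∞ φ
  integrable : Integrable φ
  integral_eq_one : ∫ x, φ x = 1
  moment : Integrable (fun x : E3 => ‖x‖ * |φ x|)

/-- `φ_ε(x) = ε⁻³ φ(x/ε)`. -/
def rescale (φ : E3 → ℝ) (ε : ℝ) (x : E3) : ℝ := (ε⁻¹) ^ 3 * φ (ε⁻¹ • x)

/-- `K_ε = φ_ε * K` for `ε > 0`, and `K_0 = K`. -/
def bsKernelMoll (φ : E3 → ℝ) (ε : ℝ) (x : E3) : E3 :=
  if ε = 0 then bsKernel x else ∫ y, rescale φ ε (x - y) • bsKernel y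

/-- `K^ε(w)(x) = ∫ K_ε(x - y) ∧ w(y) dy`. -/
def biotSavart (φ : E3 → ℝ) (ε : ℝ) (w : E3 → E3) (x : E3) : E3 :=
  ∫ y, wedge (bsKernelMoll φ ε (x - y)) (w y)

/-! ### The mild equation -/

/-- `w₀(t,x) = G_t * w₀ (x) + ∫_0^t G_{t-s} * g(s,·) (x) ds`. -/
def mildData (ν : ℝ) (w₀ : E3 → E3) (g : ℝ → E3 → E3) (t : ℝ) (x : E3) : E3 :=
  heatSemigroup ν t w₀ x + ∫ s in (0 : ℝ)..t, heatSemigroup ν (t - s) (g s) x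

/-- The `j`-th summand of the integrand of the bilinear operator, at time `s` and position `y`:
`∂_{y_j} [G_{t-s}(x - y)] (K^ε(w)_j(s,y) v(s,y) - v_j(s,y) K^ε(w)(s,y))`. -/
def bilIntegrand (ν : ℝ) (φ : E3 → ℝ) (ε : ℝ) (w v : ℝ → E3 → E3) (t : ℝ) (x : E3)
    (j : Fin 3) (s : ℝ) (y : E3) : E3 :=
  heatKernelPartial ν (t - s) j x y •
    ((biotSavart φ ε (w s) y) j • v s y - (v s y) j • biotSavart φ ε (w s) y)

/-- The bilinear operator `B^ε(w, v)`. -/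
def bil (ν : ℝ) (φ : E3 → ℝ) (ε : ℝ) (w v : ℝ → E3 → E3) (t : ℝ) (x : E3) : E3 :=
  ∫ s in (0 : ℝ)..t, ∑ j : Fin 3, ∫ y, bilIntegrand ν φ ε w v t x j s y

/-- `v = w₀ + B^ε(v, v)` on `[0,T]`: for every time, almost everywhere in space. -/
def IsMildSolution (ν : ℝ) (φ : E3 → ℝ) (ε T : ℝ) (w₀ : E3 → E3) (g : ℝ → E3 → E3)
    (v : ℝ → E3 → E3) : Prop :=
  ∀ t ∈ Icc (0 : ℝ) T, ∀ᵐ x : E3, v t x = mildData ν w₀ g t x + bil ν φ ε v v t x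

/-- All integrals in the equation `v = w₀ + B^ε(v, v)` on `[0,T]` converge absolutely. -/
structure IntegralsConverge (ν : ℝ) (φ : E3 → ℝ) (ε T : ℝ) (w₀ : E3 → E3) (g : ℝ → E3 → E3)
    (v : ℝ → E3 → E3) : Prop where
  initial : ∀ t ∈ Ioc (0 : ℝ) T, ∀ᵐ x : E3, Integrable (fun y => heatKernel ν t (x - y) • w₀ y)
  force : ∀ t ∈ Icc (0 : ℝ) T, ∀ᵐ x : E3,
    Integrable (fun q : ℝ × E3 => heatKernel ν (t - q.1) (x - q.2) • g q.1 q.2)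
      ((volume.restrict (Ioo 0 t)).prod volume)
  biotSavart : ∀ t ∈ Icc (0 : ℝ) T, ∀ᵐ x : E3,
    Integrable (fun y => wedge (bsKernelMoll φ ε (x - y)) (v t y))
  bilinear : ∀ t ∈ Icc (0 : ℝ) T, ∀ᵐ x : E3, ∀ j : Fin 3,
    Integrable (fun q : ℝ × E3 => bilIntegrand ν φ ε v v t x j q.1 q.2)
      ((volume.restrict (Ioo 0 t)).prod volume)

/-! ### Weak derivatives and function spaces -/

/-- `d` is the weak partial derivative `∂f/∂x_k`. -/
def HasWeakPartial (k : Fin 3) (f d : E3 → E3) : Prop :=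
  LocallyIntegrable f ∧ LocallyIntegrable d ∧
    ∀ ψ : E3 → ℝ, ContDiff ℝ ∞ ψ → HasCompactSupport ψ →
      ∫ x, (fderiv ℝ ψ x (basisVec k)) • f x = -∫ x, ψ x • d x

/-- `‖∂f/∂x_k‖_p`, equal to `∞` if `f` has no weak partial derivative. The infimum only
selects the weak derivative, which is unique almost everywhere. -/
def weakPartialNorm (p : ℝ) (k : Fin 3) (f : E3 → E3) : ℝ≥0∞ :=
  ⨅ (d : E3 → E3) (_ : HasWeakPartial k f d), eLpNorm d (ENNReal.ofReal p) volume

/-- `|||w|||_{0,p,T} = sup_{0 ≤ t ≤ T} ‖w(t)‖_p`. -/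
def normF0 (p T : ℝ) (w : ℝ → E3 → E3) : ℝ≥0∞ :=
  ⨆ t ∈ Icc (0 : ℝ) T, eLpNorm (w t) (ENNReal.ofReal p) volume

/-- `|||w|||_{1,p,T} = sup_{0 ≤ t ≤ T} { ‖w(t)‖_p + t^{1/2} ∑_k ‖∂w(t)/∂x_k‖_p }`,
with `0 · ∞ = 0` at `t = 0`. -/
def normF1 (p T : ℝ) (w : ℝ → E3 → E3) : ℝ≥0∞ :=
  ⨆ t ∈ Icc (0 : ℝ) T, (eLpNorm (w t) (ENNReal.ofReal p) volume +
    ENNReal.ofReal (t ^ (1 / 2 : ℝ)) * ∑ k : Fin 3, weakPartialNorm p k (w t))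

/-- Joint (Lebesgue) measurability on `[0,T] × ℝ³`. -/
def JointlyMeasurable (T : ℝ) (w : ℝ → E3 → E3) : Prop :=
  AEStronglyMeasurable (fun q : ℝ × E3 => w q.1 q.2)
    ((volume.restrict (Icc (0 : ℝ) T)).prod volume)

/-- Membership in the space `F_{0,p,T}`. -/
structure MemF0 (p T : ℝ) (w : ℝ → E3 → E3) : Prop where
  measurable : JointlyMeasurable T w
  memLp : ∀ t ∈ Icc (0 : ℝ) T, MemLp (w t) (ENNReal.ofReal p) volume
  norm_lt_top : normF0 p T w < ⊤

/-- Membership in the space `F_{1,p,T}`. -/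
structure MemF1 (p T : ℝ) (w : ℝ → E3 → E3) : Prop where
  measurable : JointlyMeasurable T w
  memLp : ∀ t ∈ Icc (0 : ℝ) T, MemLp (w t) (ENNReal.ofReal p) volume
  norm_lt_top : normF1 p T w < ⊤

/-- Null divergence in the distribution sense. -/
def DivFree (w : E3 → E3) : Prop :=
  ∀ f : E3 → ℝ, ContDiff ℝ ∞ f → HasCompactSupport f → ∫ x, fderiv ℝ f x (w x) = 0

/-- The hypothesis `(H_p)` on the initial vorticity `w₀` and the external field `g`. -/
structure HypH (p T : ℝ) (w₀ : E3 → E3) (g : ℝ → E3 → E3) : Prop where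
  memLp_init : MemLp w₀ (ENNReal.ofReal p) volume
  measurable_force : JointlyMeasurable T g
  memLp_force : ∀ t ∈ Icc (0 : ℝ) T, MemLp (g t) (ENNReal.ofReal p) volume
  force_bounded : normF0 p T g < ⊤
  div_init : DivFree w₀
  div_force : ∀ t ∈ Icc (0 : ℝ) T, DivFree (g t)

end

end VortexMild

namespace VortexMild

noncomputable section

/-! ### Lebesgue norms and convolutions of nonnegative functions -/

/-! Everything rests on one estimate at a fixed time, `lpn_triAbs_le`: with τ = t - s, the
convolution of |∇G_τ| with (|K_ε| * |w|)|v| has L^p norm at most C τ^(-3/(2p)) ‖w‖_p ‖v‖_p,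
uniformly in ε. The size |x|⁻² of K lies in no L^q, so the kernel is cut at radius √τ. The inner
part lies in L^q for q < 3/2 and the outer part for q > 3/2. Young and Hölder then apply with q =
2p/(2p-1) and q = p/(p-1), which is where 3/2 < p and p < 3 enter, and scaling gives both pieces the
same power of τ. Mollification costs only ‖φ_ε‖_1 = ‖φ‖_1. Since 3/(2p) < 1, the power is integrable
in time, and Minkowski's inequality bounds B^ε(w,v)(t) in L^p (`lpn_bilAbs_le`, `vn_bil_le`). The
estimates are made for nonnegative majorants in `ℝ≥0∞`, so they also give absolute convergence for
almost every x (`ae_bilInt`), without which B^ε, built from Bochner integrals, need not be additive.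

Uniqueness (`mild_solution_unique`): two solutions differ by B^ε(v-v',v) + B^ε(v',v-v'). In the norm
sup_t e^(-lt) ‖v(t)-v'(t)‖_p with l large, the right side has norm at most half that of v-v',
whatever T and the sizes of v and v' are.

Existence (`exists_fixed_point`): the Picard iteration is run on a field together with its three
candidate derivatives, indexed by `Option (Fin 3)`, where the derivative components follow the
Leibniz rule ∂_k B(w,w) = B(∂_k w,w) + B(w,∂_k w). The weight t^(1/2) is preserved because the Beta
integral of (t-s)^(-3/(2p)) s^(-1/2) over (0,t) is a multiple of t^(1-3/(2p)) t^(-1/2). If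
T^(1-3/(2p)) times the size of the data is small, the ball of radius 2|||w_0|||_{1,p,T} is stable
and the map halves distances there, with constants free of ε.

That the extra components are true derivatives is proved separately. The predicate `Tame` asks that
difference quotients converge in L^p with parabolic bounds. The heat flow of the data is `Tame`
(`tame_mildData`), and B^ε preserves the property since it commutes with translations (`Tame.bil`).
Hence each iterate has the expected weak derivatives, and these survive the L^p limit
(`hasWeakPartial_of_tendsto`). -/

/-- The `L^q` norm of a nonnegative function. -/
def lpn (q : ℝ) (f : E3 → ℝ≥0∞) : ℝ≥0∞ := (∫⁻ x, f x ^ q) ^ (1 / q)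

/-- The convolution of nonnegative functions. -/
def cv (f g : E3 → ℝ≥0∞) (x : E3) : ℝ≥0∞ := ∫⁻ y, f (x - y) * g y

theorem eLpNorm_eq_lpn {F : Type*} [NormedAddCommGroup F] {q : ℝ} (hq : 0 < q) (f : E3 → F) :
    eLpNorm f (ENNReal.ofReal q) volume = lpn q (fun x => ‖f x‖ₑ) := by
  rw [eLpNorm_eq_lintegral_rpow_enorm_toReal (by simpa using hq) ENNReal.ofReal_ne_top,
    ENNReal.toReal_ofReal hq.le, lpn]

theorem lpn_mono {q : ℝ} (hq : 0 < q) {f g : E3 → ℝ≥0∞} (h : ∀ᵐ x, f x ≤ g x) :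
    lpn q f ≤ lpn q g := by
  unfold lpn
  gcongr 1
  refine lintegral_mono_ae ?_
  filter_upwards [h] with x hx
  gcongr

theorem lpn_congr {q : ℝ} {f g : E3 → ℝ≥0∞} (h : f =ᵐ[volume] g) : lpn q f = lpn q g := by
  unfold lpn
  congr 1
  refine lintegral_congr_ae ?_
  filter_upwards [h] with x hx
  rw [hx]

theorem lpn_const_mul {q : ℝ} (hq : 0 < q) {f : E3 → ℝ≥0∞} (hf : Measurable f) (c : ℝ≥0∞) :
    lpn q (fun x => c * f x) = c * lpn q f := by
  unfold lpn
  simp_rw [ENNReal.mul_rpow_of_nonneg _ _ hq.le]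
  rw [lintegral_const_mul _ (hf.pow_const q), ENNReal.mul_rpow_of_nonneg _ _ (by positivity),
    ← ENNReal.rpow_mul, mul_one_div_cancel hq.ne', ENNReal.rpow_one]

theorem lpn_add_le {q : ℝ} (hq : 1 ≤ q) {f g : E3 → ℝ≥0∞} (hf : Measurable f)
    (hg : Measurable g) : lpn q (fun x => f x + g x) ≤ lpn q f + lpn q g :=
  ENNReal.lintegral_Lp_add_le hf.aemeasurable hg.aemeasurable hq

theorem lpn_one (f : E3 → ℝ≥0∞) : lpn 1 f = ∫⁻ x, f x := by simp [lpn]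

theorem ae_lt_top_of_lpn {q : ℝ} (hq : 0 < q) {f : E3 → ℝ≥0∞} (hf : Measurable f)
    (h : lpn q f < ⊤) : ∀ᵐ x, f x < ⊤ := by
  have h1 : ∫⁻ x, f x ^ q ≠ ⊤ := by
    intro h2
    simp [lpn, h2, hq] at h
  filter_upwards [ae_lt_top (hf.pow_const q) h1] with x hx
  by_contra h3
  simp only [not_lt, top_le_iff] at h3
  simp [h3, hq] at hx

theorem lintegral_comp_smul_E3 (f : E3 → ℝ≥0∞) {c : ℝ} (hc : 0 < c) :
    ∫⁻ x, f (c • x) = ENNReal.ofReal (c ^ (-3 : ℝ)) * ∫⁻ x, f x := by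
  have h := lintegral_map_equiv (μ := (volume : Measure E3)) f
    (MeasurableEquiv.smul (Units.mk0 c hc.ne') : E3 ≃ᵐ E3)
  have h2 : Measure.map (MeasurableEquiv.smul (Units.mk0 c hc.ne') : E3 ≃ᵐ E3) volume
      = ENNReal.ofReal |(c ^ 3)⁻¹| • (volume : Measure E3) := by
    have := Measure.map_addHaar_smul (volume : Measure E3) hc.ne'
    simpa using this
  rw [h2, lintegral_smul_measure] at h
  have h3 : |(c ^ 3)⁻¹| = c ^ (-3 : ℝ) := by
    rw [abs_of_pos (by positivity), Real.rpow_neg hc.le]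
    norm_num
  rw [h3] at h
  simpa using h.symm

theorem lpn_comp_smul {q : ℝ} (hq : 0 < q) (f : E3 → ℝ≥0∞) {c : ℝ} (hc : 0 < c) :
    lpn q (fun x => f (c • x)) = ENNReal.ofReal (c ^ (-3 / q)) * lpn q f := by
  unfold lpn
  rw [lintegral_comp_smul_E3 (fun x => f x ^ q) hc, ENNReal.mul_rpow_of_nonneg _ _ (by positivity),
    ENNReal.ofReal_rpow_of_pos (by positivity), ← Real.rpow_mul hc.le]
  congr 3
  ring

theorem lpn_comp_add {q : ℝ} (f : E3 → ℝ≥0∞) (h : E3) :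
    lpn q (fun x => f (x + h)) = lpn q f := by
  unfold lpn
  rw [lintegral_add_right_eq_self (fun x => f x ^ q) h]

theorem measurable_cv {f g : E3 → ℝ≥0∞} (hf : Measurable f) (hg : Measurable g) :
    Measurable (cv f g) := by
  unfold cv
  fun_prop

theorem cv_mono {f f' g g' : E3 → ℝ≥0∞} (hf : ∀ x, f x ≤ f' x) (hg : ∀ x, g x ≤ g' x) (x : E3) :
    cv f g x ≤ cv f' g' x := by
  unfold cv
  gcongr with y
  · exact hf _
  · exact hg _

theorem cv_add_left {f f' g : E3 → ℝ≥0∞} (hf : Measurable f) (hg : Measurable g) (x : E3) :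
    cv (fun z => f z + f' z) g x = cv f g x + cv f' g x := by
  unfold cv
  simp_rw [add_mul]
  rw [lintegral_add_left (by fun_prop)]

theorem lintegral_sub_left_E3 (f : E3 → ℝ≥0∞) (x : E3) : ∫⁻ y, f (x - y) = ∫⁻ y, f y :=
  lintegral_sub_left_eq_self f x

/-- Minkowski's integral inequality. -/
theorem lpn_lintegral_le {α : Type*} [MeasurableSpace α] {μ : Measure α} [SFinite μ] {q : ℝ}
    (hq : 1 < q) {F : α → E3 → ℝ≥0∞} (hF : Measurable (Function.uncurry F)) :
    lpn q (fun x => ∫⁻ s, F s x ∂μ) ≤ ∫⁻ s, lpn q (F s) ∂μ := by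
  have hq0 : 0 < q := by linarith
  set h : α → ℝ≥0∞ := fun s => lpn q (F s) with hh
  have hhm : Measurable h := by
    have : Measurable fun s => ∫⁻ x, F s x ^ q :=
      Measurable.lintegral_prod_right' (f := fun z : α × E3 => F z.1 z.2 ^ q) (hF.pow_const q)
    exact this.pow_const _
  by_cases htop : ∫⁻ s, h s ∂μ = ⊤
  · rw [htop]; exact le_top
  have hfin : ∀ᵐ s ∂μ, h s < ⊤ := ae_lt_top hhm htop
  have hFx : ∀ x, Measurable fun s => F s x := fun x => hF.comp (measurable_id.prodMk measurable_const)
  have hFs : ∀ s, Measurable (F s) := fun s => hF.comp (measurable_const.prodMk measurable_id)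
  -- almost everywhere factorisation
  have hfac : ∀ᵐ x : E3, ∀ᵐ s ∂μ, F s x = (F s x / h s) * h s := by
    have hms : MeasurableSet {z : α × E3 | F z.1 z.2 = (F z.1 z.2 / h z.1) * h z.1} :=
      measurableSet_eq_fun hF ((hF.div (hhm.comp measurable_fst)).mul (hhm.comp measurable_fst))
    have h1 : ∀ᵐ s ∂μ, ∀ᵐ x : E3, F s x = (F s x / h s) * h s := by
      filter_upwards [hfin] with s hs
      -- If the slice has zero norm it vanishes almost everywhere, so the value of 0/0 is harmless.
      by_cases h0 : h s = 0
      · have : ∫⁻ x, F s x ^ q = 0 := by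
          simp only [hh, lpn] at h0
          rcases ENNReal.rpow_eq_zero_iff.1 h0 with h2 | h2
          · exact h2.1
          · have : 0 < 1 / q := by positivity
            linarith [h2.2]
        rw [lintegral_eq_zero_iff ((hFs s).pow_const q)] at this
        filter_upwards [this] with x hx
        have : F s x = 0 := by
          simpa [hq0, hq0.le, not_lt.2 hq0.le] using hx
        simp [this]
      · exact Filter.Eventually.of_forall fun x => (ENNReal.div_mul_cancel h0 hs.ne).symm
    exact Measure.ae_ae_comm hms |>.1 h1
  have hq' : 0 < q - 1 := by linarith
  set I := ∫⁻ s, h s ∂μ with hI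
  have hconj : q.HolderConjugate (q / (q - 1)) := Real.HolderConjugate.conjExponent hq
  -- Hölder in s after writing F = (F/h) h^(1/q) · h^((q-1)/q); the second factor integrates to I.
  -- Each F/h has L^q norm at most one in x, so integrating in x afterwards costs one more factor I.
  have key : ∀ᵐ x : E3, (∫⁻ s, F s x ∂μ) ^ q ≤ I ^ (q - 1) * ∫⁻ s, (F s x / h s) ^ q * h s ∂μ := by
    filter_upwards [hfac] with x hx
    have e1 : ∫⁻ s, F s x ∂μ
        = ∫⁻ s, ((fun s => (F s x / h s) * h s ^ (1 / q)) * fun s => h s ^ ((q - 1) / q)) s ∂μ := by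
      refine lintegral_congr_ae ?_
      filter_upwards [hx] with s hs
      rw [hs]
      simp only [Pi.mul_apply]
      rw [← hs, mul_assoc, ← ENNReal.rpow_add_of_nonneg _ _ (by positivity) (by positivity),
        ← add_div, add_sub_cancel, div_self hq0.ne', ENNReal.rpow_one, ← hs]
    have e2 := ENNReal.lintegral_mul_le_Lp_mul_Lq μ hconj
      (f := fun s => (F s x / h s) * h s ^ (1 / q)) (g := fun s => h s ^ ((q - 1) / q))
      (((hFx x).div hhm).mul (hhm.pow_const _)).aemeasurable (hhm.pow_const _).aemeasurable
    rw [e1]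
    calc _ ≤ ((∫⁻ s, ((F s x / h s) * h s ^ (1 / q)) ^ q ∂μ) ^ (1 / q)
          * (∫⁻ s, (h s ^ ((q - 1) / q)) ^ (q / (q - 1)) ∂μ) ^ (1 / (q / (q - 1)))) ^ q := by
          gcongr
      _ = _ := by
          rw [ENNReal.mul_rpow_of_nonneg _ _ hq0.le, ← ENNReal.rpow_mul, ← ENNReal.rpow_mul,
            mul_comm]
          have : ∀ s, (h s ^ ((q - 1) / q)) ^ (q / (q - 1)) = h s := fun s => by
            rw [← ENNReal.rpow_mul, div_mul_div_cancel₀ hq0.ne', div_self hq'.ne', ENNReal.rpow_one]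
          simp_rw [this]
          congr 1
          · congr 1
            field_simp
          · rw [one_div_mul_cancel hq0.ne', ENNReal.rpow_one]
            refine lintegral_congr fun s => ?_
            rw [ENNReal.mul_rpow_of_nonneg _ _ hq0.le, ← ENNReal.rpow_mul,
              one_div_mul_cancel hq0.ne', ENNReal.rpow_one]
  have hfin2 : ∫⁻ x, (∫⁻ s, F s x ∂μ) ^ q ≤ I ^ q := by
    calc _ ≤ ∫⁻ x, I ^ (q - 1) * ∫⁻ s, (F s x / h s) ^ q * h s ∂μ := lintegral_mono_ae key
      _ = I ^ (q - 1) * ∫⁻ x, ∫⁻ s, (F s x / h s) ^ q * h s ∂μ := by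
          rw [lintegral_const_mul']
          exact ENNReal.rpow_ne_top_of_nonneg hq'.le htop
      _ = I ^ (q - 1) * ∫⁻ s, (∫⁻ x, (F s x / h s) ^ q * h s) ∂μ := by
          rw [lintegral_lintegral_swap]
          exact ((((hF.comp measurable_swap).div (hhm.comp measurable_snd)).pow_const q).mul
            (hhm.comp measurable_snd)).aemeasurable
      _ ≤ I ^ (q - 1) * I := by
          gcongr 1
          refine lintegral_mono_ae ?_
          filter_upwards [hfin] with s hs
          rw [lintegral_mul_const _ (((hFs s).div_const _).pow_const q)]
          by_cases h0 : h s = 0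
          · simp [h0]
          have : ∫⁻ x, (F s x / h s) ^ q = 1 := by
            simp_rw [div_eq_mul_inv, ENNReal.mul_rpow_of_nonneg _ _ hq0.le]
            rw [lintegral_mul_const _ ((hFs s).pow_const q), ENNReal.inv_rpow]
            have : h s ^ q = ∫⁻ x, F s x ^ q := by
              simp only [hh, lpn]
              rw [← ENNReal.rpow_mul, one_div_mul_cancel hq0.ne', ENNReal.rpow_one]
            rw [← this]
            refine ENNReal.mul_inv_cancel ?_ (ENNReal.rpow_ne_top_of_nonneg hq0.le hs.ne)
            simp [ENNReal.rpow_eq_zero_iff, h0, hs.ne]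
          rw [this, one_mul]
      _ = I ^ q := by
          nth_rw 2 [← ENNReal.rpow_one I]
          rw [← ENNReal.rpow_add_of_nonneg _ _ hq'.le zero_le_one, sub_add_cancel]
  calc lpn q (fun x => ∫⁻ s, F s x ∂μ) ≤ (I ^ q) ^ (1 / q) := by unfold lpn; gcongr
    _ = I := by rw [← ENNReal.rpow_mul, mul_one_div_cancel hq0.ne', ENNReal.rpow_one]

/-- Young's convolution inequality. -/
theorem lpn_cv_le {a b r : ℝ} (ha : 1 ≤ a) (hb : 1 ≤ b) (hr : 0 < r)
    (h : 1 / a + 1 / b = 1 + 1 / r) {f g : E3 → ℝ≥0∞} (hf : Measurable f) (hg : Measurable g) :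
    lpn r (cv f g) ≤ lpn a f * lpn b g := by
  have ha0 : 0 < a := by linarith
  have hb0 : 0 < b := by linarith
  have h1a : 1 / a ≤ 1 := by rw [div_le_one ha0]; exact ha
  have h1b : 1 / b ≤ 1 := by rw [div_le_one hb0]; exact hb
  have ea : 0 ≤ 1 / a - 1 / r := by linarith
  have eb : 0 ≤ 1 / b - 1 / r := by linarith
  have er : 0 ≤ 1 / r := by positivity
  set X := ∫⁻ x, f x ^ a with hX
  set Y := ∫⁻ x, g x ^ b with hY
  have key : ∀ x, cv f g x ≤ (∫⁻ y, f (x - y) ^ a * g y ^ b) ^ (1 / r) *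
      (X ^ (1 / a - 1 / r) * Y ^ (1 / b - 1 / r)) := by
    intro x
    -- Three-factor Hölder with weights 1/r, 1/a - 1/r, 1/b - 1/r, whose sum is one by the relation
    -- between the exponents. Only the first factor still depends on x, and Fubini integrates its
    -- r-th power exactly.
    have H := ENNReal.lintegral_prod_norm_pow_le (μ := (volume : Measure E3)) Finset.univ
      (f := ![fun y => f (x - y) ^ a * g y ^ b, fun y => f (x - y) ^ a, fun y => g y ^ b])
      (p := ![1 / r, 1 / a - 1 / r, 1 / b - 1 / r]) ?_ ?_ ?_
    · simp only [Fin.prod_univ_three] at H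
      change ∫⁻ y, (f (x - y) ^ a * g y ^ b) ^ (1 / r) * (f (x - y) ^ a) ^ (1 / a - 1 / r) *
        (g y ^ b) ^ (1 / b - 1 / r) ≤ (∫⁻ y, f (x - y) ^ a * g y ^ b) ^ (1 / r) *
        (∫⁻ y, f (x - y) ^ a) ^ (1 / a - 1 / r) * (∫⁻ y, g y ^ b) ^ (1 / b - 1 / r) at H
      rw [lintegral_sub_left_E3 (fun z => f z ^ a) x, mul_assoc] at H
      refine le_trans (le_of_eq ?_) H
      unfold cv
      refine lintegral_congr fun y => ?_
      rw [ENNReal.mul_rpow_of_nonneg _ _ er, ← ENNReal.rpow_mul, ← ENNReal.rpow_mul,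
        ← ENNReal.rpow_mul, ← ENNReal.rpow_mul]
      have e1 : f (x - y) = f (x - y) ^ (a * (1 / r)) * f (x - y) ^ (a * (1 / a - 1 / r)) := by
        rw [← ENNReal.rpow_add_of_nonneg _ _ (by positivity) (by positivity), ← mul_add]
        rw [add_sub_cancel, mul_one_div_cancel ha0.ne', ENNReal.rpow_one]
      have e2 : g y = g y ^ (b * (1 / r)) * g y ^ (b * (1 / b - 1 / r)) := by
        rw [← ENNReal.rpow_add_of_nonneg _ _ (by positivity) (by positivity), ← mul_add]
        rw [add_sub_cancel, mul_one_div_cancel hb0.ne', ENNReal.rpow_one]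
      nth_rw 1 [e1, e2]
      ring
    · intro i _
      fin_cases i
      · exact (((hf.comp (measurable_const.sub measurable_id)).pow_const a).mul
          (hg.pow_const b)).aemeasurable
      · exact ((hf.comp (measurable_const.sub measurable_id)).pow_const a).aemeasurable
      · exact (hg.pow_const b).aemeasurable
    · simp [Fin.sum_univ_three]
      simp at h
      linarith
    · intro i _
      fin_cases i
      · exact er
      · exact ea
      · exact eb
  set W := X ^ (1 / a - 1 / r) * Y ^ (1 / b - 1 / r) with hW
  have m1 : Measurable (cv (fun z => f z ^ a) fun z => g z ^ b) :=
    measurable_cv (hf.pow_const a) (hg.pow_const b)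
  have hsw : ∫⁻ x, ∫⁻ y, f (x - y) ^ a * g y ^ b = X * Y := by
    rw [lintegral_lintegral_swap]
    · simp_rw [fun y : E3 => lintegral_mul_const (g y ^ b) (μ := volume)
        (f := fun x => f (x - y) ^ a) (by fun_prop)]
      have e : ∀ y : E3, ∫⁻ x, f (x - y) ^ a = X := fun y =>
        lintegral_sub_right_eq_self (fun z => f z ^ a) y
      simp_rw [e]
      rw [lintegral_const_mul _ (hg.pow_const b)]
    · have : Measurable fun z : E3 × E3 => f (z.1 - z.2) ^ a * g z.2 ^ b := by fun_prop
      exact this.aemeasurable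
  calc lpn r (cv f g)
      ≤ lpn r (fun x => W * (∫⁻ y, f (x - y) ^ a * g y ^ b) ^ (1 / r)) := by
        refine lpn_mono hr (Filter.Eventually.of_forall fun x => ?_)
        rw [mul_comm]; exact key x
    _ = W * lpn r (fun x => (∫⁻ y, f (x - y) ^ a * g y ^ b) ^ (1 / r)) :=
        lpn_const_mul hr (m1.pow_const _) _
    _ = W * (X * Y) ^ (1 / r) := by
        congr 1
        unfold lpn
        simp_rw [← ENNReal.rpow_mul, one_div_mul_cancel hr.ne', ENNReal.rpow_one]
        rw [hsw]
    _ = (X ^ (1 / a - 1 / r) * X ^ (1 / r)) * (Y ^ (1 / b - 1 / r) * Y ^ (1 / r)) := by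
        rw [ENNReal.mul_rpow_of_nonneg _ _ er, hW]; ring
    _ = lpn a f * lpn b g := by
        rw [← ENNReal.rpow_add_of_nonneg _ _ ea er, ← ENNReal.rpow_add_of_nonneg _ _ eb er,
          sub_add_cancel, sub_add_cancel]
        rfl

/-- The endpoint r = ∞ of Young's inequality, where Hölder alone gives a bound at every point. -/
theorem cv_le_of_holderConjugate {a b : ℝ} (hab : a.HolderConjugate b) {f g : E3 → ℝ≥0∞}
    (hf : Measurable f) (hg : Measurable g) (x : E3) : cv f g x ≤ lpn a f * lpn b g := by
  have H := ENNReal.lintegral_mul_le_Lp_mul_Lq (volume : Measure E3) hab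
    (f := fun y => f (x - y)) (g := g) (by fun_prop) hg.aemeasurable
  rw [lintegral_sub_left_E3 (fun z => f z ^ a) x] at H
  exact H

theorem lpn_cv_le_one {q : ℝ} (hq : 1 ≤ q) {f g : E3 → ℝ≥0∞}
    (hf : Measurable f) (hg : Measurable g) : lpn q (cv f g) ≤ (∫⁻ x, f x) * lpn q g := by
  rw [← lpn_one]
  exact lpn_cv_le le_rfl hq (by linarith) (by simp) hf hg

theorem lpn_mul_le {a b r : ℝ} (ha : 0 < a) (hb : 0 < b) (hr : 0 < r)
    (h : 1 / r = 1 / a + 1 / b) {f g : E3 → ℝ≥0∞} (hf : Measurable f) (hg : Measurable g) :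
    lpn r (fun x => f x * g x) ≤ lpn a f * lpn b g := by
  refine ENNReal.lintegral_Lp_mul_le_Lq_mul_Lr hr ?_ h volume hf.aemeasurable hg.aemeasurable
  have h1 : 1 / a < 1 / r := by
    have : 0 < 1 / b := by positivity
    linarith
  exact (one_div_lt_one_div ha hr).1 h1

/-! ### Estimates of the kernels -/

/-- Polar coordinates in dimension three; r² is the Jacobian. -/
theorem lintegral_radial_lt_top {f : ℝ → ℝ} (hf : IntegrableOn (fun r => r ^ 2 * f r) (Ioi 0)) :
    ∫⁻ x : E3, ENNReal.ofReal (f ‖x‖) < ⊤ := by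
  have h : Integrable (fun x : E3 => f ‖x‖) := by
    rw [integrable_fun_norm_addHaar]
    simpa [E3] using hf
  exact h.lintegral_lt_top

theorem lpn_lt_top {q : ℝ} (hq : 0 < q) {f : E3 → ℝ≥0∞} (h : ∫⁻ x, f x ^ q < ⊤) :
    lpn q f < ⊤ :=
  ENNReal.rpow_lt_top_of_nonneg (by positivity) h.ne

/-- The size of the heat kernel. -/
def gk (ν τ : ℝ) (z : E3) : ℝ≥0∞ := ENNReal.ofReal (heatKernel ν τ z)

/-- The size of the gradient of the heat kernel. -/
def hk (ν τ : ℝ) (z : E3) : ℝ≥0∞ := ENNReal.ofReal (‖z‖ / (2 * ν * τ) * heatKernel ν τ z)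

theorem heatKernel_nonneg {ν τ : ℝ} (hν : 0 < ν) (hτ : 0 < τ) (z : E3) : 0 ≤ heatKernel ν τ z := by
  unfold heatKernel
  positivity

theorem measurable_heatKernel (ν : ℝ) :
    Measurable fun q : ℝ × E3 => heatKernel ν q.1 q.2 := by
  unfold heatKernel
  fun_prop

theorem measurable_gk (ν τ : ℝ) : Measurable (gk ν τ) :=
  ((measurable_heatKernel ν).comp (measurable_const.prodMk measurable_id)).ennreal_ofReal

theorem measurable_hk_uncurry (ν : ℝ) : Measurable fun q : ℝ × E3 => hk ν q.1 q.2 := by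
  have := measurable_heatKernel ν
  unfold hk
  fun_prop

theorem measurable_hk (ν τ : ℝ) : Measurable (hk ν τ) :=
  Measurable.of_uncurry_left (f := hk ν) (measurable_hk_uncurry ν)

theorem hasFDerivAt_heatKernel (ν τ : ℝ) (z : E3) :
    HasFDerivAt (heatKernel ν τ)
      ((-(2 / (4 * ν * τ)) * heatKernel ν τ z) • innerSL ℝ z) z := by
  have h1 : HasFDerivAt (fun z : E3 => ‖z‖ ^ 2) (2 • innerSL ℝ z) z :=
    (hasStrictFDerivAt_norm_sq z).hasFDerivAt
  have h2 := ((h1.neg.mul_const (4 * ν * τ)⁻¹).exp).const_mul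
    ((4 * Real.pi * ν * τ) ^ (-(3 / 2 : ℝ)))
  have e : heatKernel ν τ = fun z : E3 => (4 * Real.pi * ν * τ) ^ (-(3 / 2 : ℝ)) *
      Real.exp (-‖z‖ ^ 2 * (4 * ν * τ)⁻¹) := by
    ext z
    simp only [heatKernel, div_eq_mul_inv]
  rw [e]
  refine HasFDerivAt.congr_fderiv (f' := (4 * Real.pi * ν * τ) ^ (-(3 / 2 : ℝ)) •
    Real.exp (-‖z‖ ^ 2 * (4 * ν * τ)⁻¹) • (4 * ν * τ)⁻¹ • -(2 • innerSL ℝ z)) h2 ?_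
  simp only [smul_smul, ← neg_smul, ← Nat.cast_smul_eq_nsmul ℝ]
  congr 1
  push_cast
  ring

theorem heatKernelPartial_eq (ν τ : ℝ) (j : Fin 3) (x y : E3) :
    heatKernelPartial ν τ j x y = (x - y) j / (2 * ν * τ) * heatKernel ν τ (x - y) := by
  unfold heatKernelPartial
  have h1 : HasFDerivAt (fun z : E3 => x - z) (-ContinuousLinearMap.id ℝ E3) y :=
    (hasFDerivAt_id y).const_sub x
  have h := (hasFDerivAt_heatKernel ν τ (x - y)).comp y h1
  rw [show (fun z : E3 => heatKernel ν τ (x - z)) = heatKernel ν τ ∘ (fun z => x - z) from rfl,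
    h.fderiv]
  have e : (4 * ν * τ) = 2 * (2 * ν * τ) := by ring
  simp only [ContinuousLinearMap.comp_apply, smul_apply, innerSL_apply_apply,
    neg_apply, ContinuousLinearMap.id_apply, basisVec, smul_eq_mul,
    inner_neg_right, EuclideanSpace.inner_single_right, e]
  simp
  rw [div_mul_eq_div_div, div_self (two_ne_zero)]
  ring

theorem abs_coord_le (z : E3) (j : Fin 3) : |z j| ≤ ‖z‖ := by
  simpa using PiLp.norm_apply_le z j

theorem enorm_heatKernelPartial_le {ν τ : ℝ} (hν : 0 < ν) (hτ : 0 < τ) (j : Fin 3) (x y : E3) :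
    ‖heatKernelPartial ν τ j x y‖ₑ ≤ hk ν τ (x - y) := by
  rw [heatKernelPartial_eq, Real.enorm_eq_ofReal_abs, hk, abs_mul, abs_div,
    abs_of_nonneg (heatKernel_nonneg hν hτ _), abs_of_pos (show 0 < 2 * ν * τ by positivity)]
  have := heatKernel_nonneg hν hτ (x - y)
  gcongr
  exact abs_coord_le _ _

theorem heatKernel_scale {ν τ : ℝ} (hν : 0 < ν) (hτ : 0 < τ) (z : E3) :
    heatKernel ν τ z = τ ^ (-(3 / 2) : ℝ) * heatKernel ν 1 (τ ^ (-(1 / 2) : ℝ) • z) := by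
  unfold heatKernel
  rw [Real.mul_rpow (by positivity) hτ.le, norm_smul, Real.norm_of_nonneg (by positivity), mul_one,
    mul_pow, ← Real.rpow_natCast (τ ^ (-(1 / 2) : ℝ)) 2, ← Real.rpow_mul hτ.le]
  have : (-(1 / 2) : ℝ) * ((2 : ℕ) : ℝ) = -1 := by norm_num
  rw [this, Real.rpow_neg_one]
  have e : -‖z‖ ^ 2 / (4 * ν * τ) = -(τ⁻¹ * ‖z‖ ^ 2) / (4 * ν * 1) := by
    field_simp
  rw [e]
  ring

theorem gk_scale {ν τ : ℝ} (hν : 0 < ν) (hτ : 0 < τ) (z : E3) :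
    gk ν τ z = ENNReal.ofReal (τ ^ (-(3 / 2) : ℝ)) * gk ν 1 (τ ^ (-(1 / 2) : ℝ) • z) := by
  rw [gk, heatKernel_scale hν hτ, ENNReal.ofReal_mul (by positivity), gk]

theorem hk_scale {ν τ : ℝ} (hν : 0 < ν) (hτ : 0 < τ) (z : E3) :
    hk ν τ z = ENNReal.ofReal (τ ^ (-2 : ℝ)) * hk ν 1 (τ ^ (-(1 / 2) : ℝ) • z) := by
  rw [hk, heatKernel_scale hν hτ, hk, ← ENNReal.ofReal_mul (by positivity), norm_smul,
    Real.norm_of_nonneg (by positivity)]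
  congr 1
  have e : τ ^ (-2 : ℝ) * τ ^ (-(1 / 2) : ℝ) = τ ^ (-(3 / 2) : ℝ) * τ⁻¹ := by
    rw [← Real.rpow_neg_one τ, ← Real.rpow_add hτ, ← Real.rpow_add hτ]
    norm_num
  calc _ = (τ ^ (-(3 / 2) : ℝ) * τ⁻¹) * (‖z‖ / (2 * ν * 1) *
        heatKernel ν 1 (τ ^ (-(1 / 2) : ℝ) • z)) := by
        field_simp
    _ = _ := by rw [← e]; ring

/-- All the kernels are self-similar, so each norm is an explicit power of the scale times its value
at scale one. Parabolic kernels use γ = 1/2, the pieces of the Biot–Savart kernel γ = 1. -/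
theorem lpn_scale {q θ τ : ℝ} (hq : 0 < q) (hτ : 0 < τ) {f g : E3 → ℝ≥0∞} (hg : Measurable g)
    (γ : ℝ) (h : ∀ z, f z = ENNReal.ofReal (τ ^ θ) * g (τ ^ (-γ) • z)) :
    lpn q f = ENNReal.ofReal (τ ^ (θ + 3 * γ / q)) * lpn q g := by
  rw [show f = _ from funext h, lpn_const_mul hq (by fun_prop),
    lpn_comp_smul hq g (by positivity), ← mul_assoc, ← ENNReal.ofReal_mul (by positivity),
    ← Real.rpow_mul hτ.le, ← Real.rpow_add hτ]
  congr 4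
  ring

theorem lpn_hk {ν τ q : ℝ} (hν : 0 < ν) (hτ : 0 < τ) (hq : 0 < q) :
    lpn q (hk ν τ) = ENNReal.ofReal (τ ^ (-2 + 3 / (2 * q))) * lpn q (hk ν 1) := by
  rw [lpn_scale hq hτ (measurable_hk ν 1) _ (hk_scale hν hτ)]
  congr 4
  field_simp

theorem lpn_gk {ν τ : ℝ} (hν : 0 < ν) (hτ : 0 < τ) :
    lpn 1 (gk ν τ) = lpn 1 (gk ν 1) := by
  rw [lpn_scale one_pos hτ (measurable_gk ν 1) _ (gk_scale hν hτ)]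
  norm_num

theorem integrableOn_pow_mul_gaussian {a b : ℝ} (ha : 0 ≤ a) (hb : 0 < b) (c : ℝ) :
    IntegrableOn (fun r : ℝ => r ^ 2 * (c * (r ^ a * Real.exp (-b * r ^ 2)))) (Ioi 0) := by
  have h := (integrableOn_rpow_mul_exp_neg_mul_sq hb (s := a + 2) (by linarith)).const_mul c
  refine IntegrableOn.congr_fun h (fun r hr => ?_) measurableSet_Ioi
  have hr : 0 < r := hr
  rw [Real.rpow_add hr]
  norm_cast
  ring

theorem lpn_hk_lt_top {ν q : ℝ} (hν : 0 < ν) (hq : 0 < q) : lpn q (hk ν 1) < ⊤ := by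
  refine lpn_lt_top hq ?_
  have h := lintegral_radial_lt_top (integrableOn_pow_mul_gaussian hq.le
    (show 0 < q / (4 * ν) by positivity)
    (((2 * ν)⁻¹ * (4 * Real.pi * ν * 1) ^ (-(3 / 2 : ℝ))) ^ q))
  refine lt_of_le_of_lt (lintegral_mono fun z => le_of_eq ?_) h
  have := heatKernel_nonneg hν one_pos z
  rw [hk, ENNReal.ofReal_rpow_of_nonneg (by positivity) hq.le]
  congr 1
  unfold heatKernel
  have e : ‖z‖ / (2 * ν * 1) * ((4 * Real.pi * ν * 1) ^ (-(3 / 2 : ℝ)) *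
      Real.exp (-‖z‖ ^ 2 / (4 * ν * 1))) = ((2 * ν)⁻¹ * (4 * Real.pi * ν * 1) ^ (-(3 / 2 : ℝ))) *
      (‖z‖ * Real.exp (-‖z‖ ^ 2 / (4 * ν * 1))) := by
    rw [mul_one]; field_simp
  rw [e, Real.mul_rpow (by positivity) (by positivity), Real.mul_rpow (by positivity)
    (Real.exp_pos _).le, ← Real.exp_mul]
  congr 3
  field_simp

theorem lintegral_gk_lt_top {ν : ℝ} (hν : 0 < ν) : lpn 1 (gk ν 1) < ⊤ := by
  rw [lpn_one]
  have h := lintegral_radial_lt_top (integrableOn_pow_mul_gaussian le_rfl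
    (show 0 < 1 / (4 * ν) by positivity) ((4 * Real.pi * ν * 1) ^ (-(3 / 2 : ℝ))))
  refine lt_of_le_of_lt (lintegral_mono fun z => le_of_eq ?_) h
  rw [gk, heatKernel, Real.rpow_zero, one_mul]
  congr 3
  field_simp

/-! ### Size of the Biot–Savart kernel, cut at a radius. -/

/-- The inner part of the size of the Biot--Savart kernel. -/
def bsIn (R : ℝ) (z : E3) : ℝ≥0∞ :=
  ENNReal.ofReal ((Iio R).indicator (fun r => (r ^ 2)⁻¹) ‖z‖)

/-- The outer part of the size of the Biot--Savart kernel. -/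
def bsOut (R : ℝ) (z : E3) : ℝ≥0∞ :=
  ENNReal.ofReal ((Ici R).indicator (fun r => (r ^ 2)⁻¹) ‖z‖)

theorem measurable_bsIn (R : ℝ) : Measurable (bsIn R) := by
  have : Measurable ((Iio R).indicator fun r : ℝ => (r ^ 2)⁻¹) :=
    Measurable.indicator (by fun_prop) measurableSet_Iio
  exact (this.comp measurable_norm).ennreal_ofReal

theorem measurable_bsOut (R : ℝ) : Measurable (bsOut R) := by
  have : Measurable ((Ici R).indicator fun r : ℝ => (r ^ 2)⁻¹) :=
    Measurable.indicator (by fun_prop) measurableSet_Ici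
  exact (this.comp measurable_norm).ennreal_ofReal

theorem enorm_bsKernel_le (R : ℝ) (z : E3) : ‖bsKernel z‖ₑ ≤ bsIn R z + bsOut R z := by
  have h : ‖bsKernel z‖ ≤ (‖z‖ ^ 2)⁻¹ := by
    unfold bsKernel
    rw [norm_smul, norm_mul, norm_neg, Real.norm_of_nonneg (by positivity),
      Real.norm_of_nonneg (by positivity)]
    -- At the origin both sides vanish, by the convention that the inverse of zero is zero.
    rcases eq_or_ne z 0 with rfl | hz
    · simp
    have hz : 0 < ‖z‖ := norm_pos_iff.2 hz
    have h1 : 1 / (4 * Real.pi) ≤ 1 := by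
      rw [div_le_one (by positivity)]
      linarith [Real.pi_gt_three]
    calc 1 / (4 * Real.pi) * (‖z‖ ^ 3)⁻¹ * ‖z‖ = 1 / (4 * Real.pi) * (‖z‖ ^ 2)⁻¹ := by field_simp
      _ ≤ 1 * (‖z‖ ^ 2)⁻¹ := by gcongr
      _ = _ := one_mul _
  rw [← ofReal_norm]
  by_cases hR : ‖z‖ < R
  · have : bsIn R z = ENNReal.ofReal (‖z‖ ^ 2)⁻¹ := by simp [bsIn, hR]
    rw [this]
    exact le_add_right (ENNReal.ofReal_le_ofReal h)
  · have : bsOut R z = ENNReal.ofReal (‖z‖ ^ 2)⁻¹ := by simp [bsOut, not_lt.1 hR]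
    rw [this]
    exact le_add_left (ENNReal.ofReal_le_ofReal h)

theorem bsIn_scale {R : ℝ} (hR : 0 < R) (z : E3) :
    bsIn R z = ENNReal.ofReal (R ^ (-2 : ℝ)) * bsIn 1 (R ^ (-1 : ℝ) • z) := by
  rw [bsIn, bsIn, ← ENNReal.ofReal_mul (by positivity), norm_smul,
    Real.norm_of_nonneg (by positivity), Real.rpow_neg_one, Real.rpow_neg hR.le]
  congr 1
  have h : R⁻¹ * ‖z‖ < 1 ↔ ‖z‖ < R := by rw [inv_mul_lt_iff₀ hR, mul_one]
  simp only [indicator, mem_Iio, h]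
  split_ifs
  · norm_cast
    rw [← mul_inv, mul_pow, ← mul_assoc]
    field_simp
  · simp

theorem bsOut_scale {R : ℝ} (hR : 0 < R) (z : E3) :
    bsOut R z = ENNReal.ofReal (R ^ (-2 : ℝ)) * bsOut 1 (R ^ (-1 : ℝ) • z) := by
  rw [bsOut, bsOut, ← ENNReal.ofReal_mul (by positivity), norm_smul,
    Real.norm_of_nonneg (by positivity), Real.rpow_neg_one, Real.rpow_neg hR.le]
  congr 1
  have h : 1 ≤ R⁻¹ * ‖z‖ ↔ R ≤ ‖z‖ := by rw [le_inv_mul_iff₀ hR, mul_one]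
  simp only [indicator, mem_Ici, h]
  split_ifs
  · norm_cast
    rw [← mul_inv, mul_pow, ← mul_assoc]
    field_simp
  · simp

theorem lpn_bsIn {R q : ℝ} (hR : 0 < R) (hq : 0 < q) :
    lpn q (bsIn R) = ENNReal.ofReal (R ^ (-2 + 3 / q)) * lpn q (bsIn 1) := by
  rw [lpn_scale hq hR (measurable_bsIn 1) _ (bsIn_scale hR), mul_one]

theorem lpn_bsOut {R q : ℝ} (hR : 0 < R) (hq : 0 < q) :
    lpn q (bsOut R) = ENNReal.ofReal (R ^ (-2 + 3 / q)) * lpn q (bsOut 1) := by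
  rw [lpn_scale hq hR (measurable_bsOut 1) _ (bsOut_scale hR), mul_one]

theorem sq_mul_inv_sq_rpow {r : ℝ} (hr : 0 < r) (q : ℝ) :
    r ^ 2 * ((r ^ 2)⁻¹) ^ q = r ^ (2 - 2 * q) := by
  rw [← Real.rpow_natCast, Real.inv_rpow (by positivity), ← Real.rpow_mul hr.le,
    ← Real.rpow_neg hr.le, ← Real.rpow_add hr]
  norm_num
  congr 1

/-- In polar coordinates the integrand is r^(2-2q), integrable at the origin exactly when q < 3/2.
-/
theorem lpn_bsIn_lt_top {q : ℝ} (hq : 0 < q) (hq2 : q < 3 / 2) : lpn q (bsIn 1) < ⊤ := by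
  refine lpn_lt_top hq ?_
  have hi : IntegrableOn (fun r : ℝ => r ^ 2 * (Iio 1).indicator (fun r => ((r ^ 2)⁻¹) ^ q) r)
      (Ioi 0) := by
    have h1 : IntegrableOn (fun r : ℝ => r ^ (2 - 2 * q)) (Ioo 0 1) :=
      (intervalIntegral.integrableOn_Ioo_rpow_iff one_pos).2 (by linarith)
    have h2 : IntegrableOn (fun r : ℝ => r ^ 2 * ((r ^ 2)⁻¹) ^ q) (Ioo 0 1) :=
      h1.congr_fun (fun r hr => (sq_mul_inv_sq_rpow hr.1 q).symm) measurableSet_Ioo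
    rw [← integrable_indicator_iff measurableSet_Ioo] at h2
    rw [← integrable_indicator_iff measurableSet_Ioi]
    refine h2.congr (Filter.Eventually.of_forall fun r => ?_)
    simp only [indicator, mem_Ioo, mem_Ioi, mem_Iio]
    split_ifs <;> simp_all
  refine lt_of_le_of_lt (lintegral_mono fun z => le_of_eq ?_) (lintegral_radial_lt_top hi)
  unfold bsIn
  rw [ENNReal.ofReal_rpow_of_nonneg (indicator_nonneg (fun r _ => by positivity) _) hq.le]
  congr 1
  simp only [indicator]
  split_ifs
  · rfl
  · exact Real.zero_rpow hq.ne'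

/-- The same power r^(2-2q) is integrable at infinity exactly when q > 3/2. -/
theorem lpn_bsOut_lt_top {q : ℝ} (hq2 : 3 / 2 < q) : lpn q (bsOut 1) < ⊤ := by
  have hq : 0 < q := by linarith
  refine lpn_lt_top hq ?_
  have hi : IntegrableOn (fun r : ℝ => r ^ 2 * (Ici 1).indicator (fun r => ((r ^ 2)⁻¹) ^ q) r)
      (Ioi 0) := by
    have h1 : IntegrableOn (fun r : ℝ => r ^ (2 - 2 * q)) (Ioi 1) :=
      (integrableOn_Ioi_rpow_iff one_pos).2 (by linarith)
    have h2 : IntegrableOn (fun r : ℝ => r ^ 2 * ((r ^ 2)⁻¹) ^ q) (Ioi 1) :=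
      h1.congr_fun (fun r hr => (sq_mul_inv_sq_rpow (one_pos.trans hr) q).symm) measurableSet_Ioi
    rw [← integrableOn_Ici_iff_integrableOn_Ioi, ← integrable_indicator_iff measurableSet_Ici] at h2
    rw [← integrable_indicator_iff measurableSet_Ioi]
    refine h2.congr (Filter.Eventually.of_forall fun r => ?_)
    simp only [indicator, mem_Ioi, mem_Ici]
    split_ifs <;> first | rfl | linarith
  refine lt_of_le_of_lt (lintegral_mono fun z => le_of_eq ?_) (lintegral_radial_lt_top hi)
  unfold bsOut
  rw [ENNReal.ofReal_rpow_of_nonneg (indicator_nonneg (fun r _ => by positivity) _) hq.le]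
  congr 1
  simp only [indicator]
  split_ifs
  · rfl
  · exact Real.zero_rpow hq.ne'

/-! ### The basic trilinear estimate -/

theorem measurable_bsKernel : Measurable bsKernel := by
  unfold bsKernel
  fun_prop

theorem IsCutoff.measurable_rescale {φ : E3 → ℝ} (hφ : IsCutoff φ) (ε : ℝ) :
    Measurable (rescale φ ε) := by
  have := hφ.smooth.continuous.measurable
  unfold rescale
  fun_prop

theorem IsCutoff.measurable_bsKernelMoll {φ : E3 → ℝ} (hφ : IsCutoff φ) (ε : ℝ) :
    Measurable (bsKernelMoll φ ε) := by
  by_cases h : ε = 0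
  · have : bsKernelMoll φ ε = bsKernel := by ext1 x; simp [bsKernelMoll, h]
    rw [this]
    exact measurable_bsKernel
  · have : bsKernelMoll φ ε = fun x => ∫ y, rescale φ ε (x - y) • bsKernel y := by
      ext1 x; simp [bsKernelMoll, h]
    rw [this]
    refine StronglyMeasurable.measurable ?_
    refine StronglyMeasurable.integral_prod_right
      (f := fun (x : E3) (y : E3) => rescale φ ε (x - y) • bsKernel y) ?_
    have h1 := hφ.measurable_rescale ε
    have h2 := measurable_bsKernel
    refine Measurable.stronglyMeasurable ?_
    simp only [Function.uncurry_def]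
    fun_prop

/-- The size of the mollified Biot--Savart kernel. -/
def kabs (φ : E3 → ℝ) (ε : ℝ) (z : E3) : ℝ≥0∞ := ‖bsKernelMoll φ ε z‖ₑ

theorem IsCutoff.measurable_kabs {φ : E3 → ℝ} (hφ : IsCutoff φ) (ε : ℝ) :
    Measurable (kabs φ ε) := (hφ.measurable_bsKernelMoll ε).enorm

/-- Mollification at scale `ε` of a nonnegative kernel, trivial for `ε = 0`. -/
def mollAbs (φ : E3 → ℝ) (ε : ℝ) (f : E3 → ℝ≥0∞) : E3 → ℝ≥0∞ :=
  if ε = 0 then f else cv (fun z => ‖rescale φ ε z‖ₑ) f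

theorem IsCutoff.measurable_mollAbs {φ : E3 → ℝ} (hφ : IsCutoff φ) (ε : ℝ) {f : E3 → ℝ≥0∞}
    (hf : Measurable f) : Measurable (mollAbs φ ε f) := by
  unfold mollAbs
  split_ifs
  · exact hf
  · exact measurable_cv (hφ.measurable_rescale ε).enorm hf

/-- The kernel is cut first and each piece mollified afterwards, so that each piece keeps its own
integrability class for every ε. -/
theorem IsCutoff.kabs_le {φ : E3 → ℝ} (hφ : IsCutoff φ) (ε R : ℝ) (z : E3) :
    kabs φ ε z ≤ mollAbs φ ε (bsIn R) z + mollAbs φ ε (bsOut R) z := by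
  unfold kabs mollAbs bsKernelMoll
  split_ifs with h
  · exact enorm_bsKernel_le R z
  · have hm := (hφ.measurable_rescale ε).enorm
    have hi := measurable_bsIn R
    calc _ ≤ ∫⁻ y, ‖rescale φ ε (z - y) • bsKernel y‖ₑ := enorm_integral_le_lintegral_enorm _
      _ ≤ ∫⁻ y, (‖rescale φ ε (z - y)‖ₑ * bsIn R y + ‖rescale φ ε (z - y)‖ₑ * bsOut R y) := by
          refine lintegral_mono fun y => ?_
          rw [enorm_smul, ← mul_add]
          gcongr
          exact enorm_bsKernel_le R y
      _ = _ := by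
          exact lintegral_add_left ((hm.comp (measurable_const.sub measurable_id)).mul hi) _

/-- The `L¹` norm of the cutoff. -/
def cutNorm (φ : E3 → ℝ) : ℝ≥0∞ := ∫⁻ x, ‖φ x‖ₑ

theorem IsCutoff.cutNorm_lt_top {φ : E3 → ℝ} (hφ : IsCutoff φ) : cutNorm φ < ⊤ :=
  hφ.integrable.hasFiniteIntegral

theorem lintegral_rescale {φ : E3 → ℝ} {ε : ℝ} (hε : 0 < ε) :
    ∫⁻ x, ‖rescale φ ε x‖ₑ = cutNorm φ := by
  unfold rescale cutNorm
  simp_rw [enorm_mul]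
  rw [lintegral_const_mul' _ _ enorm_ne_top,
    lintegral_comp_smul_E3 (fun x => ‖φ x‖ₑ) (inv_pos.2 hε), ← mul_assoc,
    Real.enorm_of_nonneg (by positivity), ← ENNReal.ofReal_mul (by positivity)]
  have : ε⁻¹ ^ 3 * ε⁻¹ ^ (-3 : ℝ) = 1 := by
    rw [Real.rpow_neg (by positivity)]
    norm_cast
    field_simp
  rw [this, ENNReal.ofReal_one, one_mul]

/-- Source of the uniformity in ε: the L¹ norm of φ_ε does not depend on ε. The summand 1 covers ε =
0, where nothing is mollified. -/
theorem IsCutoff.lpn_mollAbs_le {φ : E3 → ℝ} (hφ : IsCutoff φ) {ε : ℝ} (hε : 0 ≤ ε) {q : ℝ}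
    (hq : 1 ≤ q) {f : E3 → ℝ≥0∞} (hf : Measurable f) :
    lpn q (mollAbs φ ε f) ≤ (1 + cutNorm φ) * lpn q f := by
  unfold mollAbs
  split_ifs with h
  · rw [add_mul, one_mul]
    exact le_self_add
  · refine (lpn_cv_le_one hq (hφ.measurable_rescale ε).enorm hf).trans ?_
    rw [lintegral_rescale (lt_of_le_of_ne hε (Ne.symm h))]
    gcongr
    exact le_add_self

/-- The trilinear form which dominates the bilinear operator at a fixed time. -/
def triAbs (ν : ℝ) (φ : E3 → ℝ) (ε τ : ℝ) (f g : E3 → ℝ≥0∞) (x : E3) : ℝ≥0∞ :=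
  cv (hk ν τ) (fun y => cv (kabs φ ε) f y * g y) x

theorem cv_kabs_le {φ : E3 → ℝ} (hφ : IsCutoff φ) (ε R : ℝ) {f : E3 → ℝ≥0∞} (hf : Measurable f)
    (y : E3) :
    cv (kabs φ ε) f y ≤ cv (mollAbs φ ε (bsIn R)) f y + cv (mollAbs φ ε (bsOut R)) f y := by
  rw [← cv_add_left (hφ.measurable_mollAbs ε (measurable_bsIn R)) hf]
  exact cv_mono (hφ.kabs_le ε R) (fun _ => le_rfl) y

theorem holderConjugate_self {p : ℝ} (hp : 1 < p) : (p / (p - 1)).HolderConjugate p :=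
  (Real.HolderConjugate.conjExponent hp).symm

/-- The constant in the trilinear estimate. -/
def triConst (ν : ℝ) (φ : E3 → ℝ) (p : ℝ) : ℝ≥0∞ :=
  (1 + cutNorm φ) * (lpn (2 * p / (2 * p - 1)) (hk ν 1) * lpn (2 * p / (2 * p - 1)) (bsIn 1) +
    lpn 1 (hk ν 1) * lpn (p / (p - 1)) (bsOut 1))

/-- The inner exponent 2p/(2p-1) is below 3/2 because p > 3/2, and the outer exponent p/(p-1) is
above 3/2 because p < 3. -/
theorem triConst_lt_top {ν : ℝ} (hν : 0 < ν) {φ : E3 → ℝ} (hφ : IsCutoff φ) {p : ℝ}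
    (hp : 3 / 2 < p) (hp3 : p < 3) : triConst ν φ p < ⊤ := by
  have h1 : 0 < 2 * p - 1 := by linarith
  have h2 : 0 < p - 1 := by linarith
  refine ENNReal.mul_lt_top (ENNReal.add_lt_top.2 ⟨ENNReal.one_lt_top, hφ.cutNorm_lt_top⟩)
    (ENNReal.add_lt_top.2 ⟨ENNReal.mul_lt_top (lpn_hk_lt_top hν (by positivity))
      (lpn_bsIn_lt_top (by positivity) ?_), ENNReal.mul_lt_top (lpn_hk_lt_top hν one_pos)
      (lpn_bsOut_lt_top ?_)⟩)
  · rw [div_lt_div_iff₀ h1 two_pos]; linarith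
  · rw [div_lt_div_iff₀ two_pos h2]; linarith

theorem lpn_cv_inner_le {φ : E3 → ℝ} (hφ : IsCutoff φ) {p : ℝ} (hp : 3 / 2 < p)
    {ε R : ℝ} (hε : 0 ≤ ε) {f : E3 → ℝ≥0∞} (hf : Measurable f) :
    lpn (2 * p) (cv (mollAbs φ ε (bsIn R)) f) ≤
      (1 + cutNorm φ) * lpn (2 * p / (2 * p - 1)) (bsIn R) * lpn p f := by
  have h1 : 0 < 2 * p - 1 := by linarith
  have ha : 1 ≤ 2 * p / (2 * p - 1) := by rw [le_div_iff₀ h1]; linarith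
  refine (lpn_cv_le (b := p) ha (by linarith) (by linarith) ?_
    (hφ.measurable_mollAbs ε (measurable_bsIn R)) hf).trans ?_
  · have : p ≠ 0 := by linarith
    field_simp
    ring
  · gcongr
    exact hφ.lpn_mollAbs_le hε ha (measurable_bsIn R)

theorem cv_outer_le {φ : E3 → ℝ} (hφ : IsCutoff φ) {p : ℝ} (hp : 3 / 2 < p)
    {ε R : ℝ} (hε : 0 ≤ ε) {f : E3 → ℝ≥0∞} (hf : Measurable f) (y : E3) :
    cv (mollAbs φ ε (bsOut R)) f y ≤
      (1 + cutNorm φ) * lpn (p / (p - 1)) (bsOut R) * lpn p f := by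
  have h1 : 0 < p - 1 := by linarith
  refine (cv_le_of_holderConjugate (holderConjugate_self (p := p) (by linarith))
    (hφ.measurable_mollAbs ε (measurable_bsOut R)) hf y).trans ?_
  gcongr
  refine hφ.lpn_mollAbs_le hε ?_ (measurable_bsOut R)
  rw [le_div_iff₀ h1]; linarith

/-- The inner piece gives an L^(2p) function and the outer piece a bounded one, so the Biot–Savart
integral converges absolutely at almost every point. Any cut radius would do here. -/
theorem ae_cv_kabs_lt_top {φ : E3 → ℝ} (hφ : IsCutoff φ) {p : ℝ} (hp : 3 / 2 < p)
    (hp3 : p < 3) {ε : ℝ} (hε : 0 ≤ ε) {f : E3 → ℝ≥0∞} (hf : Measurable f)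
    (hfp : lpn p f < ⊤) : ∀ᵐ y, cv (kabs φ ε) f y < ⊤ := by
  have hc : 1 + cutNorm φ < ⊤ := ENNReal.add_lt_top.2 ⟨ENNReal.one_lt_top, hφ.cutNorm_lt_top⟩
  have h1 : 0 < 2 * p - 1 := by linarith
  have h2 : 0 < p - 1 := by linarith
  have hin : lpn (2 * p / (2 * p - 1)) (bsIn 1) < ⊤ :=
    lpn_bsIn_lt_top (by positivity) (by rw [div_lt_div_iff₀ h1 two_pos]; linarith)
  have hout : lpn (p / (p - 1)) (bsOut 1) < ⊤ :=
    lpn_bsOut_lt_top (by rw [div_lt_div_iff₀ two_pos h2]; linarith)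
  have h3 := (lpn_cv_inner_le hφ hp hε (R := 1) hf).trans_lt
    (ENNReal.mul_lt_top (ENNReal.mul_lt_top hc hin) hfp)
  filter_upwards [ae_lt_top_of_lpn (by linarith)
    (measurable_cv (hφ.measurable_mollAbs ε (measurable_bsIn 1)) hf) h3] with y hy
  exact (cv_kabs_le hφ ε 1 hf y).trans_lt (ENNReal.add_lt_top.2 ⟨hy,
    (cv_outer_le hφ hp hε hf y).trans_lt (ENNReal.mul_lt_top (ENNReal.mul_lt_top hc hout) hfp)⟩)

/-- The estimate behind the whole theorem. Its power of τ is integrable at zero because p > 3/2, and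
its constant does not involve ε. -/
theorem lpn_triAbs_le {ν : ℝ} (hν : 0 < ν) {φ : E3 → ℝ} (hφ : IsCutoff φ) {p : ℝ} (hp : 3 / 2 < p)
    {ε τ : ℝ} (hε : 0 ≤ ε) (hτ : 0 < τ) {f g : E3 → ℝ≥0∞} (hf : Measurable f)
    (hg : Measurable g) :
    lpn p (triAbs ν φ ε τ f g) ≤
      triConst ν φ p * ENNReal.ofReal (τ ^ (-(3 / (2 * p)))) * (lpn p f * lpn p g) := by
  have hp0 : 0 < p := by linarith
  have h1 : 0 < 2 * p - 1 := by linarith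
  have h2 : 0 < p - 1 := by linarith
  set a := 2 * p / (2 * p - 1) with ha
  have ha1 : 1 ≤ a := by rw [ha, le_div_iff₀ h1]; linarith
  -- The diffusion length at time τ is the cut radius for which inner and outer contributions carry
  -- the same power of τ.
  set R := τ ^ (1 / 2 : ℝ) with hR
  have hR0 : 0 < R := by positivity
  set c := 1 + cutNorm φ with hc
  set k1 := mollAbs φ ε (bsIn R) with hk1
  set k2 := mollAbs φ ε (bsOut R) with hk2
  have mk1 : Measurable k1 := hφ.measurable_mollAbs ε (measurable_bsIn R)
  have mk2 : Measurable k2 := hφ.measurable_mollAbs ε (measurable_bsOut R)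
  have mh := measurable_hk ν τ
  have m1 := measurable_cv mk1 hf
  have m2 := measurable_cv mk2 hf
  have mF1 : Measurable fun y => cv k1 f y * g y := m1.mul hg
  set c2 := c * lpn (p / (p - 1)) (bsOut R) * lpn p f with hc2
  -- the inner part
  have I1 : lpn p (cv (hk ν τ) fun y => cv k1 f y * g y) ≤
      lpn a (hk ν τ) * (c * lpn a (bsIn R) * lpn p f * lpn p g) := by
    -- Exponents: the inner convolution lies in L^(2p), its product with g in L^(2p/3), and
    -- convolving with the heat gradient in L^a, where 1/a = 1 - 1/(2p), returns to L^p.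
    refine (lpn_cv_le (b := 2 * p / 3) ha1 (by linarith) hp0 ?_ mh mF1).trans ?_
    · rw [ha]; field_simp; ring
    · gcongr
      refine (lpn_mul_le (a := 2 * p) (b := p) (by linarith) hp0 (by linarith) ?_ m1 hg).trans ?_
      · field_simp; ring
      · gcongr
        exact lpn_cv_inner_le hφ hp hε hf
  -- the outer part
  have I2 : lpn p (cv (hk ν τ) fun y => c2 * g y) ≤ lpn 1 (hk ν τ) * (c2 * lpn p g) := by
    rw [← lpn_const_mul hp0 hg]
    refine (lpn_cv_le_one (by linarith) mh (hg.const_mul _)).trans (le_of_eq ?_)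
    rw [lpn_one]
  have split : ∀ x, triAbs ν φ ε τ f g x ≤
      cv (hk ν τ) (fun y => cv k1 f y * g y) x + cv (hk ν τ) (fun y => c2 * g y) x := by
    intro x
    unfold triAbs cv
    rw [← lintegral_add_left (by fun_prop)]
    refine lintegral_mono fun y => ?_
    simp only
    rw [← mul_add, ← add_mul]
    gcongr
    exact (cv_kabs_le hφ ε R hf y).trans (add_le_add le_rfl (cv_outer_le hφ hp hε hf y))
  have e1 : ENNReal.ofReal (τ ^ (-2 + 3 / (2 * a))) * ENNReal.ofReal (R ^ (-2 + 3 / a)) =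
      ENNReal.ofReal (τ ^ (-(3 / (2 * p)))) := by
    rw [← ENNReal.ofReal_mul (by positivity), hR, ← Real.rpow_mul hτ.le, ← Real.rpow_add hτ, ha]
    congr 2
    field_simp
    ring
  have e2 : ENNReal.ofReal (τ ^ (-2 + 3 / (2 * 1) : ℝ)) *
      ENNReal.ofReal (R ^ (-2 + 3 / (p / (p - 1)))) = ENNReal.ofReal (τ ^ (-(3 / (2 * p)))) := by
    rw [← ENNReal.ofReal_mul (by positivity), hR, ← Real.rpow_mul hτ.le, ← Real.rpow_add hτ]
    congr 2
    field_simp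
    ring
  calc lpn p (triAbs ν φ ε τ f g)
      ≤ lpn p (fun x => cv (hk ν τ) (fun y => cv k1 f y * g y) x +
          cv (hk ν τ) (fun y => c2 * g y) x) := lpn_mono hp0 (Filter.Eventually.of_forall split)
    _ ≤ _ := lpn_add_le (by linarith) (measurable_cv mh mF1) (measurable_cv mh (hg.const_mul _))
    _ ≤ lpn a (hk ν τ) * (c * lpn a (bsIn R) * lpn p f * lpn p g) +
          lpn 1 (hk ν τ) * (c2 * lpn p g) := add_le_add I1 I2
    _ = c * ((ENNReal.ofReal (τ ^ (-2 + 3 / (2 * a))) * ENNReal.ofReal (R ^ (-2 + 3 / a))) *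
          (lpn a (hk ν 1) * lpn a (bsIn 1)) +
          (ENNReal.ofReal (τ ^ (-2 + 3 / (2 * 1) : ℝ)) *
          ENNReal.ofReal (R ^ (-2 + 3 / (p / (p - 1))))) *
          (lpn 1 (hk ν 1) * lpn (p / (p - 1)) (bsOut 1))) * (lpn p f * lpn p g) := by
        rw [hc2, lpn_hk hν hτ (by linarith), lpn_hk hν hτ one_pos, lpn_bsIn hR0 (by linarith),
          lpn_bsOut hR0 (by positivity)]
        ring
    _ = _ := by rw [e1, e2, triConst]; ring

/-! ### Measurability and size of the bilinear operator -/

/-- The `L^p` norm of a vector field. -/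
def vn (p : ℝ) (f : E3 → E3) : ℝ≥0∞ := lpn p fun y => ‖f y‖ₑ

theorem eLpNorm_eq_vn {p : ℝ} (hp : 0 < p) (f : E3 → E3) :
    eLpNorm f (ENNReal.ofReal p) volume = vn p f := eLpNorm_eq_lpn hp f

theorem measurable_lpn_slice {p : ℝ} {F : ℝ → E3 → ℝ≥0∞} (hF : Measurable (Function.uncurry F)) :
    Measurable fun s => lpn p (F s) := by
  have : Measurable fun s => ∫⁻ x, F s x ^ p :=
    Measurable.lintegral_prod_right' (f := fun z : ℝ × E3 => F z.1 z.2 ^ p) (hF.pow_const p)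
  exact this.pow_const _

theorem measurable_vn {p : ℝ} {u : ℝ → E3 → E3} (hu : Measurable (Function.uncurry u)) :
    Measurable fun s => vn p (u s) :=
  measurable_lpn_slice (F := fun s y => ‖u s y‖ₑ) hu.enorm

/-- Lagrange's identity |a ∧ b|² + (a·b)² = |a|²|b|². -/
theorem norm_wedge_le (a b : E3) : ‖wedge a b‖ ≤ ‖a‖ * ‖b‖ := by
  refine le_of_sq_le_sq ?_ (by positivity)
  rw [mul_pow, EuclideanSpace.real_norm_sq_eq, EuclideanSpace.real_norm_sq_eq,
    EuclideanSpace.real_norm_sq_eq]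
  simp only [wedge, Fin.sum_univ_three, cross_apply]
  simp
  nlinarith [sq_nonneg (a 0 * b 0 + a 1 * b 1 + a 2 * b 2)]

theorem enorm_wedge_le (a b : E3) : ‖wedge a b‖ₑ ≤ ‖a‖ₑ * ‖b‖ₑ := by
  rw [← ofReal_norm, ← ofReal_norm, ← ofReal_norm, ← ENNReal.ofReal_mul (norm_nonneg _)]
  exact ENNReal.ofReal_le_ofReal (norm_wedge_le a b)

theorem wedge_add (a b c : E3) : wedge a (b + c) = wedge a b + wedge a c := by
  simp [wedge]

theorem wedge_smul (a b : E3) (r : ℝ) : wedge a (r • b) = r • wedge a b := by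
  simp [wedge]

theorem measurable_wedge : Measurable fun q : E3 × E3 => wedge q.1 q.2 := by
  refine Continuous.measurable ?_
  unfold wedge
  simp only [cross_apply]
  fun_prop

theorem enorm_biotSavart_le (φ : E3 → ℝ) (ε : ℝ) (w : E3 → E3) (y : E3) :
    ‖biotSavart φ ε w y‖ₑ ≤ cv (kabs φ ε) (fun z => ‖w z‖ₑ) y :=
  (enorm_integral_le_lintegral_enorm _).trans
    (lintegral_mono fun _ => enorm_wedge_le _ _)

theorem IsCutoff.measurable_biotSavart {φ : E3 → ℝ} (hφ : IsCutoff φ) (ε : ℝ) {u : ℝ → E3 → E3}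
    (hu : Measurable (Function.uncurry u)) :
    Measurable fun q : ℝ × E3 => biotSavart φ ε (u q.1) q.2 := by
  have h : StronglyMeasurable (Function.uncurry fun (q : ℝ × E3) (z : E3) =>
      wedge (bsKernelMoll φ ε (q.2 - z)) (u q.1 z)) := by
    refine Measurable.stronglyMeasurable (measurable_wedge.comp (Measurable.prodMk ?_ ?_))
    · exact (hφ.measurable_bsKernelMoll ε).comp (by fun_prop)
    · exact hu.comp (f := fun q : (ℝ × E3) × E3 => (q.1.1, q.2)) (by fun_prop)
  exact h.integral_prod_right.measurable

theorem measurable_heatKernelPartial (ν : ℝ) (j : Fin 3) :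
    Measurable fun q : ℝ × E3 × E3 => heatKernelPartial ν q.1 j q.2.1 q.2.2 := by
  simp_rw [heatKernelPartial_eq]
  have h : Measurable fun q : ℝ × E3 × E3 => heatKernel ν q.1 (q.2.1 - q.2.2) :=
    (measurable_heatKernel ν).comp (f := fun q : ℝ × E3 × E3 => (q.1, q.2.1 - q.2.2)) (by fun_prop)
  have h2 : Measurable fun z : E3 => z j := by fun_prop
  have h3 : Measurable fun q : ℝ × E3 × E3 => (q.2.1 - q.2.2) j := h2.comp (by fun_prop)
  fun_prop

theorem IsCutoff.measurable_bilIntegrand {φ : E3 → ℝ} (hφ : IsCutoff φ) (ν ε : ℝ)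
    {u v : ℝ → E3 → E3} (hu : Measurable (Function.uncurry u))
    (hv : Measurable (Function.uncurry v)) (j : Fin 3) :
    Measurable fun q : (ℝ × E3) × (ℝ × E3) =>
      bilIntegrand ν φ ε u v q.1.1 q.1.2 j q.2.1 q.2.2 := by
  unfold bilIntegrand
  have h1 : Measurable fun q : (ℝ × E3) × (ℝ × E3) =>
      heatKernelPartial ν (q.1.1 - q.2.1) j q.1.2 q.2.2 :=
    (measurable_heatKernelPartial ν j).comp
      (f := fun q : (ℝ × E3) × (ℝ × E3) => (q.1.1 - q.2.1, q.1.2, q.2.2)) (by fun_prop)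
  have h2 : Measurable fun q : (ℝ × E3) × (ℝ × E3) => biotSavart φ ε (u q.2.1) q.2.2 :=
    (hφ.measurable_biotSavart ε hu).comp measurable_snd
  have h3 : Measurable fun q : (ℝ × E3) × (ℝ × E3) => v q.2.1 q.2.2 := hv.comp measurable_snd
  have h0 : Measurable fun z : E3 => z j := by fun_prop
  exact h1.smul (((h0.comp h2).smul h3).sub ((h0.comp h3).smul h2))

theorem IsCutoff.measurable_bilIntegrand_slice {φ : E3 → ℝ} (hφ : IsCutoff φ) (ν ε : ℝ)
    {u v : ℝ → E3 → E3} (hu : Measurable (Function.uncurry u))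
    (hv : Measurable (Function.uncurry v)) (t : ℝ) (x : E3) (j : Fin 3) :
    Measurable fun q : ℝ × E3 => bilIntegrand ν φ ε u v t x j q.1 q.2 :=
  (hφ.measurable_bilIntegrand ν ε hu hv j).comp
    (f := fun q : ℝ × E3 => ((t, x), q)) (by fun_prop)

theorem enorm_bilIntegrand_le {ν : ℝ} (hν : 0 < ν) (φ : E3 → ℝ) (ε : ℝ) (u v : ℝ → E3 → E3)
    {t s : ℝ} (hst : s < t) (x y : E3) (j : Fin 3) :
    ‖bilIntegrand ν φ ε u v t x j s y‖ₑ ≤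
      2 * (hk ν (t - s) (x - y) * (cv (kabs φ ε) (fun z => ‖u s z‖ₑ) y * ‖v s y‖ₑ)) := by
  have key : ∀ a b : E3, ‖a j • b - b j • a‖ₑ ≤ 2 * (‖a‖ₑ * ‖b‖ₑ) := by
    intro a b
    have h : ‖a j • b - b j • a‖ ≤ 2 * (‖a‖ * ‖b‖) := by
      refine (norm_sub_le _ _).trans ?_
      rw [norm_smul, norm_smul]
      have h1 := abs_coord_le a j
      have h2 := abs_coord_le b j
      rw [Real.norm_eq_abs, Real.norm_eq_abs]
      nlinarith [norm_nonneg a, norm_nonneg b]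
    rw [← ofReal_norm, ← ofReal_norm, ← ofReal_norm, ← ENNReal.ofReal_mul (norm_nonneg _)]
    refine (ENNReal.ofReal_le_ofReal h).trans (le_of_eq ?_)
    rw [ENNReal.ofReal_mul two_pos.le]
    simp
  unfold bilIntegrand
  rw [enorm_smul]
  calc _ ≤ hk ν (t - s) (x - y) * (2 * (‖biotSavart φ ε (u s) y‖ₑ * ‖v s y‖ₑ)) := by
        gcongr
        · exact enorm_heatKernelPartial_le hν (sub_pos.2 hst) j x y
        · exact key _ _
    _ ≤ hk ν (t - s) (x - y) * (2 * (cv (kabs φ ε) (fun z => ‖u s z‖ₑ) y * ‖v s y‖ₑ)) := by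
        gcongr
        exact enorm_biotSavart_le φ ε (u s) y
    _ = _ := by ring

/-- The absolute value majorant of the bilinear operator. -/
def bilAbs (ν : ℝ) (φ : E3 → ℝ) (ε : ℝ) (u v : ℝ → E3 → E3) (t : ℝ) (x : E3) : ℝ≥0∞ :=
  ∫⁻ s in Ioo 0 t, triAbs ν φ ε (t - s) (fun z => ‖u s z‖ₑ) (fun z => ‖v s z‖ₑ) x

/-- The time integral which controls the bilinear operator. -/
def bilJ (p : ℝ) (u v : ℝ → E3 → E3) (t : ℝ) : ℝ≥0∞ :=
  ∫⁻ s in Ioo 0 t, ENNReal.ofReal ((t - s) ^ (-(3 / (2 * p)))) * (vn p (u s) * vn p (v s))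

theorem measurable_cv_uncurry {α : Type*} [MeasurableSpace α] {F G : α → E3 → ℝ≥0∞}
    (hF : Measurable (Function.uncurry F)) (hG : Measurable (Function.uncurry G)) :
    Measurable fun q : α × E3 => cv (F q.1) (G q.1) q.2 := by
  unfold cv
  refine Measurable.lintegral_prod_right'
    (f := fun z : (α × E3) × E3 => F z.1.1 (z.1.2 - z.2) * G z.1.1 z.2) ?_
  refine Measurable.mul ?_ ?_
  · exact hF.comp (f := fun z : (α × E3) × E3 => (z.1.1, z.1.2 - z.2)) (by fun_prop)
  · exact hG.comp (f := fun z : (α × E3) × E3 => (z.1.1, z.2)) (by fun_prop)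

theorem IsCutoff.measurable_triAbs {φ : E3 → ℝ} (hφ : IsCutoff φ) (ν ε t : ℝ)
    {f g : ℝ → E3 → ℝ≥0∞} (hf : Measurable (Function.uncurry f))
    (hg : Measurable (Function.uncurry g)) :
    Measurable (Function.uncurry fun s x => triAbs ν φ ε (t - s) (f s) (g s) x) := by
  have h1 : Measurable fun q : ℝ × E3 => cv (kabs φ ε) (f q.1) q.2 :=
    measurable_cv_uncurry (F := fun _ : ℝ => kabs φ ε)
      ((hφ.measurable_kabs ε).comp measurable_snd) hf
  refine measurable_cv_uncurry (F := fun s => hk ν (t - s))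
    (G := fun s y => cv (kabs φ ε) (f s) y * g s y) ?_ (h1.mul hg)
  exact (measurable_hk_uncurry ν).comp (f := fun q : ℝ × E3 => (t - q.1, q.2)) (by fun_prop)

theorem measurable_slice {F : Type*} [MeasurableSpace F] {u : ℝ → E3 → F}
    (hu : Measurable (Function.uncurry u)) (s : ℝ) :
    Measurable (u s) := Measurable.of_uncurry_left hu

theorem IsCutoff.measurable_bilAbs {φ : E3 → ℝ} (hφ : IsCutoff φ) (ν ε t : ℝ) {u v : ℝ → E3 → E3}
    (hu : Measurable (Function.uncurry u)) (hv : Measurable (Function.uncurry v)) :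
    Measurable (bilAbs ν φ ε u v t) := by
  have h := hφ.measurable_triAbs ν ε t (f := fun s z => ‖u s z‖ₑ) (g := fun s z => ‖v s z‖ₑ)
    hu.enorm hv.enorm
  unfold bilAbs
  exact h.lintegral_prod_left' (μ := volume.restrict (Ioo 0 t))

/-- Minkowski's inequality moves the L^p norm inside the time integral, and the trilinear estimate
is applied at each time. -/
theorem lpn_bilAbs_le {ν : ℝ} (hν : 0 < ν) {φ : E3 → ℝ} (hφ : IsCutoff φ) {p : ℝ} (hp : 3 / 2 < p)
    {ε : ℝ} (hε : 0 ≤ ε) {u v : ℝ → E3 → E3} (hu : Measurable (Function.uncurry u))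
    (hv : Measurable (Function.uncurry v)) (t : ℝ) :
    lpn p (bilAbs ν φ ε u v t) ≤ triConst ν φ p * bilJ p u v t := by
  have hm := hφ.measurable_triAbs ν ε t (f := fun s z => ‖u s z‖ₑ) (g := fun s z => ‖v s z‖ₑ)
    hu.enorm hv.enorm
  refine (lpn_lintegral_le (μ := volume.restrict (Ioo 0 t)) (by linarith) hm).trans ?_
  have hmm : Measurable fun s => ENNReal.ofReal ((t - s) ^ (-(3 / (2 * p)))) *
      (vn p (u s) * vn p (v s)) := by
    have h1 := measurable_vn (p := p) hu
    have h2 := measurable_vn (p := p) hv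
    fun_prop
  rw [bilJ, ← lintegral_const_mul _ hmm]
  refine setLIntegral_mono (hmm.const_mul _) fun s hs => ?_
  rw [← mul_assoc]
  exact lpn_triAbs_le hν hφ hp hε (sub_pos.2 hs.2) (measurable_slice hu s).enorm
    (measurable_slice hv s).enorm

/-- Absolute convergence of the integrals in the bilinear operator. -/
def BilInt (ν : ℝ) (φ : E3 → ℝ) (ε : ℝ) (u v : ℝ → E3 → E3) (t : ℝ) (x : E3) : Prop :=
  ∀ j : Fin 3, Integrable (fun q : ℝ × E3 => bilIntegrand ν φ ε u v t x j q.1 q.2)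
    ((volume.restrict (Ioo 0 t)).prod volume)

theorem bilInt_of_bilAbs_lt_top {ν : ℝ} (hν : 0 < ν) {φ : E3 → ℝ} (hφ : IsCutoff φ) {ε : ℝ}
    {u v : ℝ → E3 → E3} (hu : Measurable (Function.uncurry u))
    (hv : Measurable (Function.uncurry v)) {t : ℝ} {x : E3} (h : bilAbs ν φ ε u v t x < ⊤) :
    BilInt ν φ ε u v t x := by
  intro j
  have hm := hφ.measurable_bilIntegrand_slice ν ε hu hv t x j
  refine ⟨hm.aestronglyMeasurable, ?_⟩
  unfold HasFiniteIntegral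
  rw [lintegral_prod _ hm.enorm.aemeasurable]
  have h2 : ∫⁻ s in Ioo 0 t, 2 * triAbs ν φ ε (t - s) (fun z => ‖u s z‖ₑ) (fun z => ‖v s z‖ₑ) x
      < ⊤ := by
    rw [lintegral_const_mul' _ _ (by simp)]
    exact ENNReal.mul_lt_top (by simp) h
  refine lt_of_le_of_lt (setLIntegral_mono' measurableSet_Ioo fun s hs => ?_) h2
  unfold triAbs cv
  rw [← lintegral_const_mul' _ _ (by simp)]
  exact lintegral_mono fun y => enorm_bilIntegrand_le hν φ ε u v hs.2 x y j

/-- The factor 6 counts three directions with two terms each. -/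
theorem enorm_bil_le {ν : ℝ} (hν : 0 < ν) (φ : E3 → ℝ) (ε : ℝ)
    (u v : ℝ → E3 → E3) {t : ℝ} (ht : 0 ≤ t) (x : E3) :
    ‖bil ν φ ε u v t x‖ₑ ≤ 6 * bilAbs ν φ ε u v t x := by
  unfold bil bilAbs
  rw [intervalIntegral.integral_of_le ht, integral_Ioc_eq_integral_Ioo,
    ← lintegral_const_mul' _ _ (by simp)]
  refine (enorm_integral_le_lintegral_enorm _).trans
    (setLIntegral_mono' measurableSet_Ioo fun s hs => ?_)
  have h : ∀ j : Fin 3, ‖∫ y, bilIntegrand ν φ ε u v t x j s y‖ₑ ≤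
      2 * triAbs ν φ ε (t - s) (fun z => ‖u s z‖ₑ) (fun z => ‖v s z‖ₑ) x := by
    intro j
    unfold triAbs cv
    rw [← lintegral_const_mul' _ _ (by simp)]
    exact (enorm_integral_le_lintegral_enorm _).trans
      (lintegral_mono fun y => enorm_bilIntegrand_le hν φ ε u v hs.2 x y j)
  calc _ ≤ ∑ j : Fin 3, ‖∫ y, bilIntegrand ν φ ε u v t x j s y‖ₑ := enorm_sum_le _ _
    _ ≤ ∑ _j : Fin 3, 2 * triAbs ν φ ε (t - s) (fun z => ‖u s z‖ₑ) (fun z => ‖v s z‖ₑ) x :=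
        Finset.sum_le_sum fun j _ => h j
    _ = _ := by
        rw [Finset.sum_const, Finset.card_univ, Fintype.card_fin, nsmul_eq_mul, ← mul_assoc]
        norm_num

theorem vn_bil_le {ν : ℝ} (hν : 0 < ν) {φ : E3 → ℝ} (hφ : IsCutoff φ) {p : ℝ} (hp : 3 / 2 < p)
    {ε : ℝ} (hε : 0 ≤ ε) {u v : ℝ → E3 → E3} (hu : Measurable (Function.uncurry u))
    (hv : Measurable (Function.uncurry v)) {t : ℝ} (ht : 0 ≤ t) :
    vn p (bil ν φ ε u v t) ≤ 6 * triConst ν φ p * bilJ p u v t := by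
  have hp0 : 0 < p := by linarith
  calc _ ≤ lpn p (fun x => 6 * bilAbs ν φ ε u v t x) :=
        lpn_mono hp0 (Filter.Eventually.of_forall fun x => enorm_bil_le hν φ ε u v ht x)
    _ = 6 * lpn p (bilAbs ν φ ε u v t) := lpn_const_mul hp0 (hφ.measurable_bilAbs ν ε t hu hv) _
    _ ≤ _ := by
        rw [mul_assoc]
        gcongr
        exact lpn_bilAbs_le hν hφ hp hε hu hv t

/-- A majorant of finite L^p norm is finite almost everywhere, and at such points the integrals
converge absolutely on the product of time and space. -/
theorem ae_bilInt {ν : ℝ} (hν : 0 < ν) {φ : E3 → ℝ} (hφ : IsCutoff φ) {p : ℝ} (hp : 3 / 2 < p)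
    (hp3 : p < 3) {ε : ℝ} (hε : 0 ≤ ε) {u v : ℝ → E3 → E3} (hu : Measurable (Function.uncurry u))
    (hv : Measurable (Function.uncurry v)) {t : ℝ} (hJ : bilJ p u v t < ⊤) :
    ∀ᵐ x, BilInt ν φ ε u v t x := by
  have h := (lpn_bilAbs_le hν hφ hp hε hu hv t).trans_lt
    (ENNReal.mul_lt_top (triConst_lt_top hν hφ hp hp3) hJ)
  filter_upwards [ae_lt_top_of_lpn (by linarith) (hφ.measurable_bilAbs ν ε t hu hv) h] with x hx
  exact bilInt_of_bilAbs_lt_top hν hφ hu hv hx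

/-- Only almost everywhere classes at almost every time matter, and the equality holds at every x.
This permits Borel representatives in place of the given fields. -/
theorem bil_congr {ν : ℝ} {φ : E3 → ℝ} {ε : ℝ} {u u' v v' : ℝ → E3 → E3} {t : ℝ} (ht : 0 ≤ t)
    (hu : ∀ᵐ s ∂(volume.restrict (Ioo 0 t)), u s =ᵐ[volume] u' s)
    (hv : ∀ᵐ s ∂(volume.restrict (Ioo 0 t)), v s =ᵐ[volume] v' s) (x : E3) :
    bil ν φ ε u v t x = bil ν φ ε u' v' t x := by
  unfold bil
  rw [intervalIntegral.integral_of_le ht, intervalIntegral.integral_of_le ht,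
    integral_Ioc_eq_integral_Ioo, integral_Ioc_eq_integral_Ioo]
  refine integral_congr_ae ?_
  filter_upwards [hu, hv] with s h1 h2
  refine Finset.sum_congr rfl fun j _ => integral_congr_ae ?_
  have h3 : biotSavart φ ε (u s) = biotSavart φ ε (u' s) := by
    ext1 y
    refine integral_congr_ae ?_
    filter_upwards [h1] with z hz
    rw [hz]
  filter_upwards [h2] with y hy
  simp only [bilIntegrand, h3, hy]

/-- The moving endpoint is absorbed into the indicator of a measurable set of pairs (t,s), leaving
integrals over the whole line with a parameter. -/
theorem measurable_integral_interval {F : ℝ → E3 → ℝ → E3}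
    (hF : Measurable fun q : (ℝ × E3) × ℝ => F q.1.1 q.1.2 q.2) :
    Measurable fun q : ℝ × E3 => ∫ s in (0 : ℝ)..q.1, F q.1 q.2 s := by
  have key : ∀ S : Set (ℝ × ℝ), MeasurableSet S → Measurable fun q : ℝ × E3 =>
      ∫ s, S.indicator (fun r : ℝ × ℝ => F r.1 q.2 r.2) (q.1, s) := by
    intro S hS
    refine (StronglyMeasurable.integral_prod_right (f := fun (q : ℝ × E3) (s : ℝ) =>
      S.indicator (fun r : ℝ × ℝ => F r.1 q.2 r.2) (q.1, s)) ?_).measurable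
    refine Measurable.stronglyMeasurable ?_
    have hpre : Measurable fun q : (ℝ × E3) × ℝ => (q.1.1, q.2) := by fun_prop
    exact hF.indicator (hpre hS)
  have h1 := key {r | r.2 ∈ Ioc 0 r.1} (by
    simp only [mem_Ioc, ofPred_and]
    exact (measurableSet_lt measurable_const measurable_snd).inter
      (measurableSet_le measurable_snd measurable_fst))
  have h2 := key {r | r.2 ∈ Ioc r.1 0} (by
    simp only [mem_Ioc, ofPred_and]
    exact (measurableSet_lt measurable_fst measurable_snd).inter
      (measurableSet_le measurable_snd measurable_const))
  have e : (fun q : ℝ × E3 => ∫ s in (0 : ℝ)..q.1, F q.1 q.2 s) = fun q : ℝ × E3 =>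
      (∫ s, {r : ℝ × ℝ | r.2 ∈ Ioc 0 r.1}.indicator (fun r : ℝ × ℝ => F r.1 q.2 r.2) (q.1, s)) -
      ∫ s, {r : ℝ × ℝ | r.2 ∈ Ioc r.1 0}.indicator (fun r : ℝ × ℝ => F r.1 q.2 r.2) (q.1, s) := by
    ext1 q
    rw [intervalIntegral, ← integral_indicator measurableSet_Ioc,
      ← integral_indicator measurableSet_Ioc]
    rfl
  rw [e]
  exact h1.sub h2

theorem IsCutoff.measurable_bil {φ : E3 → ℝ} (hφ : IsCutoff φ) (ν ε : ℝ) {u v : ℝ → E3 → E3}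
    (hu : Measurable (Function.uncurry u)) (hv : Measurable (Function.uncurry v)) :
    Measurable (Function.uncurry (bil ν φ ε u v)) := by
  refine measurable_integral_interval
    (F := fun t x s => ∑ j : Fin 3, ∫ y, bilIntegrand ν φ ε u v t x j s y) ?_
  refine Finset.measurable_sum _ fun j _ => ?_
  have h := (hφ.measurable_bilIntegrand ν ε hu hv j).comp
    (f := fun q : ((ℝ × E3) × ℝ) × E3 => (q.1.1, (q.1.2, q.2))) (by fun_prop)
  exact (StronglyMeasurable.integral_prod_right' (f := fun q : ((ℝ × E3) × ℝ) × E3 =>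
    bilIntegrand ν φ ε u v q.1.1.1 q.1.1.2 j q.1.2 q.2) h.stronglyMeasurable).measurable

/-! ### Algebra of the bilinear operator -/

theorem vn_add_le {p : ℝ} (hp : 1 ≤ p) {f g : E3 → E3} (hf : Measurable f) (hg : Measurable g) :
    vn p (f + g) ≤ vn p f + vn p g :=
  (lpn_mono (by linarith) (Filter.Eventually.of_forall fun x => enorm_add_le (f x) (g x))).trans
    (lpn_add_le hp hf.enorm hg.enorm)

theorem vn_sub_le {p : ℝ} (hp : 1 ≤ p) {f g : E3 → E3} (hf : Measurable f) (hg : Measurable g) :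
    vn p (f - g) ≤ vn p f + vn p g :=
  (lpn_mono (by linarith) (Filter.Eventually.of_forall fun x => enorm_sub_le)).trans
    (lpn_add_le hp hf.enorm hg.enorm)

theorem vn_smul {p : ℝ} (hp : 0 < p) {f : E3 → E3} (hf : Measurable f) (a : ℝ) :
    vn p (a • f) = ‖a‖ₑ * vn p f := by
  unfold vn
  rw [← lpn_const_mul hp hf.enorm]
  simp only [Pi.smul_apply, enorm_smul]

theorem vn_congr {p : ℝ} {f g : E3 → E3} (h : f =ᵐ[volume] g) : vn p f = vn p g :=
  lpn_congr (h.mono fun x hx => by simp only [hx])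

theorem vn_zero {p : ℝ} (hp : 0 < p) : vn p 0 = 0 := by
  simp [vn, lpn, hp]

theorem IsCutoff.integrable_biotSavart {φ : E3 → ℝ} (hφ : IsCutoff φ) {ε : ℝ} {f : E3 → E3}
    (hf : Measurable f) {y : E3} (h : cv (kabs φ ε) (fun z => ‖f z‖ₑ) y < ⊤) :
    Integrable fun z => wedge (bsKernelMoll φ ε (y - z)) (f z) := by
  refine ⟨?_, (lintegral_mono fun _ => enorm_wedge_le _ _).trans_lt h⟩
  refine (measurable_wedge.comp (Measurable.prodMk ?_ hf)).aestronglyMeasurable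
  exact (hφ.measurable_bsKernelMoll ε).comp (by fun_prop)

theorem IsCutoff.ae_integrable_biotSavart {φ : E3 → ℝ} (hφ : IsCutoff φ) {p : ℝ} (hp : 3 / 2 < p)
    (hp3 : p < 3) {ε : ℝ} (hε : 0 ≤ ε) {f : E3 → E3} (hf : Measurable f) (hfp : vn p f < ⊤) :
    ∀ᵐ y, Integrable fun z => wedge (bsKernelMoll φ ε (y - z)) (f z) := by
  filter_upwards [ae_cv_kabs_lt_top hφ hp hp3 hε hf.enorm hfp] with y hy
  exact hφ.integrable_biotSavart hf hy

theorem biotSavart_sub {φ : E3 → ℝ} {ε : ℝ} {f g : E3 → E3} {y : E3}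
    (hf : Integrable fun z => wedge (bsKernelMoll φ ε (y - z)) (f z))
    (hg : Integrable fun z => wedge (bsKernelMoll φ ε (y - z)) (g z)) :
    biotSavart φ ε (f - g) y = biotSavart φ ε f y - biotSavart φ ε g y := by
  unfold biotSavart
  rw [← integral_sub hf hg]
  congr 1
  ext1 z
  rw [Pi.sub_apply, sub_eq_add_neg (f z), wedge_add, ← neg_one_smul ℝ (g z), wedge_smul,
    neg_one_smul, ← sub_eq_add_neg]

theorem biotSavart_smul (φ : E3 → ℝ) (ε a : ℝ) (f : E3 → E3) (y : E3) :
    biotSavart φ ε (a • f) y = a • biotSavart φ ε f y := by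
  unfold biotSavart
  rw [← integral_smul]
  simp only [Pi.smul_apply, wedge_smul]

theorem bil_smul_left (ν : ℝ) (φ : E3 → ℝ) (ε a : ℝ) (u v : ℝ → E3 → E3) (t : ℝ) (x : E3) :
    bil ν φ ε (a • u) v t x = a • bil ν φ ε u v t x := by
  unfold bil
  rw [← intervalIntegral.integral_smul]
  congr 1
  ext1 s
  rw [Finset.smul_sum]
  refine Finset.sum_congr rfl fun j _ => ?_
  rw [← integral_smul]
  congr 1
  ext1 y
  simp only [bilIntegrand, Pi.smul_apply, biotSavart_smul, PiLp.smul_apply, smul_eq_mul]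
  module

theorem bil_smul_right (ν : ℝ) (φ : E3 → ℝ) (ε a : ℝ) (u v : ℝ → E3 → E3) (t : ℝ) (x : E3) :
    bil ν φ ε u (a • v) t x = a • bil ν φ ε u v t x := by
  unfold bil
  rw [← intervalIntegral.integral_smul]
  congr 1
  ext1 s
  rw [Finset.smul_sum]
  refine Finset.sum_congr rfl fun j _ => ?_
  rw [← integral_smul]
  congr 1
  ext1 y
  simp only [bilIntegrand, Pi.smul_apply, PiLp.smul_apply, smul_eq_mul]
  module

/-- Subtraction has to pass through two nested Bochner integrals. Integrability on the product
supplies, by Fubini, integrability of almost every slice and of the inner integrals. -/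
theorem bil_sub_of_ae {ν : ℝ} {φ : E3 → ℝ} {ε : ℝ} {u u' u'' v v' v'' : ℝ → E3 → E3} {t : ℝ}
    (ht : 0 ≤ t) {x : E3} (h : BilInt ν φ ε u v t x) (h' : BilInt ν φ ε u' v' t x)
    (he : ∀ s ∈ Ioo 0 t, ∀ᵐ y, ∀ j, bilIntegrand ν φ ε u'' v'' t x j s y =
      bilIntegrand ν φ ε u v t x j s y - bilIntegrand ν φ ε u' v' t x j s y) :
    bil ν φ ε u'' v'' t x = bil ν φ ε u v t x - bil ν φ ε u' v' t x := by
  unfold bil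
  rw [intervalIntegral.integral_of_le ht, intervalIntegral.integral_of_le ht,
    intervalIntegral.integral_of_le ht, integral_Ioc_eq_integral_Ioo, integral_Ioc_eq_integral_Ioo,
    integral_Ioc_eq_integral_Ioo, ← integral_sub
      (integrable_finsetSum _ fun j _ => (h j).integral_prod_left)
      (integrable_finsetSum _ fun j _ => (h' j).integral_prod_left)]
  refine integral_congr_ae ?_
  have h1 := ae_all_iff.2 fun j => (h j).prod_right_ae
  have h2 := ae_all_iff.2 fun j => (h' j).prod_right_ae
  filter_upwards [h1, h2, ae_restrict_mem measurableSet_Ioo] with s hs1 hs2 hs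
  rw [← Finset.sum_sub_distrib]
  refine Finset.sum_congr rfl fun j _ => ?_
  rw [← integral_sub (hs1 j) (hs2 j)]
  refine integral_congr_ae ?_
  filter_upwards [he s hs] with y hy
  exact hy j

theorem bil_sub_right {ν : ℝ} {φ : E3 → ℝ} {ε : ℝ} {u v v' : ℝ → E3 → E3} {t : ℝ}
    (ht : 0 ≤ t) {x : E3} (h : BilInt ν φ ε u v t x) (h' : BilInt ν φ ε u v' t x) :
    bil ν φ ε u (v - v') t x = bil ν φ ε u v t x - bil ν φ ε u v' t x := by
  refine bil_sub_of_ae ht h h' fun s _ => Filter.Eventually.of_forall fun y j => ?_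
  simp only [bilIntegrand, Pi.sub_apply, PiLp.sub_apply]
  module

/-- Unlike the right variable, the left one enters through the Biot–Savart integral, which is
additive only where it converges. Hence the finiteness of the L^p norms is required at each time. -/
theorem bil_sub_left {ν : ℝ} {φ : E3 → ℝ} (hφ : IsCutoff φ) {p : ℝ} (hp : 3 / 2 < p)
    (hp3 : p < 3) {ε : ℝ} (hε : 0 ≤ ε) {u u' v : ℝ → E3 → E3} {t : ℝ}
    (ht : 0 ≤ t) (hu : Measurable (Function.uncurry u)) (hu' : Measurable (Function.uncurry u'))
    (hup : ∀ s ∈ Ioo 0 t, vn p (u s) < ⊤) (hup' : ∀ s ∈ Ioo 0 t, vn p (u' s) < ⊤)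
    {x : E3} (h : BilInt ν φ ε u v t x) (h' : BilInt ν φ ε u' v t x) :
    bil ν φ ε (u - u') v t x = bil ν φ ε u v t x - bil ν φ ε u' v t x := by
  refine bil_sub_of_ae ht h h' fun s hs => ?_
  filter_upwards [hφ.ae_integrable_biotSavart hp hp3 hε (measurable_slice hu s) (hup s hs),
    hφ.ae_integrable_biotSavart hp hp3 hε (measurable_slice hu' s) (hup' s hs)] with y h1 h2 j
  simp only [bilIntegrand, Pi.sub_apply, PiLp.sub_apply, biotSavart_sub h1 h2]
  module

/-! ### Translations and difference quotients -/

/-- Translation of a vector field. -/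
def trn (h : E3) (f : E3 → E3) (x : E3) : E3 := f (x + h)

/-- The difference quotient of a vector field in the direction `k`. -/
def dq (k : Fin 3) (h : ℝ) (f : E3 → E3) (x : E3) : E3 :=
  h⁻¹ • (f (x + h • basisVec k) - f x)

theorem vn_trn {p : ℝ} (h : E3) (f : E3 → E3) : vn p (trn h f) = vn p f :=
  lpn_comp_add (fun x => ‖f x‖ₑ) h

theorem biotSavart_trn (φ : E3 → ℝ) (ε : ℝ) (f : E3 → E3) (h y : E3) :
    biotSavart φ ε (trn h f) y = biotSavart φ ε f (y + h) := by
  unfold biotSavart trn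
  rw [← integral_add_right_eq_self (fun z => wedge (bsKernelMoll φ ε (y + h - z)) (f z)) h]
  simp only [add_sub_add_right_eq_sub]

theorem bil_trn (ν : ℝ) (φ : E3 → ℝ) (ε : ℝ) (u v : ℝ → E3 → E3) (t : ℝ) (h x : E3) :
    bil ν φ ε (fun s => trn h (u s)) (fun s => trn h (v s)) t x = bil ν φ ε u v t (x + h) := by
  unfold bil
  congr 1
  ext1 s
  refine Finset.sum_congr rfl fun j _ => ?_
  rw [← integral_add_right_eq_self (fun y => bilIntegrand ν φ ε u v t (x + h) j s y) h]
  simp only [bilIntegrand, biotSavart_trn, heatKernelPartial_eq, add_sub_add_right_eq_sub]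
  rfl

theorem measurable_trn {u : ℝ → E3 → E3} (hu : Measurable (Function.uncurry u)) (h : E3) :
    Measurable (Function.uncurry fun s => trn h (u s)) :=
  hu.comp (f := fun q : ℝ × E3 => (q.1, q.2 + h)) (by fun_prop)

theorem measurable_dq {u : ℝ → E3 → E3} (hu : Measurable (Function.uncurry u)) (k : Fin 3) (h : ℝ) :
    Measurable (Function.uncurry fun s => dq k h (u s)) :=
  ((measurable_trn hu (h • basisVec k)).sub hu).const_smul h⁻¹

theorem dq_eq (k : Fin 3) (h : ℝ) (f : E3 → E3) :
    dq k h f = h⁻¹ • (trn (h • basisVec k) f - f) := rfl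

/-! ### Bounds for the time integral -/

theorem lintegral_rpow_neg {γ t : ℝ} (hγ : γ < 1) (ht : 0 < t) :
    ∫⁻ s in Ioo 0 t, ENNReal.ofReal (s ^ (-γ)) = ENNReal.ofReal (t ^ (1 - γ) / (1 - γ)) := by
  have hi : IntegrableOn (fun s : ℝ => s ^ (-γ)) (Ioo 0 t) :=
    (intervalIntegral.integrableOn_Ioo_rpow_iff ht).2 (by linarith)
  rw [← ofReal_integral_eq_lintegral_ofReal hi
    ((ae_restrict_mem measurableSet_Ioo).mono fun s hs => Real.rpow_nonneg hs.1.le _),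
    ← integral_Ioc_eq_integral_Ioo, ← intervalIntegral.integral_of_le ht.le,
    integral_rpow (Or.inl (by linarith)), Real.zero_rpow (by linarith)]
  congr 1
  rw [sub_zero]
  ring_nf

theorem lintegral_Ioo_reflect (f : ℝ → ℝ≥0∞) (t : ℝ) :
    ∫⁻ s in Ioo 0 t, f (t - s) = ∫⁻ s in Ioo 0 t, f s := by
  rw [← lintegral_indicator measurableSet_Ioo, ← lintegral_indicator measurableSet_Ioo,
    ← lintegral_sub_left_eq_self _ t]
  congr 1
  ext1 s
  simp only [indicator, mem_Ioo, sub_sub_cancel]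
  congr 1
  simp only [sub_pos, sub_lt_self_iff, eq_iff_iff]
  exact and_comm

/-- A bound for the Beta integral. -/
def betaC (β γ : ℝ) : ℝ := 2 ^ β / (1 - γ) + 2 ^ γ / (1 - β)

/-- On each half of (0,t) one of the two singular factors is at most its value at t/2, and the other
is integrated over the whole interval. -/
theorem lintegral_beta_le {β γ t : ℝ} (hβ0 : 0 ≤ β) (hβ : β < 1) (hγ0 : 0 ≤ γ) (hγ : γ < 1)
    (ht : 0 < t) :
    ∫⁻ s in Ioo 0 t, ENNReal.ofReal ((t - s) ^ (-β)) * ENNReal.ofReal (s ^ (-γ)) ≤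
      ENNReal.ofReal (betaC β γ * t ^ (1 - β - γ)) := by
  have key : ∀ s ∈ Ioo 0 t, ENNReal.ofReal ((t - s) ^ (-β)) * ENNReal.ofReal (s ^ (-γ)) ≤
      ENNReal.ofReal ((t / 2) ^ (-β)) * ENNReal.ofReal (s ^ (-γ)) +
        ENNReal.ofReal ((t / 2) ^ (-γ)) * ENNReal.ofReal ((t - s) ^ (-β)) := by
    intro s hs
    rcases le_total s (t / 2) with h | h
    · refine le_add_right ?_
      gcongr ENNReal.ofReal ?_ * _
      exact Real.rpow_le_rpow_of_nonpos (by linarith) (by linarith) (by linarith)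
    · refine le_add_left ?_
      rw [mul_comm]
      gcongr ENNReal.ofReal ?_ * _
      exact Real.rpow_le_rpow_of_nonpos (by linarith) (by linarith) (by linarith)
  calc _ ≤ ∫⁻ s in Ioo 0 t, (ENNReal.ofReal ((t / 2) ^ (-β)) * ENNReal.ofReal (s ^ (-γ)) +
        ENNReal.ofReal ((t / 2) ^ (-γ)) * ENNReal.ofReal ((t - s) ^ (-β))) :=
        setLIntegral_mono' measurableSet_Ioo key
    _ = ENNReal.ofReal ((t / 2) ^ (-β)) * ENNReal.ofReal (t ^ (1 - γ) / (1 - γ)) +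
        ENNReal.ofReal ((t / 2) ^ (-γ)) * ENNReal.ofReal (t ^ (1 - β) / (1 - β)) := by
        rw [lintegral_add_left (by fun_prop), lintegral_const_mul _ (by fun_prop),
          lintegral_const_mul _ (by fun_prop),
          lintegral_Ioo_reflect (fun s => ENNReal.ofReal (s ^ (-β))),
          lintegral_rpow_neg hγ ht, lintegral_rpow_neg hβ ht]
    _ = _ := by
        have h1 : 0 < 1 - γ := by linarith
        have h2 : 0 < 1 - β := by linarith
        rw [← ENNReal.ofReal_mul (by positivity), ← ENNReal.ofReal_mul (by positivity),
          ← ENNReal.ofReal_add (by positivity) (by positivity)]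
        congr 1
        have e1 : t ^ (1 - β - γ) = t ^ (-β) * t ^ (1 - γ) := by
          rw [← Real.rpow_add ht]; congr 1; ring
        have e2 : t ^ (1 - β - γ) = t ^ (-γ) * t ^ (1 - β) := by
          rw [← Real.rpow_add ht]; congr 1; ring
        rw [betaC, add_mul]
        nth_rw 1 [e1]
        rw [e2, Real.div_rpow ht.le two_pos.le, Real.div_rpow ht.le two_pos.le,
          Real.rpow_neg two_pos.le, Real.rpow_neg two_pos.le]
        field_simp

theorem bilJ_le {p : ℝ} (hp : 3 / 2 < p) {u v : ℝ → E3 → E3} {t : ℝ} (ht : 0 < t) {γ : ℝ}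
    (hγ0 : 0 ≤ γ) (hγ : γ < 1) {c : ℝ≥0∞}
    (h : ∀ᵐ s ∂(volume.restrict (Ioo 0 t)), vn p (u s) * vn p (v s) ≤ c * ENNReal.ofReal (s ^ (-γ))) :
    bilJ p u v t ≤ c * ENNReal.ofReal (betaC (3 / (2 * p)) γ * t ^ (1 - 3 / (2 * p) - γ)) := by
  have hβ : 3 / (2 * p) < 1 := by rw [div_lt_one (by linarith)]; linarith
  refine le_trans ?_ (mul_le_mul_right
    (lintegral_beta_le (by positivity) hβ hγ0 hγ ht) c)
  rw [← lintegral_const_mul _ (by fun_prop), bilJ]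
  refine lintegral_mono_ae ?_
  filter_upwards [h] with s hs
  calc _ ≤ ENNReal.ofReal ((t - s) ^ (-(3 / (2 * p)))) * (c * ENNReal.ofReal (s ^ (-γ))) := by gcongr
    _ = _ := by ring

theorem bilJ_lt_top {p : ℝ} (hp : 3 / 2 < p) {u v : ℝ → E3 → E3} {t : ℝ} (ht : 0 < t) {γ : ℝ}
    (hγ0 : 0 ≤ γ) (hγ : γ < 1) {c : ℝ≥0∞} (hc : c < ⊤)
    (h : ∀ᵐ s ∂(volume.restrict (Ioo 0 t)), vn p (u s) * vn p (v s) ≤ c * ENNReal.ofReal (s ^ (-γ))) :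
    bilJ p u v t < ⊤ :=
  (bilJ_le hp ht hγ0 hγ h).trans_lt (ENNReal.mul_lt_top hc ENNReal.ofReal_lt_top)

/-- Dominated convergence in time, the Beta integrand being the majorant. -/
theorem bilJ_tendsto_zero {p : ℝ} (hp : 3 / 2 < p) {ι : Type*} {l : Filter ι}
    [l.IsCountablyGenerated] {u v : ι → ℝ → E3 → E3} {t : ℝ} (ht : 0 < t) {γ : ℝ}
    (hγ0 : 0 ≤ γ) (hγ : γ < 1) {c : ℝ≥0∞} (hc : c < ⊤)
    (hu : ∀ i, Measurable (Function.uncurry (u i))) (hv : ∀ i, Measurable (Function.uncurry (v i)))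
    (h : ∀ᶠ i in l, ∀ s ∈ Ioo 0 t, vn p (u i s) * vn p (v i s) ≤ c * ENNReal.ofReal (s ^ (-γ)))
    (hlim : ∀ s ∈ Ioo 0 t, Filter.Tendsto (fun i => vn p (u i s) * vn p (v i s)) l (nhds 0)) :
    Filter.Tendsto (fun i => bilJ p (u i) (v i) t) l (nhds 0) := by
  have hβ : 3 / (2 * p) < 1 := by rw [div_lt_one (by linarith)]; linarith
  have H := tendsto_lintegral_filter_of_dominated_convergence
    (μ := volume.restrict (Ioo 0 t)) (l := l)
    (F := fun i s => ENNReal.ofReal ((t - s) ^ (-(3 / (2 * p)))) * (vn p (u i s) * vn p (v i s)))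
    (f := fun _ => 0)
    (fun s => c * (ENNReal.ofReal ((t - s) ^ (-(3 / (2 * p)))) * ENNReal.ofReal (s ^ (-γ)))) ?_ ?_ ?_ ?_
  · simpa [bilJ] using H
  · refine Filter.Eventually.of_forall fun i => ?_
    have h1 := measurable_vn (p := p) (hu i)
    have h2 := measurable_vn (p := p) (hv i)
    fun_prop
  · filter_upwards [h] with i hi
    filter_upwards [ae_restrict_mem measurableSet_Ioo] with s hs
    calc _ ≤ ENNReal.ofReal ((t - s) ^ (-(3 / (2 * p)))) * (c * ENNReal.ofReal (s ^ (-γ))) := by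
          gcongr ENNReal.ofReal ((t - s) ^ (-(3 / (2 * p)))) * ?_; exact hi s hs
      _ = _ := by ring
  · rw [lintegral_const_mul _ (by fun_prop)]
    exact (ENNReal.mul_lt_top hc ((lintegral_beta_le (by positivity) hβ hγ0 hγ ht).trans_lt
      ENNReal.ofReal_lt_top)).ne
  · filter_upwards [ae_restrict_mem measurableSet_Ioo] with s hs
    have := ENNReal.Tendsto.const_mul (a := ENNReal.ofReal ((t - s) ^ (-(3 / (2 * p)))))
      (hlim s hs) (Or.inr ENNReal.ofReal_ne_top)
    simpa using this

/-! ### Weak derivatives and limits of difference quotients -/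

theorem memLp_of_vn {p : ℝ} (hp : 0 < p) {f : E3 → E3} (hf : Measurable f) (h : vn p f < ⊤) :
    MemLp f (ENNReal.ofReal p) volume :=
  ⟨hf.aestronglyMeasurable, by rwa [eLpNorm_eq_vn hp]⟩

theorem locallyIntegrable_of_vn {p : ℝ} (hp : 1 ≤ p) {f : E3 → E3} (hf : Measurable f)
    (h : vn p f < ⊤) : LocallyIntegrable f :=
  (memLp_of_vn (by linarith) hf h).locallyIntegrable (by simpa using hp)

theorem integrable_test_smul {p : ℝ} (hp : 1 ≤ p) {ψ : E3 → ℝ} (hψ : Continuous ψ)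
    (hc : HasCompactSupport ψ) {f : E3 → E3} (hf : Measurable f) (h : vn p f < ⊤) :
    Integrable fun x => ψ x • f x :=
  (locallyIntegrable_of_vn hp hf h).integrable_smul_left_of_hasCompactSupport hψ hc

theorem tendsto_integral_test_smul {p : ℝ} (hp : 1 < p) {ψ : E3 → ℝ} (hψ : Continuous ψ)
    (hc : HasCompactSupport ψ) {ι : Type*} {l : Filter ι} {F : ι → E3 → E3} {f : E3 → E3}
    (hF : ∀ i, Measurable (F i)) (hf : Measurable f) (hFp : ∀ᶠ i in l, vn p (F i) < ⊤)
    (hfp : vn p f < ⊤) (hlim : Filter.Tendsto (fun i => vn p (F i - f)) l (nhds 0)) :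
    Filter.Tendsto (fun i => ∫ x, ψ x • F i x) l (nhds (∫ x, ψ x • f x)) := by
  set q := p / (p - 1) with hq
  have hq0 : 0 < q := by have : 0 < p - 1 := by linarith
                         positivity
  have hψq : lpn q (fun x => ‖ψ x‖ₑ) < ⊤ := by
    rw [← eLpNorm_eq_lpn hq0]
    exact (hψ.memLp_of_hasCompactSupport hc).2
  rw [tendsto_iff_edist_tendsto_0]
  have h0 : Filter.Tendsto (fun i => lpn q (fun x => ‖ψ x‖ₑ) * vn p (F i - f)) l (nhds 0) := by
    simpa using ENNReal.Tendsto.const_mul hlim (Or.inr hψq.ne)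
  refine tendsto_of_tendsto_of_tendsto_of_le_of_le' tendsto_const_nhds h0
    (Filter.Eventually.of_forall fun _ => zero_le) ?_
  filter_upwards [hFp] with i hi
  rw [edist_eq_enorm_sub, ← integral_sub (integrable_test_smul hp.le hψ hc (hF i) hi)
    (integrable_test_smul hp.le hψ hc hf hfp)]
  refine (enorm_integral_le_lintegral_enorm _).trans ?_
  simp_rw [← smul_sub, enorm_smul]
  exact ENNReal.lintegral_mul_le_Lp_mul_Lq volume (holderConjugate_self hp)
    hψ.measurable.enorm.aemeasurable ((hF i).sub hf).enorm.aemeasurable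

theorem norm_basisVec (k : Fin 3) : ‖basisVec k‖ = 1 := by simp [basisVec]

/-- The translation is put on the smooth test function, so that no regularity of f is needed to
differentiate. -/
theorem hasDerivAt_integral_translate {p : ℝ} (hp : 1 ≤ p) {ψ : E3 → ℝ} (hψ : ContDiff ℝ ∞ ψ)
    (hc : HasCompactSupport ψ) {f : E3 → E3} (hf : Measurable f) (hfp : vn p f < ⊤) (k : Fin 3) :
    HasDerivAt (fun h : ℝ => ∫ x, ψ (x - h • basisVec k) • f x)
      (∫ x, -(fderiv ℝ ψ x (basisVec k)) • f x) 0 := by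
  have hd : Continuous fun x => fderiv ℝ ψ x (basisVec k) :=
    (hψ.continuous_fderiv (by simp)).clm_apply continuous_const
  have hdc : HasCompactSupport fun x => fderiv ℝ ψ x (basisVec k) :=
    hc.fderiv_apply (𝕜 := ℝ) (basisVec k)
  obtain ⟨C, hC⟩ := hd.bounded_above_of_compact_support hdc
  -- A compact set containing the supports of all translates with |h| < 1; f is integrable on it,
  -- which gives the dominating function.
  set K := Metric.cthickening 1 (tsupport ψ) with hK
  have hKc : IsCompact K := hc.isCompact.cthickening
  have hloc := locallyIntegrable_of_vn hp hf hfp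
  have key := hasDerivAt_integral_of_dominated_loc_of_deriv_le (μ := (volume : Measure E3))
    (F := fun (h : ℝ) x => ψ (x - h • basisVec k) • f x)
    (F' := fun (h : ℝ) x => -(fderiv ℝ ψ (x - h • basisVec k) (basisVec k)) • f x)
    (x₀ := (0 : ℝ)) (s := Metric.ball 0 1) (bound := K.indicator fun x => C * ‖f x‖)
    (Metric.ball_mem_nhds 0 one_pos) ?_ ?_ ?_ ?_ ?_ ?_
  · simpa using key.2
  · refine Filter.Eventually.of_forall fun h => ?_
    have : Measurable fun x => ψ (x - h • basisVec k) := hψ.continuous.measurable.comp (by fun_prop)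
    exact (this.smul hf).aestronglyMeasurable
  · simpa using integrable_test_smul hp hψ.continuous hc hf hfp
  · have : Measurable fun x => fderiv ℝ ψ (x - (0 : ℝ) • basisVec k) (basisVec k) :=
      hd.measurable.comp (by fun_prop)
    exact (this.neg.smul hf).aestronglyMeasurable
  · refine Filter.Eventually.of_forall fun x h hh => ?_
    by_cases hx : x ∈ K
    · rw [indicator_of_mem hx, norm_smul, norm_neg]
      gcongr
      exact hC _
    · rw [indicator_of_notMem hx]
      have : x - h • basisVec k ∉ tsupport ψ := by
        intro hmem
        refine hx (Metric.mem_cthickening_of_dist_le x _ 1 _ hmem ?_)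
        rw [dist_eq_norm, sub_sub_cancel, norm_smul, norm_basisVec, mul_one]
        exact (mem_ball_zero_iff.1 hh).le
      have h0 : fderiv ℝ ψ (x - h • basisVec k) = 0 := by
        by_contra h1
        exact this (support_fderiv_subset ℝ h1)
      simp [h0]
  · exact (integrable_indicator_iff hKc.isClosed.measurableSet).2
      ((hloc.integrableOn_isCompact hKc).norm.const_mul C)
  · refine Filter.Eventually.of_forall fun x h _ => ?_
    have h1 : HasDerivAt (fun h : ℝ => x - h • basisVec k) (-basisVec k) h := by
      simpa using ((hasDerivAt_id h).smul_const (basisVec k)).const_sub x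
    have h2 := ((hψ.differentiable (by simp)) (x - h • basisVec k)).hasFDerivAt.comp_hasDerivAt h h1
    simpa using h2.smul_const (f x)

/-- A change of variables moves the difference quotient between f and the test function. Its
integral thus has two limits, one from the L^p convergence and one from the derivative of the test
function, and they must agree. -/
theorem hasWeakPartial_of_dq {p : ℝ} (hp : 1 < p) {k : Fin 3} {f d : E3 → E3} (hf : Measurable f)
    (hd : Measurable d) (hfp : vn p f < ⊤) (hdp : vn p d < ⊤)
    (hlim : Filter.Tendsto (fun h => vn p (dq k h f - d)) (nhdsWithin 0 {0}ᶜ) (nhds 0)) :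
    HasWeakPartial k f d := by
  refine ⟨locallyIntegrable_of_vn hp.le hf hfp, locallyIntegrable_of_vn hp.le hd hdp,
    fun ψ hψ hc => ?_⟩
  have hp0 : 0 < p := by linarith
  have hmt : ∀ h : E3, Measurable (trn h f) := fun h => hf.comp (by fun_prop)
  have hmq : ∀ h : ℝ, Measurable (dq k h f) := fun h =>
    ((hmt (h • basisVec k)).sub hf).const_smul h⁻¹
  have hq : ∀ᶠ h in nhdsWithin (0 : ℝ) {0}ᶜ, vn p (dq k h f) < ⊤ := by
    refine Filter.Eventually.of_forall fun h => ?_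
    rw [dq_eq, vn_smul hp0 ((hmt _).sub hf)]
    refine ENNReal.mul_lt_top enorm_lt_top ((vn_sub_le hp.le (hmt _) hf).trans_lt ?_)
    rw [vn_trn]
    exact ENNReal.add_lt_top.2 ⟨hfp, hfp⟩
  have h1 := tendsto_integral_test_smul hp hψ.continuous hc hmq hd hq hdp hlim
  have h2 := (hasDerivAt_integral_translate hp.le hψ hc hf hfp k).tendsto_slope
  have h3 : ∀ h : ℝ, slope (fun h : ℝ => ∫ x, ψ (x - h • basisVec k) • f x) 0 h =
      ∫ x, ψ x • dq k h f x := by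
    intro h
    have e1 : ∫ x, ψ (x - h • basisVec k) • f x = ∫ x, ψ x • f (x + h • basisVec k) := by
      rw [← integral_add_right_eq_self _ (h • basisVec k)]
      simp
    have hi1 : Integrable fun x => ψ x • f (x + h • basisVec k) :=
      integrable_test_smul hp.le hψ.continuous hc (hmt _) ((vn_trn (h • basisVec k) f).trans_lt hfp)
    have hi2 := integrable_test_smul hp.le hψ.continuous hc hf hfp
    simp only [slope_def_module, sub_zero, zero_smul]
    rw [e1, ← integral_sub hi1 hi2, ← integral_smul]
    congr 1
    ext1 x
    simp only [dq]
    module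
  have h4 := tendsto_nhds_unique h1 (h2.congr h3)
  rw [h4, ← integral_neg]
  simp

theorem hasWeakPartial_of_tendsto {p : ℝ} (hp : 1 < p) {k : Fin 3} {F D : ℕ → E3 → E3}
    {f d : E3 → E3} (hF : ∀ n, Measurable (F n)) (hD : ∀ n, Measurable (D n)) (hf : Measurable f)
    (hd : Measurable d) (hFp : ∀ n, vn p (F n) < ⊤) (hDp : ∀ n, vn p (D n) < ⊤)
    (hfp : vn p f < ⊤) (hdp : vn p d < ⊤)
    (h1 : Filter.Tendsto (fun n => vn p (F n - f)) Filter.atTop (nhds 0))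
    (h2 : Filter.Tendsto (fun n => vn p (D n - d)) Filter.atTop (nhds 0))
    (hw : ∀ n, HasWeakPartial k (F n) (D n)) : HasWeakPartial k f d := by
  refine ⟨locallyIntegrable_of_vn hp.le hf hfp, locallyIntegrable_of_vn hp.le hd hdp,
    fun ψ hψ hc => ?_⟩
  have hdψ : Continuous fun x => fderiv ℝ ψ x (basisVec k) :=
    (hψ.continuous_fderiv (by simp)).clm_apply continuous_const
  have hdc : HasCompactSupport fun x => fderiv ℝ ψ x (basisVec k) :=
    hc.fderiv_apply (𝕜 := ℝ) (basisVec k)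
  have t1 := tendsto_integral_test_smul hp hdψ hdc hF hf (Filter.Eventually.of_forall hFp) hfp h1
  have t2 := tendsto_integral_test_smul hp hψ.continuous hc hD hd
    (Filter.Eventually.of_forall hDp) hdp h2
  refine tendsto_nhds_unique t1 ?_
  simp_rw [fun n => (hw n).2.2 ψ hψ hc]
  exact t2.neg

theorem HasWeakPartial.ae_unique {k : Fin 3} {f d d' : E3 → E3} (h : HasWeakPartial k f d)
    (h' : HasWeakPartial k f d') : d =ᵐ[volume] d' := by
  have hz : ∀ᵐ x : E3, (d - d') x = 0 := by
    refine ae_eq_zero_of_integral_contDiff_smul_eq_zero (h.2.1.sub h'.2.1) fun ψ hψ hc => ?_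
    have i1 := h.2.1.integrable_smul_left_of_hasCompactSupport hψ.continuous hc
    have i2 := h'.2.1.integrable_smul_left_of_hasCompactSupport hψ.continuous hc
    simp only [Pi.sub_apply, smul_sub]
    rw [integral_sub i1 i2, ← neg_inj, neg_sub', ← h.2.2 ψ hψ hc, ← h'.2.2 ψ hψ hc]
    simp
  filter_upwards [hz] with x hx
  exact sub_eq_zero.1 hx

/-- Weak derivatives are unique almost everywhere, so the infimum runs over a single class. -/
theorem HasWeakPartial.weakPartialNorm_eq {p : ℝ} (hp : 0 < p) {k : Fin 3} {f d : E3 → E3}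
    (h : HasWeakPartial k f d) : weakPartialNorm p k f = vn p d := by
  unfold weakPartialNorm
  refine le_antisymm ?_ (le_iInf₂ fun d' hd' => ?_)
  · rw [← eLpNorm_eq_vn hp]
    exact iInf₂_le d h
  · rw [eLpNorm_eq_vn hp]
    exact (vn_congr (h.ae_unique hd')).le

theorem HasWeakPartial.congr_ae {k : Fin 3} {f f' d : E3 → E3} (h : HasWeakPartial k f d)
    (hf : f =ᵐ[volume] f') : HasWeakPartial k f' d := by
  refine ⟨h.1.congr hf, h.2.1, fun ψ hψ hc => ?_⟩
  rw [← h.2.2 ψ hψ hc]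
  refine integral_congr_ae ?_
  filter_upwards [hf] with x hx
  rw [hx]

theorem weakPartialNorm_congr_ae {p : ℝ} {k : Fin 3} {f f' : E3 → E3} (hf : f =ᵐ[volume] f') :
    weakPartialNorm p k f = weakPartialNorm p k f' := by
  unfold weakPartialNorm
  congr 1
  ext1 d
  have : HasWeakPartial k f d ↔ HasWeakPartial k f' d :=
    ⟨fun h => h.congr_ae hf, fun h => h.congr_ae hf.symm⟩
  simp only [this]

/-! ### Strong derivatives of the bilinear operator -/

/-- The constant in the estimate of the bilinear operator on `[0,T]`. -/
def bilC (ν : ℝ) (φ : E3 → ℝ) (p T : ℝ) : ℝ≥0∞ :=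
  6 * triConst ν φ p * ENNReal.ofReal (betaC (3 / (2 * p)) (1 / 2)) *
    ENNReal.ofReal (T ^ (1 - 3 / (2 * p)))

theorem bilC_lt_top {ν : ℝ} (hν : 0 < ν) {φ : E3 → ℝ} (hφ : IsCutoff φ) {p : ℝ}
    (hp : 3 / 2 < p) (hp3 : p < 3) (T : ℝ) : bilC ν φ p T < ⊤ :=
  ENNReal.mul_lt_top (ENNReal.mul_lt_top (ENNReal.mul_lt_top (by simp)
    (triConst_lt_top hν hφ hp hp3)) ENNReal.ofReal_lt_top) ENNReal.ofReal_lt_top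

theorem bilC_mono (ν : ℝ) (φ : E3 → ℝ) {p : ℝ} (hp : 3 / 2 < p) {T T' : ℝ} (hT : 0 ≤ T)
    (h : T ≤ T') : bilC ν φ p T ≤ bilC ν φ p T' := by
  have hβ : 3 / (2 * p) < 1 := by rw [div_lt_one (by linarith)]; linarith
  unfold bilC
  gcongr

/-- The Beta constant increases with γ, so its value at 1/2 serves both the field itself (γ = 0) and
its derivatives (γ = 1/2). The time weight of the product is reproduced, with a gain t^(1-3/(2p))
that makes the constant small for small t. -/
theorem vn_bil_le_of_bound {ν : ℝ} (hν : 0 < ν) {φ : E3 → ℝ} (hφ : IsCutoff φ) {p : ℝ}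
    (hp : 3 / 2 < p) {ε : ℝ} (hε : 0 ≤ ε) {u v : ℝ → E3 → E3}
    (hu : Measurable (Function.uncurry u)) (hv : Measurable (Function.uncurry v)) {t : ℝ}
    (ht : 0 < t) {γ : ℝ} (hγ0 : 0 ≤ γ) (hγ : γ ≤ 1 / 2) {c : ℝ≥0∞}
    (h : ∀ᵐ s ∂(volume.restrict (Ioo 0 t)),
      vn p (u s) * vn p (v s) ≤ c * ENNReal.ofReal (s ^ (-γ))) :
    vn p (bil ν φ ε u v t) ≤ bilC ν φ p t * c * ENNReal.ofReal (t ^ (-γ)) := by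
  have hβ : 3 / (2 * p) < 1 := by rw [div_lt_one (by linarith)]; linarith
  have hβ' : 0 < 1 - 3 / (2 * p) := by linarith
  have hb : betaC (3 / (2 * p)) γ ≤ betaC (3 / (2 * p)) (1 / 2) := by
    unfold betaC
    gcongr
    norm_num
  have hb0 : 0 ≤ betaC (3 / (2 * p)) (1 / 2) := by
    unfold betaC
    have : (0 : ℝ) < 1 - 1 / 2 := by norm_num
    positivity
  calc _ ≤ 6 * triConst ν φ p * bilJ p u v t := vn_bil_le hν hφ hp hε hu hv ht.le
    _ ≤ 6 * triConst ν φ p *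
        (c * ENNReal.ofReal (betaC (3 / (2 * p)) (1 / 2) * t ^ (1 - 3 / (2 * p) - γ))) := by
        gcongr
        refine (bilJ_le hp ht hγ0 (by linarith) h).trans ?_
        gcongr
    _ = _ := by
        rw [sub_eq_add_neg _ γ, Real.rpow_add ht, ENNReal.ofReal_mul hb0,
          ENNReal.ofReal_mul (by positivity), bilC]
        ring

/-- Fields with a strong `L^p` derivative in the direction `k`, with the parabolic weight. -/
structure Tame (p T : ℝ) (k : Fin 3) (w d : ℝ → E3 → E3) : Prop where
  meas : Measurable (Function.uncurry w)
  meas' : Measurable (Function.uncurry d)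
  bound : ∃ A : ℝ≥0∞, A < ⊤ ∧ ∀ t ∈ Ioc 0 T, vn p (w t) ≤ A ∧
    vn p (d t) ≤ A * ENNReal.ofReal (t ^ (-(1 / 2 : ℝ))) ∧
    ∀ h ≠ 0, vn p (dq k h (w t)) ≤ A * ENNReal.ofReal (t ^ (-(1 / 2 : ℝ)))
  lim : ∀ t ∈ Ioc 0 T, Filter.Tendsto (fun h => vn p (dq k h (w t) - d t))
    (nhdsWithin 0 {0}ᶜ) (nhds 0)

theorem Tame.hasWeakPartial {p T : ℝ} (hp : 1 < p) {k : Fin 3} {w d : ℝ → E3 → E3}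
    (H : Tame p T k w d) {t : ℝ} (ht : t ∈ Ioc 0 T) : HasWeakPartial k (w t) (d t) := by
  obtain ⟨A, hA, hb⟩ := H.bound
  obtain ⟨h1, h2, -⟩ := hb t ht
  exact hasWeakPartial_of_dq hp (measurable_slice H.meas t) (measurable_slice H.meas' t)
    (h1.trans_lt hA) (h2.trans_lt (ENNReal.mul_lt_top hA ENNReal.ofReal_lt_top)) (H.lim t ht)

theorem Tame.add {p T : ℝ} (hp : 1 ≤ p) {k : Fin 3} {w d w' d' : ℝ → E3 → E3}
    (H : Tame p T k w d) (H' : Tame p T k w' d') : Tame p T k (w + w') (d + d') := by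
  obtain ⟨A, hA, hb⟩ := H.bound
  obtain ⟨A', hA', hb'⟩ := H'.bound
  have hdq : ∀ h t, dq k h ((w + w') t) = dq k h (w t) + dq k h (w' t) := by
    intro h t
    ext1 x
    simp only [dq, Pi.add_apply]
    module
  have m1 := measurable_slice H.meas
  have m1' := measurable_slice H'.meas
  have m2 := measurable_slice H.meas'
  have m2' := measurable_slice H'.meas'
  have m3 : ∀ h t, Measurable (dq k h (w t)) := fun h => measurable_slice (measurable_dq H.meas k h)
  have m3' : ∀ h t, Measurable (dq k h (w' t)) :=
    fun h => measurable_slice (measurable_dq H'.meas k h)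
  refine ⟨H.meas.add H'.meas, H.meas'.add H'.meas', ⟨A + A', ENNReal.add_lt_top.2 ⟨hA, hA'⟩,
    fun t ht => ?_⟩, fun t ht => ?_⟩
  · obtain ⟨h1, h2, h3⟩ := hb t ht
    obtain ⟨h1', h2', h3'⟩ := hb' t ht
    simp only [add_mul]
    refine ⟨(vn_add_le hp (m1 t) (m1' t)).trans (add_le_add h1 h1'),
      (vn_add_le hp (m2 t) (m2' t)).trans (add_le_add h2 h2'), fun h hh => ?_⟩
    rw [hdq]
    exact (vn_add_le hp (m3 h t) (m3' h t)).trans (add_le_add (h3 h hh) (h3' h hh))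
  · have h0 := (H.lim t ht).add (H'.lim t ht)
    rw [add_zero] at h0
    refine tendsto_of_tendsto_of_tendsto_of_le_of_le tendsto_const_nhds h0
      (fun _ => zero_le) fun h => ?_
    have e : dq k h ((w + w') t) - (d + d') t = (dq k h (w t) - d t) + (dq k h (w' t) - d' t) := by
      rw [hdq, Pi.add_apply]; abel
    rw [e]
    exact vn_add_le hp ((m3 h t).sub (m2 t)) ((m3' h t).sub (m2' t))

theorem ae_bilInt_of_bound {ν : ℝ} (hν : 0 < ν) {φ : E3 → ℝ} (hφ : IsCutoff φ) {p : ℝ}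
    (hp : 3 / 2 < p) (hp3 : p < 3) {ε : ℝ} (hε : 0 ≤ ε) {u v : ℝ → E3 → E3}
    (hu : Measurable (Function.uncurry u)) (hv : Measurable (Function.uncurry v)) {t : ℝ}
    (ht : 0 < t) {γ : ℝ} (hγ0 : 0 ≤ γ) (hγ : γ ≤ 1 / 2) {c : ℝ≥0∞} (hc : c < ⊤)
    (h : ∀ s ∈ Ioo 0 t, vn p (u s) * vn p (v s) ≤ c * ENNReal.ofReal (s ^ (-γ))) :
    ∀ᵐ x, BilInt ν φ ε u v t x :=
  ae_bilInt hν hφ hp hp3 hε hu hv (bilJ_lt_top hp ht hγ0 (by linarith) hc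
    ((ae_restrict_mem measurableSet_Ioo).mono h))

section

variable {ν : ℝ} {φ : E3 → ℝ} {p ε : ℝ}

/-- Leibniz rule for difference quotients: the bilinear operator commutes with translations, and
adding and subtracting B(w, τ_h w), with τ_h w the translate, splits the quotient of the quadratic
expression. -/
theorem dq_bil (hν : 0 < ν) (hφ : IsCutoff φ) (hp : 3 / 2 < p) (hp3 : p < 3) (hε : 0 ≤ ε)
    {w : ℝ → E3 → E3} (hw : Measurable (Function.uncurry w)) {t : ℝ} (ht : 0 < t) {A : ℝ≥0∞}
    (hA : A < ⊤) (hb : ∀ s ∈ Ioo 0 t, vn p (w s) ≤ A) (k : Fin 3) (h : ℝ) :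
    ∀ᵐ x, dq k h (bil ν φ ε w w t) x =
      bil ν φ ε (fun s => dq k h (w s)) (fun s => trn (h • basisVec k) (w s)) t x +
      bil ν φ ε w (fun s => dq k h (w s)) t x := by
  set τw : ℝ → E3 → E3 := fun s => trn (h • basisVec k) (w s) with hτ
  have mτ : Measurable (Function.uncurry τw) := measurable_trn hw _
  have bτ : ∀ s ∈ Ioo 0 t, vn p (τw s) ≤ A := fun s hs => by rw [hτ, vn_trn]; exact hb s hs
  have hAA : A * A < ⊤ := ENNReal.mul_lt_top hA hA
  have bd : ∀ u v : ℝ → E3 → E3, (∀ s ∈ Ioo 0 t, vn p (u s) ≤ A) → (∀ s ∈ Ioo 0 t, vn p (v s) ≤ A)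
      → ∀ s ∈ Ioo 0 t, vn p (u s) * vn p (v s) ≤ A * A * ENNReal.ofReal (s ^ (-(0 : ℝ))) := by
    intro u v h1 h2 s hs
    simpa using mul_le_mul' (h1 s hs) (h2 s hs)
  filter_upwards [
    ae_bilInt_of_bound hν hφ hp hp3 hε mτ mτ ht le_rfl (by norm_num) hAA (bd τw τw bτ bτ),
    ae_bilInt_of_bound hν hφ hp hp3 hε hw mτ ht le_rfl (by norm_num) hAA (bd w τw hb bτ),
    ae_bilInt_of_bound hν hφ hp hp3 hε hw hw ht le_rfl (by norm_num) hAA (bd w w hb hb)]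
    with x h1 h2 h3
  have e : (fun s => dq k h (w s)) = h⁻¹ • (τw - w) := rfl
  rw [e, bil_smul_left, bil_smul_right, bil_sub_right ht.le h2 h3,
    bil_sub_left hφ hp hp3 hε ht.le mτ hw (fun s hs => (bτ s hs).trans_lt hA)
      (fun s hs => (hb s hs).trans_lt hA) h1 h2, bil_trn, dq]
  module

theorem vn_bil_tendsto_zero (hν : 0 < ν) (hφ : IsCutoff φ) (hp : 3 / 2 < p) (hp3 : p < 3)
    (hε : 0 ≤ ε) {u v : ℝ → ℝ → E3 → E3} {t : ℝ} (ht : 0 < t) {c : ℝ≥0∞} (hc : c < ⊤)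
    (hu : ∀ i, Measurable (Function.uncurry (u i))) (hv : ∀ i, Measurable (Function.uncurry (v i)))
    (h : ∀ i ≠ 0, ∀ s ∈ Ioo 0 t, vn p (u i s) * vn p (v i s) ≤
      c * ENNReal.ofReal (s ^ (-(1 / 2 : ℝ))))
    (hlim : ∀ s ∈ Ioo 0 t, Filter.Tendsto (fun i => vn p (u i s) * vn p (v i s))
      (nhdsWithin 0 {0}ᶜ) (nhds 0)) :
    Filter.Tendsto (fun i => vn p (bil ν φ ε (u i) (v i) t)) (nhdsWithin 0 {0}ᶜ) (nhds 0) := by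
  have h1 := bilJ_tendsto_zero (l := nhdsWithin (0 : ℝ) {0}ᶜ) hp ht (by norm_num) (by norm_num) hc hu hv
    (eventually_nhdsWithin_of_forall h) hlim
  have h2 := ENNReal.Tendsto.const_mul (a := 6 * triConst ν φ p) h1
    (Or.inr (ENNReal.mul_lt_top (by simp) (triConst_lt_top hν hφ hp hp3)).ne)
  rw [mul_zero] at h2
  exact tendsto_of_tendsto_of_tendsto_of_le_of_le tendsto_const_nhds h2 (fun _ => zero_le)
    fun i => vn_bil_le hν hφ hp hε (hu i) (hv i) ht.le

/-- The discrete Leibniz rule bounds the difference quotients of B(w,w) by those of w. Letting h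
tend to 0 under the time integral identifies their limit. -/
theorem Tame.bil (hν : 0 < ν) (hφ : IsCutoff φ) (hp : 3 / 2 < p) (hp3 : p < 3) (hε : 0 ≤ ε)
    {T : ℝ} {k : Fin 3} {w d : ℝ → E3 → E3} (H : Tame p T k w d) :
    Tame p T k (bil ν φ ε w w) (VortexMild.bil ν φ ε d w + VortexMild.bil ν φ ε w d) := by
  have hp1 : 1 ≤ p := by linarith
  have hp0 : 0 < p := by linarith
  obtain ⟨A, hA, hb⟩ := H.bound
  have mw := H.meas
  have md := H.meas'
  have mq : ∀ h, Measurable (Function.uncurry fun s => dq k h (w s)) :=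
    fun h => measurable_dq mw k h
  have mt : ∀ h : ℝ, Measurable (Function.uncurry fun s => trn (h • basisVec k) (w s)) :=
    fun h => measurable_trn mw _
  have mB : ∀ {u v : ℝ → E3 → E3}, Measurable (Function.uncurry u) →
      Measurable (Function.uncurry v) → ∀ t, Measurable (VortexMild.bil ν φ ε u v t) :=
    fun hu hv t => measurable_slice (hφ.measurable_bil ν ε hu hv) t
  have hin : ∀ {t}, t ∈ Ioc 0 T → ∀ s ∈ Ioo 0 t, s ∈ Ioc 0 T :=
    fun ht s hs => ⟨hs.1, hs.2.le.trans ht.2⟩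
  -- products of bounds
  have b0 : ∀ {t}, t ∈ Ioc 0 T → ∀ s ∈ Ioo 0 t, vn p (w s) * vn p (w s) ≤
      A * A * ENNReal.ofReal (s ^ (-(0 : ℝ))) := fun ht s hs => by
    have := (hb s (hin ht s hs)).1
    simpa using mul_le_mul' this this
  have bl : ∀ {t} {u v : ℝ → E3 → E3} {a b : ℝ≥0∞}, t ∈ Ioc 0 T →
      (∀ s ∈ Ioc 0 T, vn p (u s) ≤ a * ENNReal.ofReal (s ^ (-(1 / 2 : ℝ)))) →
      (∀ s ∈ Ioc 0 T, vn p (v s) ≤ b) → ∀ s ∈ Ioo 0 t, vn p (u s) * vn p (v s) ≤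
        a * b * ENNReal.ofReal (s ^ (-(1 / 2 : ℝ))) := fun ht h1 h2 s hs => by
    refine (mul_le_mul' (h1 s (hin ht s hs)) (h2 s (hin ht s hs))).trans (le_of_eq (by ring))
  have br : ∀ {t} {u v : ℝ → E3 → E3} {a b : ℝ≥0∞}, t ∈ Ioc 0 T →
      (∀ s ∈ Ioc 0 T, vn p (u s) ≤ a) →
      (∀ s ∈ Ioc 0 T, vn p (v s) ≤ b * ENNReal.ofReal (s ^ (-(1 / 2 : ℝ)))) →
      ∀ s ∈ Ioo 0 t, vn p (u s) * vn p (v s) ≤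
        a * b * ENNReal.ofReal (s ^ (-(1 / 2 : ℝ))) := fun ht h1 h2 s hs => by
    refine (mul_le_mul' (h1 s (hin ht s hs)) (h2 s (hin ht s hs))).trans (le_of_eq (by ring))
  have bw : ∀ s ∈ Ioc 0 T, vn p (w s) ≤ A := fun s hs => (hb s hs).1
  have bd : ∀ s ∈ Ioc 0 T, vn p (d s) ≤ A * ENNReal.ofReal (s ^ (-(1 / 2 : ℝ))) :=
    fun s hs => (hb s hs).2.1
  have bq : ∀ h ≠ 0, ∀ s ∈ Ioc 0 T, vn p (dq k h (w s)) ≤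
      A * ENNReal.ofReal (s ^ (-(1 / 2 : ℝ))) := fun h hh s hs => (hb s hs).2.2 h hh
  have bt : ∀ h : ℝ, ∀ s ∈ Ioc 0 T, vn p (trn (h • basisVec k) (w s)) ≤ A :=
    fun h s hs => by rw [vn_trn]; exact bw s hs
  have hAA : A * A < ⊤ := ENNReal.mul_lt_top hA hA
  set C := bilC ν φ p T with hC
  have hCt : C < ⊤ := bilC_lt_top hν hφ hp hp3 T
  have est : ∀ {t} {u v : ℝ → E3 → E3}, t ∈ Ioc 0 T → Measurable (Function.uncurry u) →
      Measurable (Function.uncurry v) → (∀ s ∈ Ioo 0 t, vn p (u s) * vn p (v s) ≤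
        A * A * ENNReal.ofReal (s ^ (-(1 / 2 : ℝ)))) →
      vn p (VortexMild.bil ν φ ε u v t) ≤ C * (A * A) * ENNReal.ofReal (t ^ (-(1 / 2 : ℝ))) := by
    intro t u v ht hu hv h
    refine (vn_bil_le_of_bound hν hφ hp hε hu hv ht.1 (by norm_num) le_rfl
      ((ae_restrict_mem measurableSet_Ioo).mono h)).trans ?_
    gcongr
    exact bilC_mono ν φ hp ht.1.le ht.2
  refine ⟨hφ.measurable_bil ν ε mw mw,
    (hφ.measurable_bil ν ε md mw).add (hφ.measurable_bil ν ε mw md),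
    ⟨C * (A * A) + C * (A * A),
    ENNReal.add_lt_top.2 ⟨ENNReal.mul_lt_top hCt hAA, ENNReal.mul_lt_top hCt hAA⟩,
    fun t ht => ⟨?_, ?_, fun h hh => ?_⟩⟩, fun t ht => ?_⟩
  · refine (vn_bil_le_of_bound hν hφ hp hε mw mw ht.1 le_rfl (by norm_num)
      ((ae_restrict_mem measurableSet_Ioo).mono (b0 ht))).trans ?_
    rw [neg_zero, Real.rpow_zero, ENNReal.ofReal_one, mul_one]
    refine le_add_right ?_
    gcongr
    exact bilC_mono ν φ hp ht.1.le ht.2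
  · rw [add_mul]
    exact (vn_add_le hp1 (mB md mw t) (mB mw md t)).trans
      (add_le_add (est ht md mw (bl ht bd bw)) (est ht mw md (br ht bw bd)))
  · rw [add_mul, vn_congr (dq_bil hν hφ hp hp3 hε mw ht.1 hA
      (fun s hs => bw s (hin ht s hs)) k h)]
    exact (vn_add_le hp1 (mB (mq h) (mt h) t) (mB mw (mq h) t)).trans
      (add_le_add (est ht (mq h) (mt h) (bl ht (bq h hh) (bt h)))
        (est ht mw (mq h) (br ht bw (bq h hh))))
  · -- the limit of the difference quotients
    set u1 : ℝ → ℝ → E3 → E3 := fun h => (fun s => dq k h (w s)) - d with hu1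
    set τw : ℝ → ℝ → E3 → E3 := fun h s => trn (h • basisVec k) (w s) with hτ
    set u2 : ℝ → ℝ → E3 → E3 := fun h => τw h - w with hu2
    have m1 : ∀ h, Measurable (Function.uncurry (u1 h)) := fun h => (mq h).sub md
    have m2 : ∀ h, Measurable (Function.uncurry (u2 h)) := fun h => (mt h).sub mw
    have hvq : ∀ h s, Measurable (dq k h (w s)) := fun h s => measurable_slice (mq h) s
    have hvd : ∀ s, Measurable (d s) := fun s => measurable_slice md s
    have hvw : ∀ s, Measurable (w s) := fun s => measurable_slice mw s
    have hvt : ∀ h s, Measurable (τw h s) := fun h s => measurable_slice (mt h) s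
    have b1 : ∀ h ≠ 0, ∀ s ∈ Ioc 0 T, vn p (u1 h s) ≤
        (A + A) * ENNReal.ofReal (s ^ (-(1 / 2 : ℝ))) := fun h hh s hs => by
      rw [add_mul]
      exact (vn_sub_le hp1 (hvq h s) (hvd s)).trans (add_le_add (bq h hh s hs) (bd s hs))
    have b2 : ∀ h, ∀ s ∈ Ioc 0 T, vn p (u2 h s) ≤ A + A := fun h s hs =>
      (vn_sub_le hp1 (hvt h s) (hvw s)).trans (add_le_add (bt h s hs) (bw s hs))
    have hA2 : A + A < ⊤ := ENNReal.add_lt_top.2 ⟨hA, hA⟩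
    -- The translation error is h times the difference quotient, which is bounded at fixed s, so it
    -- is of order |h|.
    have l2 : ∀ s ∈ Ioc 0 T, Filter.Tendsto (fun h => vn p (u2 h s)) (nhdsWithin 0 {0}ᶜ)
        (nhds 0) := by
      intro s hs
      have h0 : Filter.Tendsto (fun h : ℝ => ‖h‖ₑ * (A * ENNReal.ofReal (s ^ (-(1 / 2 : ℝ)))))
          (nhdsWithin 0 {0}ᶜ) (nhds 0) := by
        have h1 : Filter.Tendsto (fun h : ℝ => ‖h‖ₑ) (nhdsWithin 0 {0}ᶜ) (nhds 0) := by
          have := (continuous_enorm (E := ℝ)).tendsto 0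
          rw [enorm_zero] at this
          exact this.mono_left nhdsWithin_le_nhds
        simpa using ENNReal.Tendsto.mul_const h1
          (Or.inr (ENNReal.mul_lt_top hA ENNReal.ofReal_lt_top).ne)
      refine tendsto_of_tendsto_of_tendsto_of_le_of_le' tendsto_const_nhds h0
        (Filter.Eventually.of_forall fun _ => zero_le)
        (eventually_nhdsWithin_of_forall fun h hh => ?_)
      have e : u2 h s = h • dq k h (w s) := by
        rw [dq_eq, smul_inv_smul₀ hh]
        rfl
      rw [e, vn_smul hp0 (hvq h s)]
      gcongr
      exact bq h hh s hs
    have L1 := vn_bil_tendsto_zero hν hφ hp hp3 hε (u := u1) (v := τw) ht.1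
      (ENNReal.mul_lt_top hA2 hA) m1 mt (fun h hh => bl ht (b1 h hh) (bt h)) fun s hs => by
        have hs' := hin ht s hs
        simp only [hτ, vn_trn]
        simpa [hu1] using ENNReal.Tendsto.mul_const (H.lim s hs') (Or.inr ((bw s hs').trans_lt hA).ne)
    have L2 := vn_bil_tendsto_zero hν hφ hp hp3 hε (u := fun _ => d) (v := u2) ht.1
      (ENNReal.mul_lt_top hA hA2) (fun _ => md) m2 (fun h hh => bl ht bd (b2 h)) fun s hs => by
        have hs' := hin ht s hs
        simpa using ENNReal.Tendsto.const_mul (l2 s hs') (Or.inr ((bd s hs').trans_lt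
          (ENNReal.mul_lt_top hA ENNReal.ofReal_lt_top)).ne)
    have L3 := vn_bil_tendsto_zero hν hφ hp hp3 hε (u := fun _ => w) (v := u1) ht.1
      (ENNReal.mul_lt_top hA hA2) (fun _ => mw) m1 (fun h hh => br ht bw (b1 h hh)) fun s hs => by
        have hs' := hin ht s hs
        simpa [hu1] using ENNReal.Tendsto.const_mul (H.lim s hs') (Or.inr ((bw s hs').trans_lt hA).ne)
    have L := (L1.add L2).add L3
    rw [add_zero, add_zero] at L
    refine tendsto_of_tendsto_of_tendsto_of_le_of_le' tendsto_const_nhds L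
      (Filter.Eventually.of_forall fun _ => zero_le)
      (eventually_nhdsWithin_of_forall fun h hh => ?_)
    -- With q the quotient and τ_h w the translate: B(q, τ_h w) + B(w,q) - B(d,w) - B(w,d) = B(q-d,
    -- τ_h w) + B(d, τ_h w - w) + B(w, q-d), where each term contains a factor tending to zero.
    have hid : dq k h (VortexMild.bil ν φ ε w w t) -
        (VortexMild.bil ν φ ε d w + VortexMild.bil ν φ ε w d) t =ᵐ[volume]
        VortexMild.bil ν φ ε (u1 h) (τw h) t + VortexMild.bil ν φ ε d (u2 h) t +
          VortexMild.bil ν φ ε w (u1 h) t := by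
      have I : ∀ {u v : ℝ → E3 → E3}, Measurable (Function.uncurry u) →
          Measurable (Function.uncurry v) → (∀ s ∈ Ioo 0 t, vn p (u s) * vn p (v s) ≤
          A * A * ENNReal.ofReal (s ^ (-(1 / 2 : ℝ)))) → ∀ᵐ x, BilInt ν φ ε u v t x :=
        fun hu hv hh => ae_bilInt_of_bound hν hφ hp hp3 hε hu hv ht.1 (by norm_num) le_rfl hAA hh
      have fin : ∀ {u : ℝ → E3 → E3}, (∀ s ∈ Ioc 0 T, vn p (u s) ≤
          A * ENNReal.ofReal (s ^ (-(1 / 2 : ℝ)))) → ∀ s ∈ Ioo 0 t, vn p (u s) < ⊤ :=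
        fun hu s hs => (hu s (hin ht s hs)).trans_lt (ENNReal.mul_lt_top hA ENNReal.ofReal_lt_top)
      filter_upwards [dq_bil hν hφ hp hp3 hε mw ht.1 hA (fun s hs => bw s (hin ht s hs)) k h,
        I (mq h) (mt h) (bl ht (bq h hh) (bt h)), I md (mt h) (bl ht bd (bt h)),
        I md mw (bl ht bd bw), I mw (mq h) (br ht bw (bq h hh)), I mw md (br ht bw bd)]
        with x e h1 h2 h3 h4 h5
      simp only [Pi.sub_apply, Pi.add_apply]
      rw [e, hu1, hu2, bil_sub_left hφ hp hp3 hε ht.1.le (mq h) md (fin (bq h hh)) (fin bd) h1 h2,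
        bil_sub_right ht.1.le h2 h3, bil_sub_right ht.1.le h4 h5]
      abel
    rw [vn_congr hid]
    refine (vn_add_le hp1 ((mB (m1 h) (mt h) t).add (mB md (m2 h) t)) (mB mw (m1 h) t)).trans ?_
    gcongr
    exact vn_add_le hp1 (mB (m1 h) (mt h) t) (mB md (m2 h) t)

end

/-! ### Convolution in space and Duhamel integrals -/

/-- `κ_t * w₀ + ∫_0^t κ_{t-s} * g(s) ds`. -/
def duh (κ : ℝ → E3 → ℝ) (w₀ : E3 → E3) (g : ℝ → E3 → E3) (t : ℝ) (x : E3) : E3 :=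
  (∫ y, κ t (x - y) • w₀ y) + ∫ s in (0 : ℝ)..t, ∫ y, κ (t - s) (x - y) • g s y

/-- The `L¹` norm of a kernel at time `τ`. -/
def kn (κ : ℝ → E3 → ℝ) (τ : ℝ) : ℝ≥0∞ := lpn 1 fun z => ‖κ τ z‖ₑ

/-- The time integral which controls the Duhamel integral. -/
def duhJ (p : ℝ) (κ : ℝ → E3 → ℝ) (w₀ : E3 → E3) (g : ℝ → E3 → E3) (t : ℝ) : ℝ≥0∞ :=
  kn κ t * vn p w₀ + ∫⁻ s in Ioo 0 t, kn κ (t - s) * vn p (g s)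

/-- The absolute value majorant of the Duhamel integral. -/
def duhAbs (κ : ℝ → E3 → ℝ) (w₀ : E3 → E3) (g : ℝ → E3 → E3) (t : ℝ) (x : E3) : ℝ≥0∞ :=
  cv (fun z => ‖κ t z‖ₑ) (fun y => ‖w₀ y‖ₑ) x +
    ∫⁻ s in Ioo 0 t, cv (fun z => ‖κ (t - s) z‖ₑ) (fun y => ‖g s y‖ₑ) x

/-- Absolute convergence of the integrals in `duh`. -/
def DuhInt (κ : ℝ → E3 → ℝ) (w₀ : E3 → E3) (g : ℝ → E3 → E3) (t : ℝ) (x : E3) : Prop :=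
  Integrable (fun y => κ t (x - y) • w₀ y) ∧
    Integrable (fun q : ℝ × E3 => κ (t - q.1) (x - q.2) • g q.1 q.2)
      ((volume.restrict (Ioo 0 t)).prod volume)

section duh

variable {κ κ' : ℝ → E3 → ℝ} {w₀ : E3 → E3} {g : ℝ → E3 → E3} {p t : ℝ}

theorem measurable_kn (hκ : Measurable (Function.uncurry κ)) : Measurable (kn κ) :=
  measurable_lpn_slice (F := fun s z => ‖κ s z‖ₑ) hκ.enorm

theorem measurable_duhAbs_integrand (hκ : Measurable (Function.uncurry κ))
    (hg : Measurable (Function.uncurry g)) (t : ℝ) :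
    Measurable (Function.uncurry fun s => cv (fun z => ‖κ (t - s) z‖ₑ) (fun y => ‖g s y‖ₑ)) :=
  measurable_cv_uncurry (F := fun s z => ‖κ (t - s) z‖ₑ) (G := fun s y => ‖g s y‖ₑ)
    (hκ.comp (f := fun q : ℝ × E3 => (t - q.1, q.2)) (by fun_prop)).enorm hg.enorm

theorem lpn_duhAbs_le (hp : 1 < p) (hκ : Measurable (Function.uncurry κ)) (hw : Measurable w₀)
    (hg : Measurable (Function.uncurry g)) : lpn p (duhAbs κ w₀ g t) ≤ duhJ p κ w₀ g t := by
  have hκs : ∀ τ, Measurable (κ τ) := fun τ => Measurable.of_uncurry_left hκ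
  have hm := measurable_duhAbs_integrand hκ hg t
  refine (lpn_add_le hp.le (measurable_cv (hκs t).enorm hw.enorm)
    (hm.lintegral_prod_left' (μ := volume.restrict (Ioo 0 t)))).trans ?_
  refine add_le_add ?_ ((lpn_lintegral_le hp hm).trans (lintegral_mono fun s => ?_))
  · rw [kn, lpn_one]
    exact lpn_cv_le_one hp.le (hκs t).enorm hw.enorm
  · rw [kn, lpn_one]
    exact lpn_cv_le_one hp.le (hκs (t - s)).enorm (measurable_slice hg s).enorm

theorem measurable_duhAbs (hκ : Measurable (Function.uncurry κ)) (hw : Measurable w₀)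
    (hg : Measurable (Function.uncurry g)) : Measurable (duhAbs κ w₀ g t) :=
  (measurable_cv (Measurable.of_uncurry_left hκ).enorm hw.enorm).add
    ((measurable_duhAbs_integrand hκ hg t).lintegral_prod_left' (μ := volume.restrict (Ioo 0 t)))

theorem enorm_duh_le (ht : 0 ≤ t) (x : E3) : ‖duh κ w₀ g t x‖ₑ ≤ duhAbs κ w₀ g t x := by
  unfold duh duhAbs
  rw [intervalIntegral.integral_of_le ht, integral_Ioc_eq_integral_Ioo]
  refine (enorm_add_le _ _).trans (add_le_add ?_ ?_)
  · refine (enorm_integral_le_lintegral_enorm _).trans (lintegral_mono fun y => ?_)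
    rw [enorm_smul]
  · refine (enorm_integral_le_lintegral_enorm _).trans (lintegral_mono fun s => ?_)
    refine (enorm_integral_le_lintegral_enorm _).trans (lintegral_mono fun y => ?_)
    rw [enorm_smul]

theorem vn_duh_le (hp : 1 < p) (hκ : Measurable (Function.uncurry κ)) (hw : Measurable w₀)
    (hg : Measurable (Function.uncurry g)) (ht : 0 ≤ t) :
    vn p (duh κ w₀ g t) ≤ duhJ p κ w₀ g t :=
  (lpn_mono (by linarith) (Filter.Eventually.of_forall (enorm_duh_le ht))).trans
    (lpn_duhAbs_le hp hκ hw hg)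

theorem ae_duhInt (hp : 1 < p) (hκ : Measurable (Function.uncurry κ)) (hw : Measurable w₀)
    (hg : Measurable (Function.uncurry g)) (hJ : duhJ p κ w₀ g t < ⊤) :
    ∀ᵐ x, DuhInt κ w₀ g t x := by
  have hκs : ∀ τ, Measurable (κ τ) := fun τ => Measurable.of_uncurry_left hκ
  filter_upwards [ae_lt_top_of_lpn (by linarith) (measurable_duhAbs hκ hw hg)
    ((lpn_duhAbs_le hp hκ hw hg).trans_lt hJ)] with x hx
  obtain ⟨h1, h2⟩ := ENNReal.add_lt_top.1 hx
  refine ⟨⟨(((hκs t).comp (by fun_prop)).smul hw).aestronglyMeasurable, ?_⟩, ?_⟩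
  · refine lt_of_le_of_lt (lintegral_mono fun y => ?_) h1
    rw [enorm_smul]
  · have hm : Measurable fun q : ℝ × E3 => κ (t - q.1) (x - q.2) • g q.1 q.2 :=
      (hκ.comp (f := fun q : ℝ × E3 => (t - q.1, x - q.2)) (by fun_prop)).smul hg
    refine ⟨hm.aestronglyMeasurable, ?_⟩
    unfold HasFiniteIntegral
    rw [lintegral_prod _ hm.enorm.aemeasurable]
    refine lt_of_le_of_lt (lintegral_mono fun s => lintegral_mono fun y => ?_) h2
    rw [enorm_smul]

theorem duh_sub (ht : 0 ≤ t) {x : E3} (h : DuhInt κ w₀ g t x) (h' : DuhInt κ' w₀ g t x) :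
    duh (κ - κ') w₀ g t x = duh κ w₀ g t x - duh κ' w₀ g t x := by
  unfold duh
  rw [add_sub_add_comm, ← integral_sub h.1 h'.1, intervalIntegral.integral_of_le ht,
    intervalIntegral.integral_of_le ht, intervalIntegral.integral_of_le ht,
    integral_Ioc_eq_integral_Ioo, integral_Ioc_eq_integral_Ioo, integral_Ioc_eq_integral_Ioo,
    ← integral_sub h.2.integral_prod_left h'.2.integral_prod_left]
  congr 1
  · simp only [Pi.sub_apply, sub_smul]
  · refine integral_congr_ae ?_
    filter_upwards [h.2.prod_right_ae, h'.2.prod_right_ae] with s h1 h2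
    rw [← integral_sub h1 h2]
    simp only [Pi.sub_apply, sub_smul]

theorem duh_smul (a : ℝ) (x : E3) : duh (a • κ) w₀ g t x = a • duh κ w₀ g t x := by
  unfold duh
  rw [smul_add, ← integral_smul, ← intervalIntegral.integral_smul]
  simp only [Pi.smul_apply, smul_eq_mul, mul_smul, integral_smul]

theorem duh_translate (h x : E3) :
    duh (fun τ z => κ τ (z + h)) w₀ g t x = duh κ w₀ g t (x + h) := by
  unfold duh
  simp only [sub_add_eq_add_sub]

theorem measurable_duh (hκ : Measurable (Function.uncurry κ)) (hw : Measurable w₀)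
    (hg : Measurable (Function.uncurry g)) : Measurable (Function.uncurry (duh κ w₀ g)) := by
  have h1 : Measurable fun q : ℝ × E3 => ∫ y, κ q.1 (q.2 - y) • w₀ y := by
    have hm : Measurable fun q : (ℝ × E3) × E3 => κ q.1.1 (q.1.2 - q.2) • w₀ q.2 :=
      (hκ.comp (f := fun q : (ℝ × E3) × E3 => (q.1.1, q.1.2 - q.2)) (by fun_prop)).smul
        (hw.comp measurable_snd)
    exact hm.stronglyMeasurable.integral_prod_right'.measurable
  have h2 : Measurable fun q : ((ℝ × E3) × ℝ) × E3 =>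
      κ (q.1.1.1 - q.1.2) (q.1.1.2 - q.2) • g q.1.2 q.2 :=
    (hκ.comp (f := fun q : ((ℝ × E3) × ℝ) × E3 => (q.1.1.1 - q.1.2, q.1.1.2 - q.2))
      (by fun_prop)).smul
      (hg.comp (f := fun q : ((ℝ × E3) × ℝ) × E3 => (q.1.2, q.2)) (by fun_prop))
  exact h1.add (measurable_integral_interval (F := fun t x s => ∫ y, κ (t - s) (x - y) • g s y)
    h2.stronglyMeasurable.integral_prod_right'.measurable)

theorem duhJ_le {c : ℝ≥0∞} {γ : ℝ} (hκ : ∀ τ, 0 < τ → kn κ τ ≤ c * ENNReal.ofReal (τ ^ (-γ)))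
    (hγ : γ ≤ 1 / 2) (ht : 0 < t) {b : ℝ≥0∞} (hb : ∀ s, vn p (g s) ≤ b) :
    duhJ p κ w₀ g t ≤ 2 * c * (vn p w₀ + ENNReal.ofReal t * b) * ENNReal.ofReal (t ^ (-γ)) := by
  have h1 : ∫⁻ s in Ioo 0 t, kn κ (t - s) * vn p (g s) ≤
      c * b * ENNReal.ofReal (2 * (t * t ^ (-γ))) := by
    calc _ ≤ ∫⁻ s in Ioo 0 t, c * b * ENNReal.ofReal ((t - s) ^ (-γ)) := by
          refine setLIntegral_mono' measurableSet_Ioo fun s hs => ?_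
          exact (mul_le_mul' (hκ _ (sub_pos.2 hs.2)) (hb s)).trans (le_of_eq (by ring))
      _ = c * b * ENNReal.ofReal (t ^ (1 - γ) / (1 - γ)) := by
          rw [lintegral_const_mul _ (by fun_prop),
            lintegral_Ioo_reflect (fun s => ENNReal.ofReal (s ^ (-γ))),
            lintegral_rpow_neg (by linarith) ht]
      _ ≤ _ := by
          gcongr
          -- The factor 2 bounds 1/(1-γ) for γ ≤ 1/2.
          rw [sub_eq_add_neg, Real.rpow_add ht, Real.rpow_one, div_le_iff₀ (by linarith)]
          have : 0 ≤ t * t ^ (-γ) := by positivity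
          nlinarith
  rw [ENNReal.ofReal_mul two_pos.le, ENNReal.ofReal_mul ht.le, ENNReal.ofReal_ofNat] at h1
  calc _ ≤ c * ENNReal.ofReal (t ^ (-γ)) * vn p w₀ +
        c * b * (2 * (ENNReal.ofReal t * ENNReal.ofReal (t ^ (-γ)))) := by
        unfold duhJ
        gcongr
        exact hκ t ht
    _ ≤ 2 * (c * ENNReal.ofReal (t ^ (-γ)) * vn p w₀) +
        c * b * (2 * (ENNReal.ofReal t * ENNReal.ofReal (t ^ (-γ)))) := by
        refine add_le_add ?_ le_rfl
        rw [two_mul]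
        exact le_self_add
    _ = _ := by ring

theorem duhJ_tendsto_zero {K : ℝ → ℝ → E3 → ℝ} (hK : ∀ h, Measurable (Function.uncurry (K h)))
    {c : ℝ≥0∞} (hc : c < ⊤) {γ : ℝ} (hγ : γ ≤ 1 / 2)
    (hb : ∀ h ≠ 0, ∀ τ, 0 < τ → kn (K h) τ ≤ c * ENNReal.ofReal (τ ^ (-γ)))
    (hlim : ∀ τ, 0 < τ → Filter.Tendsto (fun h => kn (K h) τ) (nhdsWithin 0 {0}ᶜ) (nhds 0))
    (ht : 0 < t) (hg : Measurable (Function.uncurry g)) {b : ℝ≥0∞} (hbt : b < ⊤)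
    (hgb : ∀ s, vn p (g s) ≤ b) (hw : vn p w₀ < ⊤) :
    Filter.Tendsto (fun h => duhJ p (K h) w₀ g t) (nhdsWithin 0 {0}ᶜ) (nhds 0) := by
  have h1 : Filter.Tendsto (fun h => kn (K h) t * vn p w₀) (nhdsWithin 0 {0}ᶜ) (nhds 0) := by
    simpa using ENNReal.Tendsto.mul_const (hlim t ht) (Or.inr hw.ne)
  have h2 := tendsto_lintegral_filter_of_dominated_convergence
    (μ := volume.restrict (Ioo 0 t)) (l := nhdsWithin (0 : ℝ) {0}ᶜ)
    (F := fun h s => kn (K h) (t - s) * vn p (g s)) (f := fun _ => 0)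
    (fun s => c * b * ENNReal.ofReal ((t - s) ^ (-γ))) ?_ ?_ ?_ ?_
  · have h3 := h1.add h2
    simpa [duhJ] using h3
  · refine Filter.Eventually.of_forall fun h => ?_
    exact ((measurable_kn (hK h)).comp (measurable_const.sub measurable_id)).mul (measurable_vn hg)
  · refine eventually_nhdsWithin_of_forall fun h hh => ?_
    filter_upwards [ae_restrict_mem measurableSet_Ioo] with s hs
    exact (mul_le_mul' (hb h hh _ (sub_pos.2 hs.2)) (hgb s)).trans (le_of_eq (by ring))
  · rw [lintegral_const_mul _ (by fun_prop),
      lintegral_Ioo_reflect (fun s => ENNReal.ofReal (s ^ (-γ))),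
      lintegral_rpow_neg (by linarith) ht]
    exact (ENNReal.mul_lt_top (ENNReal.mul_lt_top hc hbt) ENNReal.ofReal_lt_top).ne
  · filter_upwards [ae_restrict_mem measurableSet_Ioo] with s hs
    simpa using ENNReal.Tendsto.mul_const (hlim _ (sub_pos.2 hs.2))
      (Or.inr ((hgb s).trans_lt hbt).ne)

end duh

/-! ### The heat flow of the data -/

/-- The partial derivative of the heat kernel. -/
def heatD (ν : ℝ) (k : Fin 3) (τ : ℝ) (z : E3) : ℝ := -(z k / (2 * ν * τ)) * heatKernel ν τ z

/-- The difference quotient of the heat kernel. -/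
def heatQ (ν : ℝ) (k : Fin 3) (h : ℝ) : ℝ → E3 → ℝ :=
  h⁻¹ • ((fun τ z => heatKernel ν τ (z + h • basisVec k)) - heatKernel ν)

theorem heatQ_apply (ν : ℝ) (k : Fin 3) (h τ : ℝ) (z : E3) :
    heatQ ν k h τ z = h⁻¹ • (heatKernel ν τ (z + h • basisVec k) - heatKernel ν τ z) := rfl

theorem measurable_heatKernel_uncurry (ν : ℝ) : Measurable (Function.uncurry (heatKernel ν)) :=
  measurable_heatKernel ν

theorem measurable_heatD (ν : ℝ) (k : Fin 3) : Measurable (Function.uncurry (heatD ν k)) := by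
  have h1 := measurable_heatKernel ν
  have h2 : Measurable fun q : ℝ × E3 => q.2 k :=
    (show Measurable fun z : E3 => z k by fun_prop).comp measurable_snd
  unfold heatD
  simp only [Function.uncurry_def]
  fun_prop

theorem measurable_heatTr (ν : ℝ) (k : Fin 3) (h : ℝ) : Measurable
    (Function.uncurry fun (τ : ℝ) (z : E3) => heatKernel ν τ (z + h • basisVec k)) :=
  (measurable_heatKernel ν).comp (f := fun q : ℝ × E3 => (q.1, q.2 + h • basisVec k)) (by fun_prop)

theorem measurable_heatQ (ν : ℝ) (k : Fin 3) (h : ℝ) :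
    Measurable (Function.uncurry (heatQ ν k h)) :=
  ((measurable_heatTr ν k h).sub (measurable_heatKernel_uncurry ν)).const_smul h⁻¹

theorem hasLineDerivAt_heatKernel (ν τ : ℝ) (k : Fin 3) (z : E3) :
    HasLineDerivAt ℝ (heatKernel ν τ) (heatD ν k τ z) z (basisVec k) := by
  have h := (hasFDerivAt_heatKernel ν τ z).hasLineDerivAt (basisVec k)
  have e : heatD ν k τ z =
      ((-(2 / (4 * ν * τ)) * heatKernel ν τ z) • innerSL ℝ z) (basisVec k) := by
    simp only [smul_apply, innerSL_apply_apply, basisVec, EuclideanSpace.inner_single_right, heatD,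
      smul_eq_mul]
    have e2 : 2 / (4 * ν * τ) = 1 / (2 * ν * τ) := by
      rw [show 4 * ν * τ = 2 * (2 * ν * τ) by ring, div_mul_eq_div_div (2 : ℝ) 2, div_self two_ne_zero]
    rw [e2]
    simp
    ring
  rw [e]
  exact h

theorem enorm_heatD_le {ν τ : ℝ} (hν : 0 < ν) (hτ : 0 < τ) (k : Fin 3) (z : E3) :
    ‖heatD ν k τ z‖ₑ ≤ hk ν τ z := by
  rw [heatD, Real.enorm_eq_ofReal_abs, hk, abs_mul, abs_neg, abs_div,
    abs_of_nonneg (heatKernel_nonneg hν hτ _), abs_of_pos (show 0 < 2 * ν * τ by positivity)]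
  have := heatKernel_nonneg hν hτ z
  gcongr
  exact abs_coord_le _ _

theorem kn_heatKernel {ν τ : ℝ} (hν : 0 < ν) (hτ : 0 < τ) :
    kn (heatKernel ν) τ = lpn 1 (gk ν 1) := by
  rw [← lpn_gk hν hτ, kn]
  congr 1
  ext1 z
  rw [gk, Real.enorm_of_nonneg (heatKernel_nonneg hν hτ z)]

theorem lpn_one_hk {ν τ : ℝ} (hν : 0 < ν) (hτ : 0 < τ) :
    lpn 1 (hk ν τ) = lpn 1 (hk ν 1) * ENNReal.ofReal (τ ^ (-(1 / 2 : ℝ))) := by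
  rw [lpn_hk hν hτ one_pos, mul_comm]
  norm_num

theorem kn_heatD_le {ν τ : ℝ} (hν : 0 < ν) (hτ : 0 < τ) (k : Fin 3) :
    kn (heatD ν k) τ ≤ lpn 1 (hk ν 1) * ENNReal.ofReal (τ ^ (-(1 / 2 : ℝ))) := by
  rw [← lpn_one_hk hν hτ]
  exact lpn_mono one_pos (Filter.Eventually.of_forall (enorm_heatD_le hν hτ k))

/-- The fundamental theorem of calculus along the segment writes the quotient as an average of
derivatives. -/
theorem enorm_heatQ_le {ν τ : ℝ} (hν : 0 < ν) (hτ : 0 < τ) (k : Fin 3) {h : ℝ} (hh : h ≠ 0)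
    (z : E3) : ‖heatQ ν k h τ z‖ₑ ≤ ∫⁻ θ in Ioc (0 : ℝ) 1, hk ν τ (z + (θ * h) • basisVec k) := by
  have hd : ∀ θ : ℝ, HasDerivAt (fun θ : ℝ => heatKernel ν τ (z + (θ * h) • basisVec k))
      (h * heatD ν k τ (z + (θ * h) • basisVec k)) θ := by
    intro θ
    have h1 := hasLineDerivAt_heatKernel ν τ k (z + (θ * h) • basisVec k)
    have h2 : HasDerivAt (fun r : ℝ => heatKernel ν τ (z + (θ * h) • basisVec k + r • basisVec k))
      (heatD ν k τ (z + (θ * h) • basisVec k)) ((θ - θ) * h) := by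
      rw [sub_self, zero_mul]; exact h1
    have h3 : HasDerivAt (fun r : ℝ => (r - θ) * h) h θ := by
      simpa using ((hasDerivAt_id θ).sub_const θ).mul_const h
    have h4 := h2.scomp θ h3
    rw [smul_eq_mul] at h4
    refine h4.congr_of_eventuallyEq (Filter.Eventually.of_forall fun r => ?_)
    simp only [Function.comp]
    rw [add_assoc, ← add_smul]
    ring_nf
  have hc : Continuous fun z => heatD ν k τ z := by
    have : Continuous (heatKernel ν τ) :=
      continuous_iff_continuousAt.2 fun z => (hasFDerivAt_heatKernel ν τ z).continuousAt
    unfold heatD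
    fun_prop
  have hci : Continuous fun θ : ℝ => h * heatD ν k τ (z + (θ * h) • basisVec k) := by fun_prop
  have e := intervalIntegral.integral_eq_sub_of_hasDerivAt (a := 0) (b := 1) (fun θ _ => hd θ)
    (hci.intervalIntegrable _ _)
  rw [zero_mul, zero_smul, add_zero, one_mul, intervalIntegral.integral_const_mul] at e
  rw [heatQ_apply, ← e, smul_eq_mul, inv_mul_cancel_left₀ hh,
    intervalIntegral.integral_of_le zero_le_one]
  exact (enorm_integral_le_lintegral_enorm _).trans
    (lintegral_mono fun θ => enorm_heatD_le hν hτ k _)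

/-- An average of translates has at most the L¹ norm of the gradient bound itself, so the estimate
is uniform in h. -/
theorem kn_heatQ_le {ν τ : ℝ} (hν : 0 < ν) (hτ : 0 < τ) (k : Fin 3) {h : ℝ} (hh : h ≠ 0) :
    kn (heatQ ν k h) τ ≤ lpn 1 (hk ν 1) * ENNReal.ofReal (τ ^ (-(1 / 2 : ℝ))) := by
  rw [← lpn_one_hk hν hτ, kn, lpn_one, lpn_one]
  have hm : Measurable fun q : E3 × ℝ => hk ν τ (q.1 + (q.2 * h) • basisVec k) :=
    (measurable_hk ν τ).comp (by fun_prop)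
  calc _ ≤ ∫⁻ z, ∫⁻ θ in Ioc (0 : ℝ) 1, hk ν τ (z + (θ * h) • basisVec k) :=
        lintegral_mono (enorm_heatQ_le hν hτ k hh)
    _ = ∫⁻ θ in Ioc (0 : ℝ) 1, ∫⁻ z, hk ν τ (z + (θ * h) • basisVec k) :=
        lintegral_lintegral_swap hm.aemeasurable
    _ = _ := by
        have e : ∀ θ : ℝ, ∫⁻ z, hk ν τ (z + (θ * h) • basisVec k) = ∫⁻ z, hk ν τ z := fun θ =>
          lintegral_add_right_eq_self (hk ν τ) ((θ * h) • basisVec k)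
        simp_rw [e]
        simp

/-- A Gaussian majorant of the gradient of the heat kernel near a point. -/
def heatMaj (ν τ : ℝ) (z : E3) : ℝ≥0∞ :=
  ENNReal.ofReal ((2 * ν * τ)⁻¹ * (4 * Real.pi * ν * τ) ^ (-(3 / 2 : ℝ)) *
    Real.exp (1 / (4 * ν * τ)) * ((‖z‖ + 1) * Real.exp (-(1 / (8 * ν * τ)) * ‖z‖ ^ 2)))

/-- For |w| ≤ 1 one has |z+w|² ≥ |z|²/2 - 1, so halving the Gaussian rate absorbs every unit
translation. -/
theorem hk_le_heatMaj {ν τ : ℝ} (hν : 0 < ν) (hτ : 0 < τ) (z w : E3) (hw : ‖w‖ ≤ 1) :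
    hk ν τ (z + w) ≤ heatMaj ν τ z := by
  unfold hk heatMaj heatKernel
  refine ENNReal.ofReal_le_ofReal ?_
  have h1 : ‖z + w‖ ≤ ‖z‖ + 1 := (norm_add_le _ _).trans (by linarith)
  have h2 : ‖z‖ ≤ ‖z + w‖ + 1 := by
    calc ‖z‖ = ‖(z + w) - w‖ := by simp
      _ ≤ ‖z + w‖ + ‖w‖ := norm_sub_le _ _
      _ ≤ _ := by linarith
  have h3 : -‖z + w‖ ^ 2 / (4 * ν * τ) ≤ 1 / (4 * ν * τ) + -(1 / (8 * ν * τ)) * ‖z‖ ^ 2 := by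
    have e : 1 / (4 * ν * τ) + -(1 / (8 * ν * τ)) * ‖z‖ ^ 2 = (1 - ‖z‖ ^ 2 / 2) / (4 * ν * τ) := by
      field_simp
      ring
    rw [e]
    gcongr
    nlinarith [norm_nonneg z, norm_nonneg (z + w), sq_nonneg (‖z + w‖ - 1)]
  calc _ ≤ (‖z‖ + 1) / (2 * ν * τ) * ((4 * Real.pi * ν * τ) ^ (-(3 / 2 : ℝ)) *
        (Real.exp (1 / (4 * ν * τ)) * Real.exp (-(1 / (8 * ν * τ)) * ‖z‖ ^ 2))) := by
        rw [← Real.exp_add]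
        gcongr
    _ = _ := by ring

theorem lintegral_heatMaj_lt_top {ν τ : ℝ} (hν : 0 < ν) (hτ : 0 < τ) :
    ∫⁻ z, heatMaj ν τ z < ⊤ := by
  set K := (2 * ν * τ)⁻¹ * (4 * Real.pi * ν * τ) ^ (-(3 / 2 : ℝ)) * Real.exp (1 / (4 * ν * τ))
  have hB : 0 < 1 / (8 * ν * τ) := by positivity
  have hi : IntegrableOn (fun r : ℝ => r ^ 2 * (K * ((r + 1) *
      Real.exp (-(1 / (8 * ν * τ)) * r ^ 2)))) (Ioi 0) := by
    refine IntegrableOn.congr_fun ((integrableOn_pow_mul_gaussian zero_le_one hB K).add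
      (integrableOn_pow_mul_gaussian le_rfl hB K)) (fun r _ => ?_) measurableSet_Ioi
    simp only [Pi.add_apply, Real.rpow_one, Real.rpow_zero]
    ring
  exact lintegral_radial_lt_top hi

/-- Pointwise convergence is differentiability of the kernel; for |h| < 1 the Gaussian majorant
dominates. -/
theorem kn_heatQ_sub_tendsto {ν τ : ℝ} (hν : 0 < ν) (hτ : 0 < τ) (k : Fin 3) :
    Filter.Tendsto (fun h => kn (heatQ ν k h - heatD ν k) τ) (nhdsWithin 0 {0}ᶜ) (nhds 0) := by
  have key := tendsto_lintegral_filter_of_dominated_convergence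
    (μ := (volume : Measure E3)) (l := nhdsWithin (0 : ℝ) {0}ᶜ)
    (F := fun h z => ‖heatQ ν k h τ z - heatD ν k τ z‖ₑ) (f := fun _ => 0)
    (fun z => 2 * heatMaj ν τ z) ?_ ?_ ?_ ?_
  · simpa [kn, lpn_one] using key
  · exact Filter.Eventually.of_forall fun h => ((Measurable.of_uncurry_left
      (measurable_heatQ ν k h)).sub (Measurable.of_uncurry_left (measurable_heatD ν k))).enorm
  · have hball : Metric.ball (0 : ℝ) 1 ∈ nhdsWithin (0 : ℝ) {0}ᶜ :=
      mem_nhdsWithin_of_mem_nhds (Metric.ball_mem_nhds 0 one_pos)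
    filter_upwards [hball, self_mem_nhdsWithin] with h hb hh
    refine Filter.Eventually.of_forall fun z => ?_
    have hh1 : |h| ≤ 1 := by
      rw [← Real.norm_eq_abs]; exact (mem_ball_zero_iff.1 hb).le
    rw [two_mul]
    refine enorm_sub_le.trans (add_le_add ?_ ?_)
    · refine (enorm_heatQ_le hν hτ k hh z).trans ?_
      calc _ ≤ ∫⁻ _θ in Ioc (0 : ℝ) 1, heatMaj ν τ z := by
            refine setLIntegral_mono' measurableSet_Ioc fun θ hθ => ?_
            refine hk_le_heatMaj hν hτ z _ ?_
            rw [norm_smul, norm_basisVec, mul_one, Real.norm_eq_abs, abs_mul, abs_of_pos hθ.1]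
            exact mul_le_one₀ hθ.2 (abs_nonneg h) hh1
        _ = _ := by simp
    · refine (enorm_heatD_le hν hτ k z).trans ?_
      simpa using hk_le_heatMaj hν hτ z 0 (by simp)
  · rw [lintegral_const_mul' _ _ (by simp)]
    exact (ENNReal.mul_lt_top (by simp) (lintegral_heatMaj_lt_top hν hτ)).ne
  · refine Filter.Eventually.of_forall fun z => ?_
    have h1 := (hasLineDerivAt_heatKernel ν τ k z).tendsto_slope_zero
    have h2 := (h1.sub_const (heatD ν k τ z)).enorm
    rw [sub_self, enorm_zero] at h2
    exact h2

/-- The convention for the heat semigroup at time zero matters at t = 0 only. For t ≠ 0 it affects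
the Duhamel integral at the single instant s = t. -/
theorem mildData_eq (ν : ℝ) (w₀ : E3 → E3) (g : ℝ → E3 → E3) (t : ℝ) (x : E3) :
    mildData ν w₀ g t x = if t = 0 then w₀ x else duh (heatKernel ν) w₀ g t x := by
  unfold mildData
  split_ifs with h
  · simp [h, heatSemigroup]
  · unfold duh
    have e1 : heatSemigroup ν t w₀ x = ∫ y, heatKernel ν t (x - y) • w₀ y := by
      simp [heatSemigroup, h]
    rw [e1]
    congr 1
    refine intervalIntegral.integral_congr_ae ?_
    have : ∀ᵐ s : ℝ, s ≠ t := by simp [ae_iff]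
    filter_upwards [this] with s hs _
    simp [heatSemigroup, sub_eq_zero, hs.symm]

theorem measurable_mildData (ν : ℝ) {w₀ : E3 → E3} {g : ℝ → E3 → E3} (hw : Measurable w₀)
    (hg : Measurable (Function.uncurry g)) : Measurable (Function.uncurry (mildData ν w₀ g)) := by
  have e : Function.uncurry (mildData ν w₀ g) = fun q : ℝ × E3 =>
      if q.1 = 0 then w₀ q.2 else duh (heatKernel ν) w₀ g q.1 q.2 := by
    ext1 q
    exact mildData_eq ν w₀ g q.1 q.2
  rw [e]
  exact Measurable.ite (measurable_fst (measurableSet_singleton 0)) (hw.comp measurable_snd)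
    (measurable_duh (measurable_heatKernel_uncurry ν) hw hg)

/-- The constant in the estimates of the heat flow of the data. -/
def dataC (ν : ℝ) : ℝ≥0∞ := 2 * lpn 1 (gk ν 1) + 2 * lpn 1 (hk ν 1)

theorem dataC_lt_top {ν : ℝ} (hν : 0 < ν) : dataC ν < ⊤ :=
  ENNReal.add_lt_top.2 ⟨ENNReal.mul_lt_top (by simp) (lintegral_gk_lt_top hν),
    ENNReal.mul_lt_top (by simp) (lpn_hk_lt_top hν one_pos)⟩

section data

variable {ν p T : ℝ} {w₀ : E3 → E3} {g : ℝ → E3 → E3} {b : ℝ≥0∞} {t : ℝ}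

theorem duhJ_heatKernel_le (hν : 0 < ν) (hb : ∀ s, vn p (g s) ≤ b) (ht : 0 < t) :
    duhJ p (heatKernel ν) w₀ g t ≤ dataC ν * (vn p w₀ + ENNReal.ofReal t * b) := by
  refine (duhJ_le (c := lpn 1 (gk ν 1)) (γ := 0) (fun τ hτ => ?_) (by norm_num) ht hb).trans ?_
  · rw [kn_heatKernel hν hτ]; simp
  · rw [neg_zero, Real.rpow_zero, ENNReal.ofReal_one, mul_one]
    gcongr
    exact le_self_add

theorem duhJ_heat_le_of_kn {κ : ℝ → E3 → ℝ} (hb : ∀ s, vn p (g s) ≤ b) (ht : 0 < t)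
    (hκ : ∀ τ, 0 < τ → kn κ τ ≤ lpn 1 (hk ν 1) * ENNReal.ofReal (τ ^ (-(1 / 2 : ℝ)))) :
    duhJ p κ w₀ g t ≤ dataC ν * (vn p w₀ + ENNReal.ofReal t * b) *
      ENNReal.ofReal (t ^ (-(1 / 2 : ℝ))) := by
  refine (duhJ_le hκ le_rfl ht hb).trans ?_
  gcongr
  exact le_add_self

theorem vn_mildData_le (hν : 0 < ν) (hp : 1 < p) (hw : Measurable w₀)
    (hg : Measurable (Function.uncurry g)) (hb : ∀ s, vn p (g s) ≤ b) (ht : 0 < t) :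
    vn p (mildData ν w₀ g t) ≤ dataC ν * (vn p w₀ + ENNReal.ofReal t * b) := by
  have e : mildData ν w₀ g t = duh (heatKernel ν) w₀ g t := by
    ext1 x; rw [mildData_eq, if_neg ht.ne']
  rw [e]
  exact (vn_duh_le hp (measurable_heatKernel_uncurry ν) hw hg ht.le).trans
    (duhJ_heatKernel_le hν hb ht)

theorem vn_duh_heatD_le (hν : 0 < ν) (hp : 1 < p) (hw : Measurable w₀)
    (hg : Measurable (Function.uncurry g)) (hb : ∀ s, vn p (g s) ≤ b) (ht : 0 < t) (k : Fin 3) :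
    vn p (duh (heatD ν k) w₀ g t) ≤ dataC ν * (vn p w₀ + ENNReal.ofReal t * b) *
      ENNReal.ofReal (t ^ (-(1 / 2 : ℝ))) :=
  (vn_duh_le hp (measurable_heatD ν k) hw hg ht.le).trans
    (duhJ_heat_le_of_kn hb ht fun _ hτ => kn_heatD_le hν hτ k)

/-- Difference quotients fall on the heat kernel, where they converge in L¹ with the bound τ^(-1/2).
Young's inequality and dominated convergence in time transfer this to the data. -/
theorem tame_mildData (hν : 0 < ν) (hp : 1 < p) (hw : Measurable w₀)
    (hg : Measurable (Function.uncurry g)) (hwp : vn p w₀ < ⊤) (hb : ∀ s, vn p (g s) ≤ b)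
    (hbt : b < ⊤) (k : Fin 3) :
    Tame p T k (mildData ν w₀ g) (duh (heatD ν k) w₀ g) := by
  have hp0 : 0 < p := by linarith
  have mG := measurable_heatKernel_uncurry ν
  have mT := measurable_heatTr ν k
  have hfin : ∀ t, dataC ν * (vn p w₀ + ENNReal.ofReal t * b) < ⊤ := fun t =>
    ENNReal.mul_lt_top (dataC_lt_top hν) (ENNReal.add_lt_top.2 ⟨hwp,
      ENNReal.mul_lt_top ENNReal.ofReal_lt_top hbt⟩)
  have hmono : ∀ t ∈ Ioc 0 T, dataC ν * (vn p w₀ + ENNReal.ofReal t * b) ≤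
      dataC ν * (vn p w₀ + ENNReal.ofReal T * b) := fun t ht => by
    have := ht.2
    gcongr
  have hdq : ∀ h, ∀ t ∈ Ioc 0 T, dq k h (mildData ν w₀ g t) =ᵐ[volume]
      duh (heatQ ν k h) w₀ g t := by
    intro h t ht
    have e : mildData ν w₀ g t = duh (heatKernel ν) w₀ g t := by
      ext1 x; rw [mildData_eq, if_neg ht.1.ne']
    have hJ : duhJ p (heatKernel ν) w₀ g t < ⊤ := (duhJ_heatKernel_le hν hb ht.1).trans_lt (hfin t)
    have hI := ae_duhInt hp mG hw hg hJ
    have hJ' : duhJ p (fun (τ : ℝ) (z : E3) => heatKernel ν τ (z + h • basisVec k)) w₀ g t < ⊤ := by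
      have : ∀ τ, kn (fun (τ : ℝ) (z : E3) => heatKernel ν τ (z + h • basisVec k)) τ =
          kn (heatKernel ν) τ := fun τ => lpn_comp_add (fun z => ‖heatKernel ν τ z‖ₑ) _
      simpa only [duhJ, this] using hJ
    filter_upwards [hI, ae_duhInt hp (mT h) hw hg hJ'] with x h1 h2
    rw [e, heatQ, duh_smul, duh_sub ht.1.le h2 h1, duh_translate]
    rfl
  refine ⟨measurable_mildData ν hw hg, measurable_duh (measurable_heatD ν k) hw hg,
    ⟨_, hfin T, fun t ht => ⟨?_, ?_, fun h hh => ?_⟩⟩, fun t ht => ?_⟩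
  · exact (vn_mildData_le hν hp hw hg hb ht.1).trans (hmono t ht)
  · exact (vn_duh_heatD_le hν hp hw hg hb ht.1 k).trans (mul_le_mul_left (hmono t ht) _)
  · rw [vn_congr (hdq h t ht)]
    exact (vn_duh_le hp (measurable_heatQ ν k h) hw hg ht.1.le).trans
      ((duhJ_heat_le_of_kn hb ht.1 fun _ hτ => kn_heatQ_le hν hτ k hh).trans
        (mul_le_mul_left (hmono t ht) _))
  · have hlim := duhJ_tendsto_zero (K := fun h => heatQ ν k h - heatD ν k) (p := p) (w₀ := w₀)
      (c := lpn 1 (hk ν 1) + lpn 1 (hk ν 1)) (γ := 1 / 2)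
      (fun h => (measurable_heatQ ν k h).sub (measurable_heatD ν k))
      (ENNReal.add_lt_top.2 ⟨lpn_hk_lt_top hν one_pos, lpn_hk_lt_top hν one_pos⟩) le_rfl ?_
      (fun τ hτ => kn_heatQ_sub_tendsto hν hτ k) ht.1 hg hbt hb hwp
    · refine tendsto_of_tendsto_of_tendsto_of_le_of_le' tendsto_const_nhds hlim
        (Filter.Eventually.of_forall fun _ => zero_le)
        (eventually_nhdsWithin_of_forall fun h hh => ?_)
      have hQ := ae_duhInt hp (measurable_heatQ ν k h) hw hg
        ((duhJ_heat_le_of_kn (ν := ν) hb ht.1 fun _ hτ => kn_heatQ_le hν hτ k hh).trans_lt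
          (ENNReal.mul_lt_top (hfin t) ENNReal.ofReal_lt_top))
      have hD := ae_duhInt hp (measurable_heatD ν k) hw hg
        ((duhJ_heat_le_of_kn (ν := ν) hb ht.1 fun _ hτ => kn_heatD_le hν hτ k).trans_lt
          (ENNReal.mul_lt_top (hfin t) ENNReal.ofReal_lt_top))
      have e : dq k h (mildData ν w₀ g t) - duh (heatD ν k) w₀ g t =ᵐ[volume]
          duh (heatQ ν k h - heatD ν k) w₀ g t := by
        filter_upwards [hdq h t ht, hQ, hD] with x h1 h2 h3
        rw [Pi.sub_apply, h1, duh_sub ht.1.le h2 h3]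
      rw [vn_congr e]
      exact vn_duh_le hp ((measurable_heatQ ν k h).sub (measurable_heatD ν k)) hw hg ht.1.le
    · intro h hh τ hτ
      rw [add_mul]
      refine le_trans ?_ (add_le_add (kn_heatQ_le hν hτ k hh) (kn_heatD_le hν hτ k))
      refine (lpn_mono one_pos (Filter.Eventually.of_forall fun z => enorm_sub_le)).trans
        (lpn_add_le le_rfl ?_ ?_)
      · exact (Measurable.of_uncurry_left (measurable_heatQ ν k h)).enorm
      · exact (Measurable.of_uncurry_left (measurable_heatD ν k)).enorm

end data

/-! ### Limits of geometrically convergent sequences of fields -/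

/-- The pointwise limit of a sequence of fields. -/
def fieldLim (F : ℕ → ℝ → E3 → E3) (t : ℝ) (x : E3) : E3 :=
  Filter.limUnder Filter.atTop fun n => F n t x

/-- Taking the limit pointwise in (t,x) keeps joint measurability, which L^p limits chosen
separately for each t would not provide. -/
theorem measurable_fieldLim {F : ℕ → ℝ → E3 → E3} (hF : ∀ n, Measurable (Function.uncurry (F n))) :
    Measurable (Function.uncurry (fieldLim F)) :=
  (StronglyMeasurable.limUnder (l := Filter.atTop)
    (f := fun n => Function.uncurry (F n)) fun n => (hF n).stronglyMeasurable).measurable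

theorem tendsto_const_mul_half_pow {c : ℝ≥0∞} (hc : c < ⊤) :
    Filter.Tendsto (fun n : ℕ => c * (2⁻¹ : ℝ≥0∞) ^ n) Filter.atTop (nhds 0) := by
  have h : Filter.Tendsto (fun n : ℕ => (2⁻¹ : ℝ≥0∞) ^ n) Filter.atTop (nhds 0) :=
    ENNReal.tendsto_pow_atTop_nhds_zero_of_lt_one (by simp)
  simpa using ENNReal.Tendsto.const_mul h (Or.inr hc.ne)

/-- Geometric increments make the slice converge almost everywhere at this very t, and Fatou's lemma
turns the telescoped bound into a rate for the limit. -/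
theorem vn_sub_fieldLim_le {p : ℝ} (hp : 1 ≤ p) {F : ℕ → ℝ → E3 → E3} {t : ℝ}
    (hF : ∀ n, Measurable (F n t)) {c : ℝ≥0∞} (hc : c < ⊤)
    (h : ∀ n, vn p (F (n + 1) t - F n t) ≤ c * 2⁻¹ ^ n) (n : ℕ) :
    vn p (F n t - fieldLim F t) ≤ 2 * c * 2⁻¹ ^ n := by
  have hp0 : 0 < p := by linarith
  have hneg : ∀ f g : E3 → E3, vn p (f - g) = vn p (g - f) := fun f g => by
    unfold vn
    congr 1
    ext1 x
    simp only [Pi.sub_apply]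
    exact enorm_sub_rev _ _
  have hhalf : ∀ n : ℕ, 2 * c * (2⁻¹ : ℝ≥0∞) ^ (n + 1) + c * 2⁻¹ ^ n = 2 * c * 2⁻¹ ^ n := fun n => by
    have : (2 : ℝ≥0∞) * 2⁻¹ = 1 := ENNReal.mul_inv_cancel (by simp) (by simp)
    calc _ = (2 * 2⁻¹) * c * (2⁻¹ : ℝ≥0∞) ^ n + c * 2⁻¹ ^ n := by ring
      _ = _ := by rw [this]; ring
  have hstep : ∀ j n, vn p (F (n + j) t - F n t) ≤ 2 * c * 2⁻¹ ^ n := by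
    intro j
    induction j with
    | zero => intro n; simp [vn_zero hp0]
    | succ j ih =>
      intro n
      have e : F (n + (j + 1)) t - F n t =
          (F (n + 1 + j) t - F (n + 1) t) + (F (n + 1) t - F n t) := by
        rw [show n + (j + 1) = n + 1 + j by ring]; abel
      rw [e, ← hhalf n]
      exact (vn_add_le hp ((hF _).sub (hF _)) ((hF _).sub (hF _))).trans
        (add_le_add (ih (n + 1)) (h n))
  -- Two telescoped tails give 4c; the added 1 secures the strict inequality, also when c = 0.
  have hcau : ∀ N n m : ℕ, N ≤ n → N ≤ m →
      eLpNorm (F n t - F m t) (ENNReal.ofReal p) volume < (4 * c + 1) * 2⁻¹ ^ N := by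
    intro N n m hn hm
    obtain ⟨a, rfl⟩ := Nat.exists_eq_add_of_le hn
    obtain ⟨b, rfl⟩ := Nat.exists_eq_add_of_le hm
    have e : F (N + a) t - F (N + b) t = (F (N + a) t - F N t) - (F (N + b) t - F N t) := by abel
    rw [eLpNorm_eq_vn hp0, e]
    refine ((vn_sub_le hp ((hF _).sub (hF _)) ((hF _).sub (hF _))).trans
      (add_le_add (hstep a N) (hstep b N))).trans_lt ?_
    have h0 : (2⁻¹ : ℝ≥0∞) ^ N ≠ 0 := by simp
    have h1 : (2⁻¹ : ℝ≥0∞) ^ N ≠ ⊤ := by simp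
    rw [← add_mul, ENNReal.mul_lt_mul_iff_left h0 h1, ← add_mul,
      show (2 : ℝ≥0∞) + 2 = 4 by norm_num]
    exact ENNReal.lt_add_right (ENNReal.mul_lt_top (by simp) hc).ne one_ne_zero
  have hsum : ∑' N : ℕ, (4 * c + 1) * (2⁻¹ : ℝ≥0∞) ^ N ≠ ⊤ := by
    rw [ENNReal.tsum_mul_left, ENNReal.tsum_geometric]
    refine ENNReal.mul_ne_top (ENNReal.add_lt_top.2 ⟨ENNReal.mul_lt_top (by simp) hc, by simp⟩).ne ?_
    rw [ENNReal.one_sub_inv_two, inv_inv]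
    simp
  have hae := Lp.ae_tendsto_of_cauchy_eLpNorm (μ := (volume : Measure E3))
    (f := fun n => F n t) (fun n => (hF n).aestronglyMeasurable)
    (by simpa using hp : 1 ≤ ENNReal.ofReal p) hsum hcau
  have hlim : ∀ᵐ x, Filter.Tendsto (fun j => (F n t - F (n + j) t) x) Filter.atTop
      (nhds ((F n t - fieldLim F t) x)) := by
    filter_upwards [hae] with x hx
    obtain ⟨l, hl⟩ := hx
    have e : fieldLim F t x = l := hl.limUnder_eq
    simp only [Pi.sub_apply, e]
    have h2 : Filter.Tendsto (fun j => F (n + j) t x) Filter.atTop (nhds l) := by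
      simpa only [add_comm] using (Filter.tendsto_add_atTop_iff_nat n).2 hl
    exact h2.const_sub _
  have hfat := Lp.eLpNorm_lim_le_liminf_eLpNorm (p := ENNReal.ofReal p)
    (fun j => ((hF n).sub (hF (n + j))).aestronglyMeasurable) _ hlim
  rw [← eLpNorm_eq_vn hp0]
  refine hfat.trans (Filter.liminf_le_of_le (by isBoundedDefault) fun b hb => ?_)
  obtain ⟨j, hj⟩ := hb.exists
  refine hj.trans ?_
  rw [eLpNorm_eq_vn hp0, hneg]
  exact hstep j n

/-! ### The bilinear operator with its derivatives -/

/-- The bilinear operator acting on a field together with its partial derivatives. -/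
def bilD (ν : ℝ) (φ : E3 → ℝ) (ε : ℝ) (U V : Option (Fin 3) → ℝ → E3 → E3) :
    Option (Fin 3) → ℝ → E3 → E3
  | none => bil ν φ ε (U none) (V none)
  | some k => bil ν φ ε (U (some k)) (V none) + bil ν φ ε (U none) (V (some k))

/-- `‖w(t)‖_p + t^{1/2} ∑_k ‖d_k(t)‖_p`. -/
def nrmD (p : ℝ) (U : Option (Fin 3) → ℝ → E3 → E3) (t : ℝ) : ℝ≥0∞ :=
  vn p (U none t) + ENNReal.ofReal (t ^ (1 / 2 : ℝ)) * ∑ k : Fin 3, vn p (U (some k) t)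

/-- Joint measurability of a field together with its partial derivatives. -/
def MeasD (U : Option (Fin 3) → ℝ → E3 → E3) : Prop := ∀ i, Measurable (Function.uncurry (U i))

theorem ofReal_half_mul {t : ℝ} (ht : 0 < t) :
    ENNReal.ofReal (t ^ (1 / 2 : ℝ)) * ENNReal.ofReal (t ^ (-(1 / 2 : ℝ))) = 1 := by
  rw [← ENNReal.ofReal_mul (by positivity), ← Real.rpow_add ht]
  norm_num

theorem vn_none_le_nrmD {p : ℝ} {U : Option (Fin 3) → ℝ → E3 → E3} {t : ℝ} :
    vn p (U none t) ≤ nrmD p U t := le_self_add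

theorem vn_some_le_nrmD {p : ℝ} {U : Option (Fin 3) → ℝ → E3 → E3} {t : ℝ} (ht : 0 < t)
    (k : Fin 3) : vn p (U (some k) t) ≤ nrmD p U t * ENNReal.ofReal (t ^ (-(1 / 2 : ℝ))) := by
  calc vn p (U (some k) t) = (ENNReal.ofReal (t ^ (1 / 2 : ℝ)) *
        ENNReal.ofReal (t ^ (-(1 / 2 : ℝ)))) * vn p (U (some k) t) := by
        rw [ofReal_half_mul ht, one_mul]
    _ = ENNReal.ofReal (t ^ (1 / 2 : ℝ)) * vn p (U (some k) t) *
        ENNReal.ofReal (t ^ (-(1 / 2 : ℝ))) := by ring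
    _ ≤ _ := by
        gcongr
        refine le_trans ?_ le_add_self
        gcongr
        exact Finset.single_le_sum (f := fun k => vn p (U (some k) t)) (fun _ _ => zero_le)
          (Finset.mem_univ k)

theorem nrmD_le_of_bounds {p : ℝ} {U : Option (Fin 3) → ℝ → E3 → E3} {t : ℝ} (ht : 0 < t)
    {a b : ℝ≥0∞} (h0 : vn p (U none t) ≤ a)
    (h1 : ∀ k, vn p (U (some k) t) ≤ b * ENNReal.ofReal (t ^ (-(1 / 2 : ℝ)))) :
    nrmD p U t ≤ a + 3 * b := by
  refine add_le_add h0 ?_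
  calc _ ≤ ENNReal.ofReal (t ^ (1 / 2 : ℝ)) *
        ∑ _k : Fin 3, b * ENNReal.ofReal (t ^ (-(1 / 2 : ℝ))) := by
        gcongr with k
        exact h1 k
    _ = 3 * b * (ENNReal.ofReal (t ^ (1 / 2 : ℝ)) * ENNReal.ofReal (t ^ (-(1 / 2 : ℝ)))) := by
        rw [Finset.sum_const, Finset.card_univ, Fintype.card_fin, nsmul_eq_mul]
        push_cast
        ring
    _ = _ := by rw [ofReal_half_mul ht, mul_one]

theorem nrmD_congr {p : ℝ} {U V : Option (Fin 3) → ℝ → E3 → E3} {t : ℝ}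
    (h : ∀ i, U i t =ᵐ[volume] V i t) : nrmD p U t = nrmD p V t := by
  unfold nrmD
  rw [vn_congr (h none)]
  simp only [fun k => vn_congr (p := p) (h (some k))]

theorem MeasD.slice {U : Option (Fin 3) → ℝ → E3 → E3} (hU : MeasD U) (i : Option (Fin 3)) (t : ℝ) :
    Measurable (U i t) := measurable_slice (hU i) t

theorem nrmD_add_le {p : ℝ} (hp : 1 ≤ p) {U V : Option (Fin 3) → ℝ → E3 → E3} {t : ℝ}
    (hU : MeasD U) (hV : MeasD V) : nrmD p (U + V) t ≤ nrmD p U t + nrmD p V t := by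
  unfold nrmD
  calc _ ≤ (vn p (U none t) + vn p (V none t)) + ENNReal.ofReal (t ^ (1 / 2 : ℝ)) *
        ∑ k : Fin 3, (vn p (U (some k) t) + vn p (V (some k) t)) := by
        refine add_le_add (vn_add_le hp (hU.slice _ t) (hV.slice _ t)) ?_
        gcongr with k
        exact vn_add_le hp (hU.slice _ t) (hV.slice _ t)
    _ = _ := by rw [Finset.sum_add_distrib]; ring

theorem IsCutoff.measD_bilD {φ : E3 → ℝ} (hφ : IsCutoff φ) (ν ε : ℝ)
    {U V : Option (Fin 3) → ℝ → E3 → E3} (hU : MeasD U) (hV : MeasD V) :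
    MeasD (bilD ν φ ε U V) := by
  rintro (_ | k)
  · exact hφ.measurable_bil ν ε (hU _) (hV _)
  · exact (hφ.measurable_bil ν ε (hU _) (hV _)).add (hφ.measurable_bil ν ε (hU _) (hV _))

/-! ### The Picard iteration in the norm with derivatives. -/

section picard

variable {ν : ℝ} {φ : E3 → ℝ} {p ε T : ℝ}

theorem products_bound {U V : Option (Fin 3) → ℝ → E3 → E3} {A B : ℝ≥0∞}
    (hA : ∀ t ∈ Ioc 0 T, nrmD p U t ≤ A) (hB : ∀ t ∈ Ioc 0 T, nrmD p V t ≤ B) {t : ℝ}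
    (ht : t ∈ Ioc 0 T) :
    (∀ s ∈ Ioo 0 t, vn p (U none s) * vn p (V none s) ≤ A * B * ENNReal.ofReal (s ^ (-(0 : ℝ)))) ∧
    (∀ k, ∀ s ∈ Ioo 0 t, vn p (U (some k) s) * vn p (V none s) ≤
      A * B * ENNReal.ofReal (s ^ (-(1 / 2 : ℝ)))) ∧
    (∀ k, ∀ s ∈ Ioo 0 t, vn p (U none s) * vn p (V (some k) s) ≤
      A * B * ENNReal.ofReal (s ^ (-(1 / 2 : ℝ)))) := by
  have hin : ∀ s ∈ Ioo 0 t, s ∈ Ioc 0 T := fun s hs => ⟨hs.1, hs.2.le.trans ht.2⟩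
  refine ⟨fun s hs => ?_, fun k s hs => ?_, fun k s hs => ?_⟩
  · simpa using mul_le_mul' (vn_none_le_nrmD.trans (hA s (hin s hs)))
      (vn_none_le_nrmD.trans (hB s (hin s hs)))
  · calc _ ≤ (A * ENNReal.ofReal (s ^ (-(1 / 2 : ℝ)))) * B :=
        mul_le_mul' ((vn_some_le_nrmD hs.1 k).trans (mul_le_mul_left (hA s (hin s hs)) _))
          (vn_none_le_nrmD.trans (hB s (hin s hs)))
      _ = _ := by ring
  · calc _ ≤ A * (B * ENNReal.ofReal (s ^ (-(1 / 2 : ℝ)))) :=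
        mul_le_mul' (vn_none_le_nrmD.trans (hA s (hin s hs)))
          ((vn_some_le_nrmD hs.1 k).trans (mul_le_mul_left (hB s (hin s hs)) _))
      _ = _ := by ring

/-- Seven is one for the field plus three directions with two Leibniz terms each. -/
theorem nrmD_bilD_le (hν : 0 < ν) (hφ : IsCutoff φ) (hp : 3 / 2 < p) (hε : 0 ≤ ε)
    {U V : Option (Fin 3) → ℝ → E3 → E3} (hU : MeasD U) (hV : MeasD V) {A B : ℝ≥0∞}
    (hA : ∀ t ∈ Ioc 0 T, nrmD p U t ≤ A) (hB : ∀ t ∈ Ioc 0 T, nrmD p V t ≤ B) {t : ℝ}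
    (ht : t ∈ Ioc 0 T) : nrmD p (bilD ν φ ε U V) t ≤ 7 * bilC ν φ p T * (A * B) := by
  obtain ⟨b0, b1, b2⟩ := products_bound hA hB ht
  have hC := bilC_mono ν φ hp ht.1.le ht.2
  have hm : ∀ {u v : ℝ → E3 → E3}, Measurable (Function.uncurry u) →
      Measurable (Function.uncurry v) → Measurable (bil ν φ ε u v t) :=
    fun hu hv => measurable_slice (hφ.measurable_bil ν ε hu hv) t
  have h0 : vn p (bilD ν φ ε U V none t) ≤ bilC ν φ p T * (A * B) := by
    refine (vn_bil_le_of_bound hν hφ hp hε (hU _) (hV _) ht.1 le_rfl (by norm_num)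
      ((ae_restrict_mem measurableSet_Ioo).mono b0)).trans ?_
    rw [neg_zero, Real.rpow_zero, ENNReal.ofReal_one, mul_one]
    gcongr
  have h1 : ∀ k, vn p (bilD ν φ ε U V (some k) t) ≤
      2 * bilC ν φ p T * (A * B) * ENNReal.ofReal (t ^ (-(1 / 2 : ℝ))) := by
    intro k
    have e1 := vn_bil_le_of_bound hν hφ hp hε (hU (some k)) (hV none) ht.1 (by norm_num) le_rfl
      ((ae_restrict_mem measurableSet_Ioo).mono (b1 k))
    have e2 := vn_bil_le_of_bound hν hφ hp hε (hU none) (hV (some k)) ht.1 (by norm_num) le_rfl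
      ((ae_restrict_mem measurableSet_Ioo).mono (b2 k))
    refine (vn_add_le (by linarith) (hm (hU _) (hV _)) (hm (hU _) (hV _))).trans
      ((add_le_add e1 e2).trans ?_)
    calc _ = 2 * bilC ν φ p t * (A * B) * ENNReal.ofReal (t ^ (-(1 / 2 : ℝ))) := by ring
      _ ≤ _ := by gcongr
  exact (nrmD_le_of_bounds ht.1 h0 h1).trans (le_of_eq (by ring))

/-- Polarisation B(u,u) - B(v,v) = B(u-v,u) + B(v,u-v), component by component. It holds where all
the integrals involved converge absolutely, hence almost everywhere. -/
theorem bilD_sub_ae (hν : 0 < ν) (hφ : IsCutoff φ) (hp : 3 / 2 < p) (hp3 : p < 3) (hε : 0 ≤ ε)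
    {U V : Option (Fin 3) → ℝ → E3 → E3} (hU : MeasD U) (hV : MeasD V) {A : ℝ≥0∞} (hAt : A < ⊤)
    (hA : ∀ t ∈ Ioc 0 T, nrmD p U t ≤ A) (hB : ∀ t ∈ Ioc 0 T, nrmD p V t ≤ A) {t : ℝ}
    (ht : t ∈ Ioc 0 T) (i : Option (Fin 3)) :
    (bilD ν φ ε U U - bilD ν φ ε V V) i t =ᵐ[volume]
      (bilD ν φ ε (U - V) U + bilD ν φ ε V (U - V)) i t := by
  have hAA : A * A < ⊤ := ENNReal.mul_lt_top hAt hAt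
  have hin : ∀ s ∈ Ioo 0 t, s ∈ Ioc 0 T := fun s hs => ⟨hs.1, hs.2.le.trans ht.2⟩
  have fin : ∀ {X : Option (Fin 3) → ℝ → E3 → E3}, (∀ t ∈ Ioc 0 T, nrmD p X t ≤ A) →
      ∀ i, ∀ s ∈ Ioo 0 t, vn p (X i s) < ⊤ := by
    rintro X hX (_ | k) s hs
    · exact (vn_none_le_nrmD.trans (hX s (hin s hs))).trans_lt hAt
    · exact ((vn_some_le_nrmD hs.1 k).trans (mul_le_mul_left (hX s (hin s hs)) _)).trans_lt
        (ENNReal.mul_lt_top hAt ENNReal.ofReal_lt_top)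
  have I0 : ∀ {X Y : Option (Fin 3) → ℝ → E3 → E3}, MeasD X → MeasD Y →
      (∀ t ∈ Ioc 0 T, nrmD p X t ≤ A) → (∀ t ∈ Ioc 0 T, nrmD p Y t ≤ A) →
      ∀ᵐ x, BilInt ν φ ε (X none) (Y none) t x := fun mX mY hX hY =>
    ae_bilInt_of_bound hν hφ hp hp3 hε (mX _) (mY _) ht.1 le_rfl (by norm_num) hAA
      (products_bound hX hY ht).1
  have I1 : ∀ {X Y : Option (Fin 3) → ℝ → E3 → E3}, MeasD X → MeasD Y →
      (∀ t ∈ Ioc 0 T, nrmD p X t ≤ A) → (∀ t ∈ Ioc 0 T, nrmD p Y t ≤ A) →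
      ∀ k, ∀ᵐ x, BilInt ν φ ε (X (some k)) (Y none) t x := fun mX mY hX hY k =>
    ae_bilInt_of_bound hν hφ hp hp3 hε (mX _) (mY _) ht.1 (by norm_num) le_rfl hAA
      ((products_bound hX hY ht).2.1 k)
  have I2 : ∀ {X Y : Option (Fin 3) → ℝ → E3 → E3}, MeasD X → MeasD Y →
      (∀ t ∈ Ioc 0 T, nrmD p X t ≤ A) → (∀ t ∈ Ioc 0 T, nrmD p Y t ≤ A) →
      ∀ k, ∀ᵐ x, BilInt ν φ ε (X none) (Y (some k)) t x := fun mX mY hX hY k =>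
    ae_bilInt_of_bound hν hφ hp hp3 hε (mX _) (mY _) ht.1 (by norm_num) le_rfl hAA
      ((products_bound hX hY ht).2.2 k)
  have t0 := ht.1.le
  rcases i with _ | k
  · filter_upwards [I0 hU hU hA hA, I0 hV hU hB hA, I0 hV hV hB hB] with x h1 h2 h3
    simp only [Pi.sub_apply, Pi.add_apply, bilD]
    rw [bil_sub_left hφ hp hp3 hε t0 (hU _) (hV _) (fin hA _) (fin hB _) h1 h2,
      bil_sub_right t0 h2 h3]
    abel
  · filter_upwards [I1 hU hU hA hA k, I1 hV hU hB hA k, I1 hV hV hB hB k, I2 hU hU hA hA k,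
      I2 hV hU hB hA k, I2 hV hV hB hB k] with x h1 h2 h3 h4 h5 h6
    simp only [Pi.sub_apply, Pi.add_apply, bilD]
    rw [bil_sub_left hφ hp hp3 hε t0 (hU _) (hV _) (fin hA _) (fin hB _) h1 h2,
      bil_sub_left hφ hp hp3 hε t0 (hU _) (hV _) (fin hA _) (fin hB _) h4 h5,
      bil_sub_right t0 h2 h3, bil_sub_right t0 h5 h6]
    abel

theorem nrmD_bilD_sub_le (hν : 0 < ν) (hφ : IsCutoff φ) (hp : 3 / 2 < p) (hp3 : p < 3)
    (hε : 0 ≤ ε) {U V : Option (Fin 3) → ℝ → E3 → E3} (hU : MeasD U) (hV : MeasD V) {A δ : ℝ≥0∞}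
    (hAt : A < ⊤) (hA : ∀ t ∈ Ioc 0 T, nrmD p U t ≤ A) (hB : ∀ t ∈ Ioc 0 T, nrmD p V t ≤ A)
    (hδ : ∀ t ∈ Ioc 0 T, nrmD p (U - V) t ≤ δ) {t : ℝ} (ht : t ∈ Ioc 0 T) :
    nrmD p (bilD ν φ ε U U - bilD ν φ ε V V) t ≤ 14 * bilC ν φ p T * A * δ := by
  have hUV : MeasD (U - V) := fun i => (hU i).sub (hV i)
  rw [nrmD_congr (bilD_sub_ae hν hφ hp hp3 hε hU hV hAt hA hB ht)]
  refine (nrmD_add_le (by linarith) (hφ.measD_bilD ν ε hUV hU) (hφ.measD_bilD ν ε hV hUV)).trans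
    ((add_le_add (nrmD_bilD_le hν hφ hp hε hUV hU hδ hA ht)
      (nrmD_bilD_le hν hφ hp hε hV hUV hB hδ ht)).trans (le_of_eq ?_))
  ring

/-- The Picard iterates. -/
def picard (ν : ℝ) (φ : E3 → ℝ) (ε : ℝ) (W : Option (Fin 3) → ℝ → E3 → E3) :
    ℕ → Option (Fin 3) → ℝ → E3 → E3
  | 0 => W
  | n + 1 => W + bilD ν φ ε (picard ν φ ε W n) (picard ν φ ε W n)

theorem measD_picard (hφ : IsCutoff φ) {W : Option (Fin 3) → ℝ → E3 → E3} (hW : MeasD W) (n : ℕ) :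
    MeasD (picard ν φ ε W n) := by
  induction n with
  | zero => exact hW
  | succ n ih => exact fun i => (hW i).add (hφ.measD_bilD ν ε ih ih i)

variable {W : Option (Fin 3) → ℝ → E3 → E3} {M : ℝ≥0∞}

/-- On the ball of radius 2M the quadratic term is at most 7C(2M)² = 28CM · M, with C = `bilC ν φ p
T`. The bound 28CM ≤ 1 would suffice here; the constant 56 is set by the contraction. -/
theorem nrmD_picard_le (hν : 0 < ν) (hφ : IsCutoff φ) (hp : 3 / 2 < p) (hε : 0 ≤ ε)
    (hW : MeasD W) (hM : ∀ t ∈ Ioc 0 T, nrmD p W t ≤ M)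
    (hsmall : 56 * bilC ν φ p T * M ≤ 1) (n : ℕ) :
    ∀ t ∈ Ioc 0 T, nrmD p (picard ν φ ε W n) t ≤ 2 * M := by
  induction n with
  | zero => exact fun t ht => (hM t ht).trans (by rw [two_mul]; exact le_self_add)
  | succ n ih =>
    intro t ht
    have hm := measD_picard (ν := ν) (ε := ε) hφ hW n
    refine (nrmD_add_le (by linarith) hW (hφ.measD_bilD ν ε hm hm)).trans ?_
    rw [two_mul]
    refine add_le_add (hM t ht) ((nrmD_bilD_le hν hφ hp hε hm hm ih ih ht).trans ?_)
    calc _ = 28 * bilC ν φ p T * M * M := by ring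
      _ ≤ 56 * bilC ν φ p T * M * M := by gcongr; norm_num
      _ ≤ 1 * M := by gcongr
      _ = M := one_mul M

/-- On that ball the Lipschitz constant is 14C(2M) = 28CM ≤ 1/2, so each increment is at most half
the preceding bound. -/
theorem nrmD_picard_sub_le (hν : 0 < ν) (hφ : IsCutoff φ) (hp : 3 / 2 < p) (hp3 : p < 3)
    (hε : 0 ≤ ε) (hW : MeasD W) (hMt : M < ⊤) (hM : ∀ t ∈ Ioc 0 T, nrmD p W t ≤ M)
    (hsmall : 56 * bilC ν φ p T * M ≤ 1) (n : ℕ) :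
    ∀ t ∈ Ioc 0 T, nrmD p (picard ν φ ε W (n + 1) - picard ν φ ε W n) t ≤ M * 2⁻¹ ^ n := by
  induction n with
  | zero =>
    intro t ht
    have e : picard ν φ ε W 1 - picard ν φ ε W 0 = bilD ν φ ε W W := by
      simp [picard]
    rw [e, pow_zero, mul_one]
    refine (nrmD_bilD_le hν hφ hp hε hW hW hM hM ht).trans ?_
    calc _ = 7 * bilC ν φ p T * M * M := by ring
      _ ≤ 56 * bilC ν φ p T * M * M := by gcongr; norm_num
      _ ≤ 1 * M := by gcongr
      _ = M := one_mul M
  | succ n ih =>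
    intro t ht
    have hm := measD_picard (ν := ν) (ε := ε) hφ hW
    have hb := nrmD_picard_le (ε := ε) hν hφ hp hε hW hM hsmall
    have e : picard ν φ ε W (n + 1 + 1) - picard ν φ ε W (n + 1) =
        bilD ν φ ε (picard ν φ ε W (n + 1)) (picard ν φ ε W (n + 1)) -
        bilD ν φ ε (picard ν φ ε W n) (picard ν φ ε W n) := by
      rw [picard, add_sub_assoc]
      nth_rw 3 [picard]
      abel
    rw [e]
    refine (nrmD_bilD_sub_le hν hφ hp hp3 hε (hm _) (hm _) (ENNReal.mul_lt_top (by simp) hMt)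
      (hb _) (hb _) ih ht).trans ?_
    have h2 : (28 : ℝ≥0∞) = 56 * 2⁻¹ := by
      rw [← div_eq_mul_inv, ENNReal.eq_div_iff (by simp) (by simp)]; norm_num
    calc _ = 28 * bilC ν φ p T * M * (M * 2⁻¹ ^ n) := by ring
      _ = (56 * bilC ν φ p T * M) * (M * 2⁻¹ ^ (n + 1)) := by rw [h2]; ring
      _ ≤ 1 * (M * 2⁻¹ ^ (n + 1)) := by gcongr
      _ = _ := one_mul _

/-- Links the two halves of the iteration: the components evolved by the Leibniz rule are true L^p
derivatives of the field. -/
theorem picard_tame (hν : 0 < ν) (hφ : IsCutoff φ) (hp : 3 / 2 < p) (hp3 : p < 3) (hε : 0 ≤ ε)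
    {k : Fin 3} (hT : Tame p T k (W none) (W (some k))) (n : ℕ) :
    Tame p T k (picard ν φ ε W n none) (picard ν φ ε W n (some k)) := by
  induction n with
  | zero => exact hT
  | succ n ih => exact hT.add (by linarith) (ih.bil hν hφ hp hp3 hε)

end picard

/-! ### Convergence of the Picard iteration -/

theorem ae_eq_of_vn_sub_eq_zero {p : ℝ} (hp : 0 < p) {f g : E3 → E3} (hf : Measurable f)
    (hg : Measurable g) (h : vn p (f - g) = 0) : f =ᵐ[volume] g := by
  rw [← eLpNorm_eq_vn hp, eLpNorm_eq_zero_iff (hf.sub hg).aestronglyMeasurable (by simpa using hp)]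
    at h
  filter_upwards [h] with x hx
  exact sub_eq_zero.1 hx

theorem nrmD_sub_le {p : ℝ} (hp : 1 ≤ p) {U V : Option (Fin 3) → ℝ → E3 → E3} {t : ℝ}
    (hU : MeasD U) (hV : MeasD V) : nrmD p (U - V) t ≤ nrmD p U t + nrmD p V t := by
  unfold nrmD
  calc _ ≤ (vn p (U none t) + vn p (V none t)) + ENNReal.ofReal (t ^ (1 / 2 : ℝ)) *
        ∑ k : Fin 3, (vn p (U (some k) t) + vn p (V (some k) t)) := by
        refine add_le_add (vn_sub_le hp (hU.slice _ t) (hV.slice _ t)) ?_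
        gcongr with k
        exact vn_sub_le hp (hU.slice _ t) (hV.slice _ t)
    _ = _ := by rw [Finset.sum_add_distrib]; ring

theorem bil_zero_time (ν : ℝ) (φ : E3 → ℝ) (ε : ℝ) (u v : ℝ → E3 → E3) (x : E3) :
    bil ν φ ε u v 0 x = 0 := by
  unfold bil
  exact intervalIntegral.integral_same

/-- The limit of a sequence of fields with their partial derivatives. -/
def limD (P : ℕ → Option (Fin 3) → ℝ → E3 → E3) : Option (Fin 3) → ℝ → E3 → E3 :=
  fun i => fieldLim fun n => P n i

section limits

variable {p T : ℝ} {P : ℕ → Option (Fin 3) → ℝ → E3 → E3} {M : ℝ≥0∞}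

theorem measD_limD (mP : ∀ n, MeasD (P n)) : MeasD (limD P) :=
  fun i => measurable_fieldLim fun n => mP n i

theorem vn_none_sub_limD_le (hp : 1 ≤ p) (mP : ∀ n, MeasD (P n)) (hMt : M < ⊤) {t : ℝ}
    (dP : ∀ n, nrmD p (P (n + 1) - P n) t ≤ M * 2⁻¹ ^ n) (n : ℕ) :
    vn p (P n none t - limD P none t) ≤ 2 * M * 2⁻¹ ^ n :=
  vn_sub_fieldLim_le (F := fun n => P n none) hp (fun n => (mP n).slice none t) hMt
    (fun n => (vn_none_le_nrmD (U := P (n + 1) - P n)).trans (dP n)) n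

theorem vn_some_sub_limD_le (hp : 1 ≤ p) (mP : ∀ n, MeasD (P n)) (hMt : M < ⊤) {t : ℝ}
    (ht : 0 < t) (dP : ∀ n, nrmD p (P (n + 1) - P n) t ≤ M * 2⁻¹ ^ n) (k : Fin 3) (n : ℕ) :
    vn p (P n (some k) t - limD P (some k) t) ≤
      2 * (M * ENNReal.ofReal (t ^ (-(1 / 2 : ℝ)))) * 2⁻¹ ^ n :=
  vn_sub_fieldLim_le (F := fun n => P n (some k)) hp (fun n => (mP n).slice (some k) t)
    (ENNReal.mul_lt_top hMt ENNReal.ofReal_lt_top) (fun n =>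
      ((vn_some_le_nrmD (U := P (n + 1) - P n) ht k).trans (mul_le_mul_left (dP n) _)).trans
        (le_of_eq (by ring))) n

theorem nrmD_sub_limD_le (hp : 1 ≤ p) (mP : ∀ n, MeasD (P n)) (hMt : M < ⊤) {t : ℝ}
    (ht : 0 < t) (dP : ∀ n, nrmD p (P (n + 1) - P n) t ≤ M * 2⁻¹ ^ n) (n : ℕ) :
    nrmD p (P n - limD P) t ≤ 8 * M * 2⁻¹ ^ n := by
  have h0 : vn p ((P n - limD P) none t) ≤ 2 * M * 2⁻¹ ^ n := vn_none_sub_limD_le hp mP hMt dP n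
  have h1 : ∀ k, vn p ((P n - limD P) (some k) t) ≤
      2 * M * 2⁻¹ ^ n * ENNReal.ofReal (t ^ (-(1 / 2 : ℝ))) := fun k =>
    (vn_some_sub_limD_le hp mP hMt ht dP k n).trans (le_of_eq (by ring))
  exact (nrmD_le_of_bounds ht h0 h1).trans (le_of_eq (by ring))

theorem nrmD_limD_le (hp : 1 ≤ p) (mP : ∀ n, MeasD (P n)) (hMt : M < ⊤) {t : ℝ}
    (ht : 0 < t) (dP : ∀ n, nrmD p (P (n + 1) - P n) t ≤ M * 2⁻¹ ^ n)
    (bP : ∀ n, nrmD p (P n) t ≤ 2 * M) : nrmD p (limD P) t ≤ 2 * M := by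
  have hlim : Filter.Tendsto (fun n : ℕ => 2 * M + 8 * M * 2⁻¹ ^ n) Filter.atTop
      (nhds (2 * M)) := by
    simpa using (tendsto_const_mul_half_pow (ENNReal.mul_lt_top (by simp : (8 : ℝ≥0∞) < ⊤)
      hMt)).const_add (2 * M)
  refine ge_of_tendsto' hlim fun n => ?_
  have e : limD P = P n - (P n - limD P) := (sub_sub_cancel _ _).symm
  have mU := measD_limD mP
  have mPU : MeasD (P n - limD P) := fun i => (mP n i).sub (mU i)
  calc nrmD p (limD P) t = nrmD p (P n - (P n - limD P)) t := congrArg (nrmD p · t) e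
    _ ≤ nrmD p (P n) t + nrmD p (P n - limD P) t := nrmD_sub_le hp (mP n) mPU
    _ ≤ _ := add_le_add (bP n) (nrmD_sub_limD_le hp mP hMt ht dP n)

theorem hasWeakPartial_limD (hp : 1 < p) (mP : ∀ n, MeasD (P n)) (hMt : M < ⊤) {t : ℝ}
    (ht : 0 < t) (dP : ∀ n, nrmD p (P (n + 1) - P n) t ≤ M * 2⁻¹ ^ n)
    (bP : ∀ n, nrmD p (P n) t ≤ 2 * M) {k : Fin 3}
    (hP : ∀ n, HasWeakPartial k (P n none t) (P n (some k) t)) :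
    HasWeakPartial k (limD P none t) (limD P (some k) t) := by
  have fin : ∀ {X : Option (Fin 3) → ℝ → E3 → E3}, nrmD p X t ≤ 2 * M → ∀ i, vn p (X i t) < ⊤ := by
    have h2M : 2 * M < ⊤ := ENNReal.mul_lt_top (by simp) hMt
    rintro X hX (_ | k)
    · exact (vn_none_le_nrmD.trans hX).trans_lt h2M
    · exact ((vn_some_le_nrmD ht k).trans (mul_le_mul_left hX _)).trans_lt
        (ENNReal.mul_lt_top h2M ENNReal.ofReal_lt_top)
  have l0 := tendsto_const_mul_half_pow (ENNReal.mul_lt_top (by simp : (2 : ℝ≥0∞) < ⊤) hMt)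
  have l1 := tendsto_const_mul_half_pow (ENNReal.mul_lt_top (by simp : (2 : ℝ≥0∞) < ⊤)
    (ENNReal.mul_lt_top hMt (ENNReal.ofReal_lt_top (r := t ^ (-(1 / 2 : ℝ))))))
  have mU := measD_limD mP
  have bU := nrmD_limD_le hp.le mP hMt ht dP bP
  exact hasWeakPartial_of_tendsto hp (fun n => (mP n).slice none t)
    (fun n => (mP n).slice (some k) t) (mU.slice none t) (mU.slice (some k) t)
    (fun n => fin (bP n) _) (fun n => fin (bP n) _) (fin bU _) (fin bU _)
    (tendsto_of_tendsto_of_tendsto_of_le_of_le tendsto_const_nhds l0 (fun _ => zero_le)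
      (vn_none_sub_limD_le hp.le mP hMt dP))
    (tendsto_of_tendsto_of_tendsto_of_le_of_le tendsto_const_nhds l1 (fun _ => zero_le)
      (vn_some_sub_limD_le hp.le mP hMt ht dP k)) hP

end limits

theorem picard_none_zero (ν : ℝ) (φ : E3 → ℝ) (ε : ℝ) (W : Option (Fin 3) → ℝ → E3 → E3) (n : ℕ) :
    picard ν φ ε W n none 0 = W none 0 := by
  cases n with
  | zero => rfl
  | succ n =>
    ext1 x
    simp only [picard, Pi.add_apply, bilD, bil_zero_time, add_zero]

/-- Both sides lie within a multiple of 2^(-n) of the iterate n + 1, for every n, so the L^p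
distance between them is zero at this fixed t. -/
theorem limD_picard_eq {ν : ℝ} {φ : E3 → ℝ} {p ε T : ℝ} (hν : 0 < ν) (hφ : IsCutoff φ)
    (hp : 3 / 2 < p) (hp3 : p < 3) (hε : 0 ≤ ε) {W : Option (Fin 3) → ℝ → E3 → E3} {M : ℝ≥0∞}
    (hW : MeasD W) (hMt : M < ⊤) (hM : ∀ t ∈ Ioc 0 T, nrmD p W t ≤ M)
    (hsmall : 56 * bilC ν φ p T * M ≤ 1) {U : Option (Fin 3) → ℝ → E3 → E3}
    (hU : limD (picard ν φ ε W) = U) {t : ℝ} (ht' : t ∈ Ioc 0 T) :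
    U none t =ᵐ[volume] fun x => W none t x + bil ν φ ε (U none) (U none) t x := by
  have hp1 : 1 ≤ p := by linarith
  have hp0 : 0 < p := by linarith
  have mP := measD_picard (ν := ν) (ε := ε) hφ hW
  have bP := nrmD_picard_le (ε := ε) hν hφ hp hε hW hM hsmall
  have dP := nrmD_picard_sub_le (ε := ε) hν hφ hp hp3 hε hW hMt hM hsmall
  have mU : MeasD U := hU ▸ measD_limD mP
  have bU : ∀ t ∈ Ioc 0 T, nrmD p U t ≤ 2 * M := fun t ht =>
    hU ▸ nrmD_limD_le hp1 mP hMt ht.1 (fun n => dP n t ht) fun n => bP n t ht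
  have c0 : ∀ n, vn p (picard ν φ ε W n none t - U none t) ≤ 2 * M * 2⁻¹ ^ n := fun n =>
    hU ▸ vn_none_sub_limD_le hp1 mP hMt (fun n => dP n t ht') n
  have cN : ∀ n, ∀ t ∈ Ioc 0 T, nrmD p (picard ν φ ε W n - U) t ≤ 8 * M * 2⁻¹ ^ n :=
    fun n t ht => hU ▸ nrmD_sub_limD_le hp1 mP hMt ht.1 (fun n => dP n t ht) n
  have mB := hφ.measD_bilD ν ε mU mU
  have mR : Measurable ((W + bilD ν φ ε U U) none t) := (hW.slice none t).add (mB.slice none t)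
  refine ae_eq_of_vn_sub_eq_zero hp0 (mU.slice none t) mR (le_antisymm ?_ zero_le)
  have hct : 2 * M + 14 * bilC ν φ p T * (2 * M) * (8 * M) < ⊤ := by
    have h2M : ∀ a : ℝ≥0∞, a < ⊤ → a * M < ⊤ := fun a ha => ENNReal.mul_lt_top ha hMt
    exact ENNReal.add_lt_top.2 ⟨h2M _ (by simp), ENNReal.mul_lt_top (ENNReal.mul_lt_top
      (ENNReal.mul_lt_top (by simp) (bilC_lt_top hν hφ hp hp3 T)) (h2M _ (by simp)))
      (h2M _ (by simp))⟩
  refine ge_of_tendsto' (tendsto_const_mul_half_pow hct) fun n => ?_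
  have e2 : picard ν φ ε W (n + 1) none t - (W + bilD ν φ ε U U) none t =
      (bilD ν φ ε (picard ν φ ε W n) (picard ν φ ε W n) - bilD ν φ ε U U) none t := by
    ext1 x
    simp only [picard, Pi.add_apply, Pi.sub_apply]
    exact add_sub_add_left_eq_sub _ _ _
  have e : U none t - (W + bilD ν φ ε U U) none t =
      (picard ν φ ε W (n + 1) none t - (W + bilD ν φ ε U U) none t) -
        (picard ν φ ε W (n + 1) none t - U none t) := (sub_sub_sub_cancel_left _ _ _).symm
  change vn p (U none t - (W + bilD ν φ ε U U) none t) ≤ _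
  rw [e]
  refine (vn_sub_le hp1 (((mP _).slice none t).sub mR)
    (((mP _).slice none t).sub (mU.slice none t))).trans ?_
  rw [e2]
  have h3 := nrmD_bilD_sub_le hν hφ hp hp3 hε (mP n) mU (ENNReal.mul_lt_top (by simp) hMt)
    (bP n) bU (cN n) ht'
  have h4 : 2 * M * (2⁻¹ : ℝ≥0∞) ^ (n + 1) ≤ 2 * M * 2⁻¹ ^ n := by
    gcongr 1
    exact pow_le_pow_right_of_le_one' (by simp) (Nat.le_succ n)
  refine (add_le_add (vn_none_le_nrmD.trans h3) ((c0 (n + 1)).trans h4)).trans (le_of_eq ?_)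
  ring

theorem exists_fixed_point {ν : ℝ} {φ : E3 → ℝ} {p ε T : ℝ} (hν : 0 < ν) (hφ : IsCutoff φ)
    (hp : 3 / 2 < p) (hp3 : p < 3) (hε : 0 ≤ ε) {W : Option (Fin 3) → ℝ → E3 → E3} {M : ℝ≥0∞}
    (hT : ∀ k, Tame p T k (W none) (W (some k)))
    (hMt : M < ⊤) (hM : ∀ t ∈ Ioc 0 T, nrmD p W t ≤ M) (hsmall : 56 * bilC ν φ p T * M ≤ 1) :
    ∃ U : Option (Fin 3) → ℝ → E3 → E3, MeasD U ∧ (∀ t ∈ Ioc 0 T, nrmD p U t ≤ 2 * M) ∧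
      (∀ t ∈ Ioc 0 T, ∀ k, HasWeakPartial k (U none t) (U (some k) t)) ∧
      ∀ t ∈ Icc 0 T, U none t =ᵐ[volume]
        fun x => W none t x + bil ν φ ε (U none) (U none) t x := by
  have hp1 : 1 ≤ p := by linarith
  have hp0 : 0 < p := by linarith
  have hW : MeasD W := by
    rintro (_ | k)
    · exact (hT 0).meas
    · exact (hT k).meas'
  have mP := measD_picard (ν := ν) (ε := ε) hφ hW
  have bP := nrmD_picard_le (ε := ε) hν hφ hp hε hW hM hsmall
  have dP := nrmD_picard_sub_le (ε := ε) hν hφ hp hp3 hε hW hMt hM hsmall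
  refine ⟨limD (picard ν φ ε W), measD_limD mP, fun t ht =>
    nrmD_limD_le hp1 mP hMt ht.1 (fun n => dP n t ht) fun n => bP n t ht, fun t ht k =>
    hasWeakPartial_limD (by linarith) mP hMt ht.1 (fun n => dP n t ht) (fun n => bP n t ht)
      fun n => (picard_tame hν hφ hp hp3 hε (hT k) n).hasWeakPartial (by linarith) ht,
    fun t ht => ?_⟩
  -- At t = 0 all iterates coincide, so the convergence lemma applies with increments bounded by c =
  -- 0.
  rcases eq_or_lt_of_le ht.1 with rfl | h0
  · have h1 := vn_sub_fieldLim_le hp1 (F := fun n => picard ν φ ε W n none) (t := 0) (c := 0)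
      (fun n => (mP n).slice none 0) (by simp)
      (fun n => by simp [picard_none_zero, vn_zero hp0]) 0
    have h2 := ae_eq_of_vn_sub_eq_zero hp0 ((mP 0).slice none 0) ((measD_limD mP).slice none 0)
      (le_antisymm (h1.trans (by simp)) zero_le)
    simp only [bil_zero_time, add_zero]
    exact h2.symm
  · exact limD_picard_eq hν hφ hp hp3 hε hW hMt hM hsmall rfl ⟨h0, ht.2⟩

/-! ### Measurable representatives -/

/-- A Borel version is set to zero at the times where its norm exceeds the bound. This alters it
only on a null set of times in [0,T], and the bound then holds at every real time. -/
theorem exists_measurable_rep {p T : ℝ} (hp : 0 < p) {v : ℝ → E3 → E3} (hv : JointlyMeasurable T v) :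
    ∃ u : ℝ → E3 → E3, Measurable (Function.uncurry u) ∧ (∀ s, vn p (u s) ≤ normF0 p T v) ∧
      ∀ᵐ s ∂(volume.restrict (Icc 0 T)), v s =ᵐ[volume] u s := by
  obtain ⟨m, hm, he⟩ := hv
  have hmm : Measurable (Function.uncurry fun (s : ℝ) (x : E3) => m (s, x)) := hm.measurable
  set b := normF0 p T v with hb
  set S : Set ℝ := {s | vn p (fun x => m (s, x)) ≤ b} with hS
  have hSm : MeasurableSet S := measurableSet_le (measurable_vn hmm) measurable_const
  refine ⟨fun s x => S.indicator (fun s => m (s, x)) s, ?_, fun s => ?_, ?_⟩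
  · have h1 := hm.measurable.indicator (measurable_fst hSm : MeasurableSet (Prod.fst ⁻¹' S))
    exact h1
  · by_cases hs : s ∈ S
    · simp only [indicator_of_mem hs]
      exact hs
    · simp only [indicator_of_notMem hs]
      exact (vn_zero hp).le.trans zero_le
  · filter_upwards [Measure.ae_ae_of_ae_prod he, ae_restrict_mem measurableSet_Icc] with s hs hsT
    have h1 : vn p (fun x => m (s, x)) = vn p (v s) := vn_congr (hs.mono fun x hx => hx.symm)
    have h2 : s ∈ S := by
      change vn p (fun x => m (s, x)) ≤ b
      rw [h1, ← eLpNorm_eq_vn hp, hb, normF0]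
      exact le_iSup₂ (f := fun t (_ : t ∈ Icc (0 : ℝ) T) =>
        eLpNorm (v t) (ENNReal.ofReal p) volume) s hsT
    filter_upwards [hs] with x hx
    rw [indicator_of_mem h2]
    exact hx

theorem ae_restrict_Ioo_of_Icc {T t : ℝ} (ht : t ≤ T) {P : ℝ → Prop}
    (h : ∀ᵐ s ∂(volume.restrict (Icc 0 T)), P s) : ∀ᵐ s ∂(volume.restrict (Ioo 0 t)), P s :=
  ae_restrict_of_ae_restrict_of_subset
    (show Ioo 0 t ⊆ Icc 0 T from fun _ hs => ⟨hs.1.le, hs.2.le.trans ht⟩) h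

theorem mildData_congr_of_pos {ν t : ℝ} (ht : 0 < t) {w₀ w₀' : E3 → E3} {g g' : ℝ → E3 → E3}
    (hw : w₀ =ᵐ[volume] w₀')
    (hg : ∀ᵐ s ∂(volume.restrict (Ioo 0 t)), g s =ᵐ[volume] g' s) :
    mildData ν w₀ g t = mildData ν w₀' g' t := by
  ext1 x
  unfold mildData
  congr 1
  · simp only [heatSemigroup, ht.ne', if_false]
    refine integral_congr_ae ?_
    filter_upwards [hw] with y hy
    rw [hy]
  · rw [intervalIntegral.integral_of_le ht.le, intervalIntegral.integral_of_le ht.le,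
      integral_Ioc_eq_integral_Ioo, integral_Ioc_eq_integral_Ioo]
    refine integral_congr_ae ?_
    filter_upwards [hg, ae_restrict_mem measurableSet_Ioo] with s hs hst
    have : t - s ≠ 0 := (sub_pos.2 hst.2).ne'
    simp only [heatSemigroup, this, if_false]
    refine integral_congr_ae ?_
    filter_upwards [hs] with y hy
    rw [hy]

theorem mildData_zero (ν : ℝ) (w₀ : E3 → E3) (g : ℝ → E3 → E3) : mildData ν w₀ g 0 = w₀ := by
  ext1 x
  rw [mildData_eq, if_pos rfl]

/-- Passing from slices to the product needs a measurable exceptional set, so the first field is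
replaced by a measurable version before Fubini is used. -/
theorem ae_prod_of_ae_ae {μ : Measure ℝ} [SFinite μ] {f g : ℝ → E3 → E3}
    (hf : AEStronglyMeasurable (fun q : ℝ × E3 => f q.1 q.2) (μ.prod volume))
    (hg : Measurable (Function.uncurry g)) (h : ∀ᵐ s ∂μ, f s =ᵐ[volume] g s) :
    ∀ᵐ q ∂(μ.prod volume), f q.1 q.2 = g q.1 q.2 := by
  obtain ⟨m, hm, he⟩ := hf
  have hmg : ∀ᵐ q ∂(μ.prod (volume : Measure E3)), m q = Function.uncurry g q := by
    refine (Measure.ae_prod_iff_ae_ae (measurableSet_eq_fun hm.measurable hg)).2 ?_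
    filter_upwards [h, Measure.ae_ae_of_ae_prod he] with s h1 h2
    filter_upwards [h1, h2] with x h3 h4
    exact h4.symm.trans h3
  filter_upwards [he, hmg] with q h1 h2
  exact h1.trans h2

/-! ### Uniqueness -/

/-- After reflection the integral over (0,t) is at most the one over (0,T), which tends to zero as
the rate grows, by dominated convergence. -/
theorem exists_exp_weight {β T : ℝ} (hβ : β < 1) (hT : 0 < T) {K : ℝ≥0∞} (hK : K < ⊤) :
    ∃ l : ℝ, ∀ t ∈ Ioc 0 T, K * ∫⁻ s in Ioo 0 t, ENNReal.ofReal ((t - s) ^ (-β)) *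
      ENNReal.ofReal (Real.exp (-l * (t - s))) ≤ 2⁻¹ := by
  have key := tendsto_lintegral_filter_of_dominated_convergence
    (μ := volume.restrict (Ioo 0 T)) (l := Filter.atTop)
    (F := fun (n : ℕ) s => ENNReal.ofReal (s ^ (-β)) * ENNReal.ofReal (Real.exp (-(n : ℝ) * s)))
    (f := fun _ => 0) (fun s => ENNReal.ofReal (s ^ (-β))) ?_ ?_ ?_ ?_
  · have k2 := ENNReal.Tendsto.const_mul (a := K) key (Or.inr hK.ne)
    simp only [lintegral_zero, mul_zero] at k2
    obtain ⟨n, hn⟩ := (k2.eventually_lt_const (show (0 : ℝ≥0∞) < 2⁻¹ by simp)).exists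
    refine ⟨n, fun t ht => ?_⟩
    rw [lintegral_Ioo_reflect (fun s => ENNReal.ofReal (s ^ (-β)) *
      ENNReal.ofReal (Real.exp (-(n : ℝ) * s)))]
    refine le_trans ?_ hn.le
    gcongr
    exact ht.2
  · exact Filter.Eventually.of_forall fun n => by fun_prop
  · refine Filter.Eventually.of_forall fun n => ?_
    filter_upwards [ae_restrict_mem measurableSet_Ioo] with s hs
    refine mul_le_of_le_one_right' ?_
    rw [ENNReal.ofReal_le_one, Real.exp_le_one_iff]
    have := hs.1
    have : 0 ≤ (n : ℝ) * s := by positivity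
    linarith
  · rw [lintegral_rpow_neg hβ hT]
    exact ENNReal.ofReal_ne_top
  · filter_upwards [ae_restrict_mem measurableSet_Ioo] with s hs
    have h1 : Filter.Tendsto (fun n : ℕ => Real.exp (-(n : ℝ) * s)) Filter.atTop (nhds 0) := by
      refine Real.tendsto_exp_atBot.comp ?_
      have := (tendsto_natCast_atTop_atTop (R := ℝ)).atTop_mul_const hs.1
      simpa only [neg_mul, Function.comp_def] using Filter.tendsto_neg_atTop_atBot.comp this
    have h2 := ENNReal.tendsto_ofReal h1
    rw [ENNReal.ofReal_zero] at h2
    simpa using ENNReal.Tendsto.const_mul (a := ENNReal.ofReal (s ^ (-β))) h2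
      (Or.inr ENNReal.ofReal_ne_top)

/-- The exponential weight replaces smallness of T or of the solutions: the weighted supremum m of
the difference satisfies m ≤ m/2. -/
theorem mild_solution_unique {ν : ℝ} {φ : E3 → ℝ} {p ε T : ℝ} (hν : 0 < ν) (hφ : IsCutoff φ)
    (hp : 3 / 2 < p) (hp3 : p < 3) (hε : 0 ≤ ε) (hT : 0 < T) {w₀ : E3 → E3} {g : ℝ → E3 → E3}
    {v v' : ℝ → E3 → E3} (hv : MemF0 p T v) (hv' : MemF0 p T v')
    (hs : IsMildSolution ν φ ε T w₀ g v) (hs' : IsMildSolution ν φ ε T w₀ g v') :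
    ∀ t ∈ Icc (0 : ℝ) T, v t =ᵐ[volume] v' t := by
  have hp0 : 0 < p := by linarith
  have hp1 : 1 ≤ p := by linarith
  have hβ : 3 / (2 * p) < 1 := by rw [div_lt_one (by linarith)]; linarith
  obtain ⟨u, mu, bu, eu⟩ := exists_measurable_rep hp0 hv.measurable
  obtain ⟨u', mu', bu', eu'⟩ := exists_measurable_rep hp0 hv'.measurable
  set A := normF0 p T v + normF0 p T v' with hA
  have hAt : A < ⊤ := ENNReal.add_lt_top.2 ⟨hv.norm_lt_top, hv'.norm_lt_top⟩
  have bA : ∀ s, vn p (u s) ≤ A := fun s => (bu s).trans le_self_add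
  have bA' : ∀ s, vn p (u' s) ≤ A := fun s => (bu' s).trans le_add_self
  set K := 2 * (6 * triConst ν φ p) * A with hK
  have hKt : K < ⊤ := ENNReal.mul_lt_top (ENNReal.mul_lt_top (by simp)
    (ENNReal.mul_lt_top (by simp) (triConst_lt_top hν hφ hp hp3))) hAt
  obtain ⟨l, hl⟩ := exists_exp_weight hβ hT hKt
  set E : ℝ → ℝ≥0∞ := fun s => ENNReal.ofReal (Real.exp (l * s)) with hE
  have hE0 : ∀ s, E s ≠ 0 := fun s => by simp [hE, Real.exp_pos]
  have hEt : ∀ s, E s ≠ ⊤ := fun s => ENNReal.ofReal_ne_top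
  set m : ℝ≥0∞ := ⨆ s ∈ Icc (0 : ℝ) T, (E s)⁻¹ * vn p (v s - v' s) with hm
  have hle : ∀ s ∈ Icc (0 : ℝ) T, vn p (v s - v' s) ≤ m * E s := by
    intro s hs
    have h1 : (E s)⁻¹ * vn p (v s - v' s) ≤ m :=
      le_iSup₂ (f := fun s (_ : s ∈ Icc (0 : ℝ) T) => (E s)⁻¹ * vn p (v s - v' s)) s hs
    calc _ = (E s)⁻¹ * vn p (v s - v' s) * E s := by
          rw [mul_comm, ← mul_assoc, ENNReal.mul_inv_cancel (hE0 s) (hEt s), one_mul]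
      _ ≤ _ := by gcongr
  -- Finiteness is needed to conclude m = 0 from m ≤ m/2.
  have hmt : m < ⊤ := by
    have hb : ∀ s ∈ Icc (0 : ℝ) T, (E s)⁻¹ * vn p (v s - v' s) ≤
        ENNReal.ofReal (Real.exp (|l| * T)) * A := by
      intro s hs
      refine mul_le_mul' ?_ ?_
      · rw [hE, ← ENNReal.ofReal_inv_of_pos (Real.exp_pos _), ← Real.exp_neg]
        refine ENNReal.ofReal_le_ofReal (Real.exp_le_exp.2 ?_)
        have h1 := neg_abs_le l
        have h2 := hs.1
        have h3 := hs.2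
        nlinarith [abs_nonneg l]
      · rw [← eLpNorm_eq_vn hp0]
        refine (eLpNorm_sub_le (hv.memLp s hs).1 (hv'.memLp s hs).1
          (by simpa using hp1)).trans (add_le_add ?_ ?_)
        · exact le_iSup₂ (f := fun t (_ : t ∈ Icc (0 : ℝ) T) =>
            eLpNorm (v t) (ENNReal.ofReal p) volume) s hs
        · exact le_iSup₂ (f := fun t (_ : t ∈ Icc (0 : ℝ) T) =>
            eLpNorm (v' t) (ENNReal.ofReal p) volume) s hs
    exact (iSup₂_le hb).trans_lt (ENNReal.mul_lt_top ENNReal.ofReal_lt_top hAt)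
  have hstep : ∀ t ∈ Icc (0 : ℝ) T, (E t)⁻¹ * vn p (v t - v' t) ≤ 2⁻¹ * m := by
    intro t ht
    have ev : ∀ x, bil ν φ ε v v t x = bil ν φ ε u u t x :=
      bil_congr ht.1 (ae_restrict_Ioo_of_Icc ht.2 eu) (ae_restrict_Ioo_of_Icc ht.2 eu)
    have ev' : ∀ x, bil ν φ ε v' v' t x = bil ν φ ε u' u' t x :=
      bil_congr ht.1 (ae_restrict_Ioo_of_Icc ht.2 eu') (ae_restrict_Ioo_of_Icc ht.2 eu')
    rcases eq_or_lt_of_le ht.1 with h0 | h0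
    · subst h0
      have : v 0 - v' 0 =ᵐ[volume] 0 := by
        filter_upwards [hs 0 ht, hs' 0 ht] with x h1 h2
        rw [Pi.sub_apply, h1, h2, bil_zero_time, bil_zero_time, sub_self]
        rfl
      rw [vn_congr this, vn_zero hp0, mul_zero]
      exact zero_le
    have I : ∀ {a b : ℝ → E3 → E3}, Measurable (Function.uncurry a) →
        Measurable (Function.uncurry b) → (∀ s, vn p (a s) ≤ A) → (∀ s, vn p (b s) ≤ A) →
        ∀ᵐ x, BilInt ν φ ε a b t x := fun ma mb ha hb =>
      ae_bilInt_of_bound hν hφ hp hp3 hε ma mb h0 le_rfl (by norm_num)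
        (ENNReal.mul_lt_top hAt hAt) fun s _ => by simpa using mul_le_mul' (ha s) (hb s)
    have hid : v t - v' t =ᵐ[volume] bil ν φ ε (u - u') u t + bil ν φ ε u' (u - u') t := by
      filter_upwards [hs t ht, hs' t ht, I mu mu bA bA, I mu' mu bA' bA, I mu' mu' bA' bA']
        with x h1 h2 h3 h4 h5
      rw [Pi.sub_apply, h1, h2, ev, ev', Pi.add_apply,
        bil_sub_left hφ hp hp3 hε h0.le mu mu' (fun s _ => (bA s).trans_lt hAt)
          (fun s _ => (bA' s).trans_lt hAt) h3 h4, bil_sub_right h0.le h4 h5]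
      abel
    have hdiff : ∀ᵐ s ∂(volume.restrict (Ioo 0 t)), vn p ((u - u') s) ≤ m * E s := by
      filter_upwards [ae_restrict_Ioo_of_Icc ht.2 eu, ae_restrict_Ioo_of_Icc ht.2 eu',
        ae_restrict_mem measurableSet_Ioo] with s h1 h2 hs
      have : (u - u') s =ᵐ[volume] v s - v' s := by
        filter_upwards [h1, h2] with x hx hx'
        simp only [Pi.sub_apply, hx, hx']
      rw [vn_congr this]
      exact hle s ⟨hs.1.le, hs.2.le.trans ht.2⟩
    -- Writing e^(ls) = e^(lt) e^(-l(t-s)) takes the weight at time t outside and leaves the small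
    -- integral.
    set L := ∫⁻ s in Ioo 0 t, ENNReal.ofReal ((t - s) ^ (-(3 / (2 * p)))) *
      ENNReal.ofReal (Real.exp (-l * (t - s))) with hL
    have hJ : ∀ {a b : ℝ → E3 → E3}, (∀ᵐ s ∂(volume.restrict (Ioo 0 t)),
        vn p (a s) * vn p (b s) ≤ A * (m * E s)) → bilJ p a b t ≤ A * m * E t * L := by
      intro a b hab
      rw [hL, ← lintegral_const_mul _ (by fun_prop), bilJ]
      refine lintegral_mono_ae ?_
      filter_upwards [hab] with s hs
      have e : E s = E t * ENNReal.ofReal (Real.exp (-l * (t - s))) := by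
        rw [hE, ← ENNReal.ofReal_mul (Real.exp_pos _).le, ← Real.exp_add]
        ring_nf
      calc _ ≤ ENNReal.ofReal ((t - s) ^ (-(3 / (2 * p)))) * (A * (m * E s)) := by
            gcongr ENNReal.ofReal ((t - s) ^ (-(3 / (2 * p)))) * ?_
        _ = _ := by rw [e]; ring
    have mB : ∀ {a b : ℝ → E3 → E3}, Measurable (Function.uncurry a) →
        Measurable (Function.uncurry b) → Measurable (bil ν φ ε a b t) :=
      fun ha hb => measurable_slice (hφ.measurable_bil ν ε ha hb) t
    have mD : Measurable (Function.uncurry (u - u')) := mu.sub mu'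
    have hfin : vn p (v t - v' t) ≤ K * L * m * E t := by
      rw [vn_congr hid]
      refine (vn_add_le hp1 (mB mD mu) (mB mu' mD)).trans ((add_le_add
        (vn_bil_le hν hφ hp hε mD mu h0.le) (vn_bil_le hν hφ hp hε mu' mD h0.le)).trans ?_)
      calc _ ≤ 6 * triConst ν φ p * (A * m * E t * L) + 6 * triConst ν φ p * (A * m * E t * L) := by
            gcongr
            · refine hJ ?_
              filter_upwards [hdiff] with s hs
              rw [mul_comm]
              exact mul_le_mul' (bA s) hs
            · refine hJ ?_
              filter_upwards [hdiff] with s hs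
              exact mul_le_mul' (bA' s) hs
        _ = _ := by rw [hK]; ring
    calc _ ≤ (E t)⁻¹ * (K * L * m * E t) := by gcongr
      _ = K * L * m * ((E t)⁻¹ * E t) := by ring
      _ = K * L * m := by rw [ENNReal.inv_mul_cancel (hE0 t) (hEt t), mul_one]
      _ ≤ 2⁻¹ * m := by
          gcongr
          exact hl t ⟨h0, ht.2⟩
  have hm0 : m = 0 := by
    have h1 : m ≤ 2⁻¹ * m := iSup₂_le hstep
    by_contra hne
    have h2 : 2⁻¹ * m < m := by
      have := ENNReal.half_lt_self hne hmt.ne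
      rwa [div_eq_mul_inv, mul_comm] at this
    exact absurd h1 (not_le.2 h2)
  intro t ht
  have h1 := hle t ht
  rw [hm0, zero_mul, nonpos_iff_eq_zero, ← eLpNorm_eq_vn hp0, eLpNorm_eq_zero_iff
    ((hv.memLp t ht).1.sub (hv'.memLp t ht).1) (by simpa using hp0)] at h1
  filter_upwards [h1] with x hx
  exact sub_eq_zero.1 hx

/-! ### The data of the mild equation -/

theorem HypH.exists_rep {p T : ℝ} (hp : 0 < p) {w₀ : E3 → E3} {g : ℝ → E3 → E3}
    (H : HypH p T w₀ g) : ∃ (w₀' : E3 → E3) (g' : ℝ → E3 → E3), Measurable w₀' ∧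
      Measurable (Function.uncurry g') ∧ w₀ =ᵐ[volume] w₀' ∧
      (∀ s, vn p (g' s) ≤ normF0 p T g) ∧
      ∀ᵐ s ∂(volume.restrict (Icc 0 T)), g s =ᵐ[volume] g' s := by
  obtain ⟨g', h1, h2, h3⟩ := exists_measurable_rep hp H.measurable_force
  obtain ⟨w₀', h4, h5⟩ := H.memLp_init.1
  exact ⟨w₀', g', h4.measurable, h1, h5, h2, h3⟩

/-- The size of the data. -/
def dataN (p T : ℝ) (w₀ : E3 → E3) (g : ℝ → E3 → E3) : ℝ≥0∞ :=
  eLpNorm w₀ (ENNReal.ofReal p) volume + ENNReal.ofReal T * normF0 p T g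

theorem HypH.dataN_lt_top {p T : ℝ} {w₀ : E3 → E3} {g : ℝ → E3 → E3} (H : HypH p T w₀ g) :
    dataN p T w₀ g < ⊤ :=
  ENNReal.add_lt_top.2 ⟨H.memLp_init.2, ENNReal.mul_lt_top ENNReal.ofReal_lt_top H.force_bounded⟩

theorem normF1_slice_eq {p : ℝ} (hp : 0 < p) {t : ℝ} {w : E3 → E3}
    {U : Option (Fin 3) → ℝ → E3 → E3} (hw : w =ᵐ[volume] U none t)
    (hU : ∀ k, HasWeakPartial k (U none t) (U (some k) t)) :
    eLpNorm w (ENNReal.ofReal p) volume +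
      ENNReal.ofReal (t ^ (1 / 2 : ℝ)) * ∑ k : Fin 3, weakPartialNorm p k w = nrmD p U t := by
  unfold nrmD
  rw [eLpNorm_congr_ae hw, eLpNorm_eq_vn hp]
  simp only [weakPartialNorm_congr_ae hw, fun k => (hU k).weakPartialNorm_eq hp]

theorem normF1_le {p T : ℝ} (hp : 0 < p) {w : ℝ → E3 → E3} {U : Option (Fin 3) → ℝ → E3 → E3}
    {b : ℝ≥0∞} (hw : ∀ t ∈ Ioc 0 T, w t =ᵐ[volume] U none t)
    (hU : ∀ t ∈ Ioc 0 T, ∀ k, HasWeakPartial k (U none t) (U (some k) t))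
    (h0 : eLpNorm (w 0) (ENNReal.ofReal p) volume ≤ b) (hb : ∀ t ∈ Ioc 0 T, nrmD p U t ≤ b) :
    normF1 p T w ≤ b := by
  refine iSup₂_le fun t ht => ?_
  rcases eq_or_lt_of_le ht.1 with rfl | h
  · rw [Real.zero_rpow (by norm_num), ENNReal.ofReal_zero, zero_mul, add_zero]
    exact h0
  · rw [normF1_slice_eq hp (hw t ⟨h, ht.2⟩) (hU t ⟨h, ht.2⟩)]
    exact hb t ⟨h, ht.2⟩

theorem le_normF1 {p T : ℝ} {w : ℝ → E3 → E3} {t : ℝ} (ht : t ∈ Icc 0 T) :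
    eLpNorm (w t) (ENNReal.ofReal p) volume + ENNReal.ofReal (t ^ (1 / 2 : ℝ)) *
      ∑ k : Fin 3, weakPartialNorm p k (w t) ≤ normF1 p T w :=
  le_iSup₂ (f := fun t (_ : t ∈ Icc (0 : ℝ) T) => eLpNorm (w t) (ENNReal.ofReal p) volume +
    ENNReal.ofReal (t ^ (1 / 2 : ℝ)) * ∑ k : Fin 3, weakPartialNorm p k (w t)) t ht

theorem eLpNorm_le_normF1 {p T : ℝ} {w : ℝ → E3 → E3} {t : ℝ} (ht : t ∈ Icc 0 T) :
    eLpNorm (w t) (ENNReal.ofReal p) volume ≤ normF1 p T w :=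
  le_self_add.trans (le_normF1 ht)

/-- The heat potential of the data, together with its partial derivatives. -/
def dataD (ν : ℝ) (w₀ : E3 → E3) (g : ℝ → E3 → E3) : Option (Fin 3) → ℝ → E3 → E3
  | none => mildData ν w₀ g
  | some k => duh (heatD ν k) w₀ g

section potential

variable {ν p T : ℝ} {w₀ : E3 → E3} {g : ℝ → E3 → E3}

theorem nrmD_dataD_le (hν : 0 < ν) (hp : 1 < p) (hw : Measurable w₀)
    (hg : Measurable (Function.uncurry g)) {b : ℝ≥0∞} (hb : ∀ s, vn p (g s) ≤ b) {t : ℝ}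
    (ht : 0 < t) :
    nrmD p (dataD ν w₀ g) t ≤ 4 * dataC ν * (vn p w₀ + ENNReal.ofReal t * b) :=
  (nrmD_le_of_bounds (U := dataD ν w₀ g) ht (vn_mildData_le hν hp hw hg hb ht)
    (vn_duh_heatD_le hν hp hw hg hb ht)).trans (le_of_eq (by ring))

theorem exists_data_rep (hν : 0 < ν) (hp : 1 < p) (H : HypH p T w₀ g) :
    MemF1 p T (mildData ν w₀ g) ∧
    normF1 p T (mildData ν w₀ g) ≤ (4 * dataC ν + 1) * dataN p T w₀ g ∧
    (∃ W : Option (Fin 3) → ℝ → E3 → E3, (∀ k, Tame p T k (W none) (W (some k))) ∧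
      (∀ t ∈ Icc 0 T, mildData ν w₀ g t =ᵐ[volume] W none t) ∧
      ∀ t ∈ Ioc 0 T, nrmD p W t ≤ normF1 p T (mildData ν w₀ g)) ∧
    ∀ t ∈ Ioc 0 T, ∀ᵐ x, DuhInt (heatKernel ν) w₀ g t x := by
  have hp0 : 0 < p := by linarith
  obtain ⟨w₀', g', mw, mg, ew, bg, eg⟩ := H.exists_rep hp0
  have nw : vn p w₀' = eLpNorm w₀ (ENNReal.ofReal p) volume := by
    rw [← eLpNorm_eq_vn hp0, eLpNorm_congr_ae ew]
  have nwt : vn p w₀' < ⊤ := nw ▸ H.memLp_init.2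
  have hN : ∀ t ∈ Ioc 0 T, vn p w₀' + ENNReal.ofReal t * normF0 p T g ≤ dataN p T w₀ g := by
    intro t ht
    rw [nw, dataN]
    gcongr
    exact ht.2
  have tame : ∀ k, Tame p T k (dataD ν w₀' g' none) (dataD ν w₀' g' (some k)) :=
    tame_mildData hν hp mw mg nwt bg H.force_bounded
  have epos : ∀ t ∈ Ioc 0 T, mildData ν w₀ g t = mildData ν w₀' g' t := fun t ht =>
    mildData_congr_of_pos ht.1 ew (ae_restrict_Ioo_of_Icc ht.2 eg)
  have eae : ∀ t ∈ Icc 0 T, mildData ν w₀ g t =ᵐ[volume] dataD ν w₀' g' none t := by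
    intro t ht
    rcases eq_or_lt_of_le ht.1 with rfl | h
    · simp only [dataD, mildData_zero]
      exact ew
    · exact (epos t ⟨h, ht.2⟩).eventuallyEq
  have wp : ∀ t ∈ Ioc 0 T, ∀ k,
      HasWeakPartial k (dataD ν w₀' g' none t) (dataD ν w₀' g' (some k) t) :=
    fun t ht k => (tame k).hasWeakPartial hp ht
  have mm := measurable_mildData ν mw mg
  -- The 4 is one field plus three derivatives; the added 1 covers t = 0, where the initial datum
  -- enters with constant one.
  have bound : normF1 p T (mildData ν w₀ g) ≤ (4 * dataC ν + 1) * dataN p T w₀ g := by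
    refine normF1_le hp0 (fun t ht => eae t ⟨ht.1.le, ht.2⟩) wp ?_ fun t ht => ?_
    · rw [mildData_zero]
      calc _ ≤ 1 * dataN p T w₀ g := by rw [one_mul]; exact le_self_add
        _ ≤ _ := by gcongr; exact le_add_self
    · refine (nrmD_dataD_le hν hp mw mg bg ht.1).trans ?_
      gcongr
      · exact le_self_add
      · exact hN t ht
  have btop : normF1 p T (mildData ν w₀ g) < ⊤ :=
    bound.trans_lt (ENNReal.mul_lt_top (ENNReal.add_lt_top.2
      ⟨ENNReal.mul_lt_top (by simp) (dataC_lt_top hν), by simp⟩) H.dataN_lt_top)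
  refine ⟨⟨?_, fun t ht => ?_, btop⟩, bound, ⟨dataD ν w₀' g', tame, eae, fun t ht => ?_⟩,
    fun t ht => ?_⟩
  -- The two heat flows agree everywhere for t > 0, and the slice t = 0 is null.
  · refine mm.aestronglyMeasurable.congr ?_
    have h1 : ∀ᵐ s ∂(volume.restrict (Icc 0 T)), s ∈ Ioc 0 T := by
      filter_upwards [ae_restrict_mem measurableSet_Icc,
        ae_restrict_of_ae (Measure.ae_ne volume (0 : ℝ))] with s h2 h3
      exact ⟨lt_of_le_of_ne h2.1 h3.symm, h2.2⟩
    filter_upwards [Measure.quasiMeasurePreserving_fst.ae h1] with q hq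
    exact congrFun (epos q.1 hq).symm q.2
  · refine ⟨(measurable_slice mm t).aestronglyMeasurable.congr (eae t ht).symm, ?_⟩
    exact (eLpNorm_le_normF1 ht).trans_lt btop
  · rw [← normF1_slice_eq hp0 (eae t ⟨ht.1.le, ht.2⟩) (wp t ht)]
    exact le_normF1 ⟨ht.1.le, ht.2⟩
  · have hJ := (duhJ_heatKernel_le (p := p) (w₀ := w₀') hν bg ht.1).trans_lt
      (ENNReal.mul_lt_top (dataC_lt_top hν) ((hN t ht).trans_lt H.dataN_lt_top))
    have hsub : Ioo 0 t ⊆ Icc 0 T := fun s hs => ⟨hs.1.le, hs.2.le.trans ht.2⟩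
    have eprod := ae_prod_of_ae_ae (μ := volume.restrict (Ioo 0 t)) (f := g) (g := g')
      (H.measurable_force.mono_measure (Measure.prod_mono
        (Measure.restrict_mono hsub le_rfl) le_rfl)) mg (ae_restrict_Ioo_of_Icc ht.2 eg)
    filter_upwards [ae_duhInt hp (measurable_heatKernel_uncurry ν) mw mg hJ] with x hx
    refine ⟨hx.1.congr ?_, hx.2.congr ?_⟩
    · filter_upwards [ew] with y hy
      rw [hy]
    · filter_upwards [eprod] with q hq
      rw [hq]

end potential

/-! ### Existence -/

theorem exists_mild_solution {ν : ℝ} {φ : E3 → ℝ} {p ε T : ℝ} (hν : 0 < ν) (hφ : IsCutoff φ)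
    (hp : 3 / 2 < p) (hp3 : p < 3) (hε : 0 ≤ ε) (hT : 0 < T) {w₀ : E3 → E3} {g : ℝ → E3 → E3}
    (H : HypH p T w₀ g)
    (hsmall : 56 * bilC ν φ p T * normF1 p T (mildData ν w₀ g) ≤ 1) :
    ∃ w : ℝ → E3 → E3, MemF1 p T w ∧ IntegralsConverge ν φ ε T w₀ g w ∧
      IsMildSolution ν φ ε T w₀ g w ∧ normF1 p T w ≤ 2 * normF1 p T (mildData ν w₀ g) := by
  have hp0 : 0 < p := by linarith
  obtain ⟨hmem, -, ⟨W, hW, eW, bW⟩, hduh⟩ := exists_data_rep hν (by linarith) H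
  set M := normF1 p T (mildData ν w₀ g) with hM
  have hMt : M < ⊤ := hmem.norm_lt_top
  have h2M : 2 * M < ⊤ := ENNReal.mul_lt_top (by simp) hMt
  obtain ⟨U, mU, bU, wU, eU⟩ := exists_fixed_point hν hφ hp hp3 hε hW hMt bW hsmall
  have sol : IsMildSolution ν φ ε T w₀ g (U none) := by
    intro t ht
    filter_upwards [eU t ht, eW t ht] with x h1 h2
    rw [h1, h2]
  have e0 : U none 0 =ᵐ[volume] mildData ν w₀ g 0 := by
    filter_upwards [sol 0 ⟨le_rfl, hT.le⟩] with x hx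
    rw [hx, bil_zero_time, add_zero]
  have n0 : eLpNorm (U none 0) (ENNReal.ofReal p) volume ≤ 2 * M := by
    rw [eLpNorm_congr_ae e0, two_mul]
    exact (eLpNorm_le_normF1 ⟨le_rfl, hT.le⟩).trans le_self_add
  have hnorm : normF1 p T (U none) ≤ 2 * M :=
    normF1_le hp0 (fun t _ => Filter.EventuallyEq.rfl) wU n0 bU
  have hvn : ∀ t ∈ Icc 0 T, vn p (U none t) < ⊤ := fun t ht => by
    rw [← eLpNorm_eq_vn hp0]
    exact ((eLpNorm_le_normF1 ht).trans hnorm).trans_lt h2M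
  refine ⟨U none, ⟨(mU none).aestronglyMeasurable, fun t ht =>
    memLp_of_vn hp0 (mU.slice none t) (hvn t ht), hnorm.trans_lt h2M⟩,
    ⟨fun t ht => (hduh t ht).mono fun x hx => hx.1, fun t ht => ?_, fun t ht =>
      hφ.ae_integrable_biotSavart hp hp3 hε (mU.slice none t) (hvn t ht), fun t ht => ?_⟩,
    sol, hnorm⟩
  · rcases eq_or_lt_of_le ht.1 with rfl | h
    · simp
    · exact (hduh t ⟨h, ht.2⟩).mono fun x hx => hx.2
  · rcases eq_or_lt_of_le ht.1 with rfl | h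
    · simp
    · exact ae_bilInt_of_bound hν hφ hp hp3 hε (mU none) (mU none) h le_rfl (by norm_num)
        (ENNReal.mul_lt_top h2M h2M) (products_bound bU bU ⟨h, ht.2⟩).1

/-- The constant of the bilinear operator on [0,T] is T^(1-3/(2p)) times a number depending on p, ν
and φ only, and the heat flow is linearly controlled by the data. The threshold 1/(c+1) stays valid
when c = 0. -/
theorem exists_smallness {ν : ℝ} {φ : E3 → ℝ} {p : ℝ} (hν : 0 < ν) (hφ : IsCutoff φ)
    (hp : 3 / 2 < p) (hp3 : p < 3) : ∃ Γ₀ : ℝ, 0 < Γ₀ ∧ ∀ (T : ℝ) (N M : ℝ≥0∞),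
      ENNReal.ofReal (T ^ (1 - 3 / (2 * p))) * N < ENNReal.ofReal Γ₀ →
      M ≤ (4 * dataC ν + 1) * N → 56 * bilC ν φ p T * M ≤ 1 := by
  set C := 6 * triConst ν φ p * ENNReal.ofReal (betaC (3 / (2 * p)) (1 / 2)) with hC
  have hCt : C < ⊤ := ENNReal.mul_lt_top (ENNReal.mul_lt_top (by simp)
    (triConst_lt_top hν hφ hp hp3)) ENNReal.ofReal_lt_top
  set c := 56 * C * (4 * dataC ν + 1) with hc
  have hct : c < ⊤ := ENNReal.mul_lt_top (ENNReal.mul_lt_top (by simp) hCt)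
    (ENNReal.add_lt_top.2 ⟨ENNReal.mul_lt_top (by simp) (dataC_lt_top hν), by simp⟩)
  refine ⟨(c.toReal + 1)⁻¹, by positivity, fun T N M hN hM => ?_⟩
  calc 56 * bilC ν φ p T * M ≤ 56 * bilC ν φ p T * ((4 * dataC ν + 1) * N) := by gcongr
    _ = c * (ENNReal.ofReal (T ^ (1 - 3 / (2 * p))) * N) := by
      rw [bilC, ← hC, hc]
      ring
    _ ≤ c * ENNReal.ofReal (c.toReal + 1)⁻¹ := by gcongr
    _ = ENNReal.ofReal (c.toReal * (c.toReal + 1)⁻¹) := by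
      rw [ENNReal.ofReal_mul ENNReal.toReal_nonneg, ENNReal.ofReal_toReal hct.ne]
    _ ≤ 1 := by
      rw [ENNReal.ofReal_le_one, ← div_eq_mul_inv, div_le_one (by positivity)]
      linarith

end

end VortexMild

/-! ### Assembly of uniqueness and existence. -/

theorem mainTheorem3 (ν : ℝ) (hν : 0 < ν) (φ : VortexMild.E3 → ℝ) (hφ : VortexMild.IsCutoff φ)
    (p : ℝ) (hp : 3 / 2 < p) (hp3 : p < 3) :
    (∀ T : ℝ, 0 < T → ∀ (w₀ : VortexMild.E3 → VortexMild.E3)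
        (g : ℝ → VortexMild.E3 → VortexMild.E3), VortexMild.HypH p T w₀ g →
      ∀ ε : ℝ, 0 ≤ ε → ∀ v v' : ℝ → VortexMild.E3 → VortexMild.E3,
        VortexMild.MemF0 p T v → VortexMild.MemF0 p T v' →
        VortexMild.IsMildSolution ν φ ε T w₀ g v → VortexMild.IsMildSolution ν φ ε T w₀ g v' →
        ∀ t ∈ Icc (0 : ℝ) T, v t =ᵐ[volume] v' t) ∧
    (∃ Γ₀ : ℝ, 0 < Γ₀ ∧
      ∀ T : ℝ, 0 < T → ∀ (w₀ : VortexMild.E3 → VortexMild.E3)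
        (g : ℝ → VortexMild.E3 → VortexMild.E3), VortexMild.HypH p T w₀ g →
        ENNReal.ofReal (T ^ (1 - 3 / (2 * p))) *
            (eLpNorm w₀ (ENNReal.ofReal p) volume + ENNReal.ofReal T * VortexMild.normF0 p T g)
          < ENNReal.ofReal Γ₀ →
        VortexMild.MemF1 p T (VortexMild.mildData ν w₀ g) ∧
        ∃ w : ℝ → ℝ → VortexMild.E3 → VortexMild.E3,
          (∀ ε : ℝ, 0 ≤ ε → VortexMild.MemF1 p T (w ε) ∧
            VortexMild.IntegralsConverge ν φ ε T w₀ g (w ε) ∧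
            VortexMild.IsMildSolution ν φ ε T w₀ g (w ε)) ∧
          (⨆ ε ∈ Ici (0 : ℝ), VortexMild.normF1 p T (w ε)) ≤
            2 * VortexMild.normF1 p T (VortexMild.mildData ν w₀ g)) := by
  refine ⟨fun T hT w₀ g _ ε hε v v' hv hv' hs hs' =>
    VortexMild.mild_solution_unique hν hφ hp hp3 hε hT hv hv' hs hs', ?_⟩
  obtain ⟨Γ₀, hΓ, hsmall⟩ := VortexMild.exists_smallness hν hφ hp hp3
  refine ⟨Γ₀, hΓ, fun T hT w₀ g H hlt => ?_⟩
  obtain ⟨hmem, hle, -⟩ := VortexMild.exists_data_rep hν (by linarith) H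
  -- The condition on ε sits inside the existential, with a dummy field for negative ε, so that
  -- choice yields a family indexed by all reals.
  have key : ∀ ε : ℝ, ∃ w : ℝ → VortexMild.E3 → VortexMild.E3, 0 ≤ ε →
      VortexMild.MemF1 p T w ∧ VortexMild.IntegralsConverge ν φ ε T w₀ g w ∧
      VortexMild.IsMildSolution ν φ ε T w₀ g w ∧ VortexMild.normF1 p T w ≤
        2 * VortexMild.normF1 p T (VortexMild.mildData ν w₀ g) := by
    intro ε
    by_cases hε : 0 ≤ ε
    · obtain ⟨w, hw⟩ := VortexMild.exists_mild_solution hν hφ hp hp3 hε hT H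
        (hsmall T _ _ hlt hle)
      exact ⟨w, fun _ => hw⟩
    · exact ⟨0, fun h => absurd h hε⟩
  choose w hw using key
  exact ⟨hmem, w, fun ε hε => ⟨(hw ε hε).1, (hw ε hε).2.1, (hw ε hε).2.2.1⟩,
    iSup₂_le fun ε hε => (hw ε hε).2.2.2⟩
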